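/- Let $d\in\mathbb N$, $0<\rho\le 1$, $m\in\mathbb R$, and let $\omega:[0,\infty)\to[0,\infty)$ be a non-quasianalytic weight function: $\omega$ is continuous and increasing, $\omega|_{[0,1]}=0$, $\omega(2t)\le L(\omega(t)+1)$ for some $L\ge1$ and all $t\ge0$, $\int_1^\infty\omega(t)t^{-2}\,dt<\infty$, $\log t=o(\omega(t))$ as $t\to\infty$, and $\varphi(s)=\omega(e^s)$ is convex. Put $\varphi^*(t)=\sup_{s\ge0}\{st-\varphi(s)\}$, $\omega(x)=\omega(|x|)$ for $x\in\mathbb R^d$ (with $|\cdot|$ the Euclidean norm), and $\langle z\rangle=(1+|z|^2)^{1/2}$. Let $a\in \mathrm{GA}^{m,\omega}_\rho$, that is, $a\in C^\infty(\mathbb R^{3d})$ and for every $n\in\mathbb N$, $n\ge 1$, there is $C_n>0$ such that for all $(x,y,\xi)\in\mathbb R^{3d}$ and $\alpha,\beta,\gamma\in\mathbb N_0^d$ $$|D_x^\alpha D_y^\beta D_\xi^\gamma a(x,y,\xi)|\le C_n\Big(\frac{\langle x-y\rangle}{\langle(x,y,\xi)\rangle}\Big)^{\rho|\alpha+\beta+\gamma|}e^{n\rho\varphi^*(|\alpha+\beta+\gamma|/n)}e^{m(\omega(x)+\omega(y)+\omega(\xi))}.$$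 For open $U\subseteq\mathbb R^{2d}$ let $\mathcal D_{(\omega)}(U)$ be the space of all $\Phi\in C^\infty(\mathbb R^{2d})$ with compact support contained in $U$ such that $\sup_{\alpha,\beta,x,y}|D_x^\alpha D_y^\beta\Phi(x,y)|e^{-\lambda\varphi^*(|\alpha+\beta|/\lambda)}<\infty$ for every $\lambda>0$. The formal kernel $K(x,y)=\int_{\mathbb R^d}e^{i(x-y)\xi}a(x,y,\xi)\,d\xi$ is understood in the weak sense $$\langle K,\Phi\rangle=\int_{\mathbb R^d}\Big(\iint_{\mathbb R^{2d}}e^{i(x-y)\xi}a(x,y,\xi)\Phi(x,y)\,dx\,dy\Big)d\xi,\qquad \Phi\in\mathcal D_{(\omega)}(\mathbb R^{2d}).$$ Then the integral over $\xi$ in this definition converges absolutely for every $\Phi\in\mathcal D_{(\omega)}(\mathbb R^{2d})$. Off the diagonal $K$ is given by a function: there is a function, also denoted $K$, such that $\langle K,\Phi\rangle=\iint K(x,y)\Phi(x,y)\,dx\,dy$ for all $\Phi\in\mathcal D_{(\omega)}(\{(x,y):x\ne y\})$. For every $r>0$, with $\Delta_r=\{(x,y)\in\mathbb R^{2d}:|x-y|<r\}$,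 this function satisfies: 1. $K\in C^\infty(\mathbb R^{2d}\setminus\overline{\Delta_r})$; 2. for every $\lambda>0$ there is $C_\lambda>0$ (depending on $r$) such that for all $(x,y)\in\mathbb R^{2d}\setminus\Delta_r$ and all $\alpha,\beta\in\mathbb N_0^d$ $$|D_x^\alpha D_y^\beta K(x,y)|\le C_\lambda\, e^{\lambda\varphi^*(|\alpha+\beta|/\lambda)}e^{-\lambda\omega(x)}e^{-\lambda\omega(y)}.$$ -/

import Mathlib

open Set Filter Topology MeasureTheory

namespace FormalKernel

noncomputable section

/-- Non-quasianalytic weight functions in the sense of Braun, Meise and Taylor, normalised by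
`ω = 0` on `[0, 1]`. Only the values of `ω` on `[0, ∞)` matter; `ω` is extended radially, so that
`ω(x)` means `ω ‖x‖` for a vector `x`. -/
structure IsWeight (ω : ℝ → ℝ) : Prop where
  continuousOn : ContinuousOn ω (Ici 0)
  monotoneOn : MonotoneOn ω (Ici 0)
  nonneg : ∀ t, 0 ≤ t → 0 ≤ ω t
  /-- condition (α) -/
  doubling : ∃ L : ℝ, 1 ≤ L ∧ ∀ t, 0 ≤ t → ω (2 * t) ≤ L * (ω t + 1)
  /-- condition (β), non-quasianalyticity -/
  integrable : IntegrableOn (fun t => ω t / t ^ 2) (Ioi 1)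
  /-- condition (γ) -/
  log_isLittleO : Real.log =o[atTop] ω
  /-- condition (δ) -/
  convex : ConvexOn ℝ univ (fun s => ω (Real.exp s))
  zero_of_le_one : ∀ t, 0 ≤ t → t ≤ 1 → ω t = 0

/-- The Young conjugate `φ*(t) = sup_{s ≥ 0} (s t - φ(s))` of `φ(s) = ω(e^s)`. By condition (γ)
the supremum is finite for a weight function and `t ≥ 0`. -/
def youngConj (ω : ℝ → ℝ) (t : ℝ) : ℝ :=
  sSup ((fun s => s * t - ω (Real.exp s)) '' Ici 0)

/-- The Euclidean space `ℝ^d`. -/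
abbrev Euc (d : ℕ) : Type := EuclideanSpace ℝ (Fin d)

/-- The `j`-th standard basis vector of `ℝ^d`. -/
def stdVec {d : ℕ} (j : Fin d) : Euc d := EuclideanSpace.single j 1

/-- The length `|α|` of a multi-index. -/
def len {d : ℕ} (α : Fin d → ℕ) : ℕ := ∑ j, α j

section Deriv

variable {V : Type*} [NormedAddCommGroup V] [NormedSpace ℝ V]

/-- The derivative of `f` in the direction `v`. -/
def dirDeriv (v : V) (f : V → ℂ) : V → ℂ := fun p => fderiv ℝ f p v

/-- `∂_{e 0}^{α 0} ⋯ ∂_{e (d-1)}^{α (d-1)} f`, for directions `e 0, …, e (d-1)`. The operators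
`D = -i ∂` give the same absolute values. -/
def multiDeriv {d : ℕ} (e : Fin d → V) (α : Fin d → ℕ) (f : V → ℂ) : V → ℂ :=
  (List.finRange d).foldr (fun j g => (dirDeriv (e j))^[α j] g) f

end Deriv

/-- `∂_x^α ∂_y^β f` for a function `f(x, y)`. -/
def deriv₂ {d : ℕ} (α β : Fin d → ℕ) (f : Euc d × Euc d → ℂ) : Euc d × Euc d → ℂ :=
  multiDeriv (fun j => (stdVec j, 0)) α (multiDeriv (fun j => (0, stdVec j)) β f)

/-- `∂_x^α ∂_y^β ∂_ξ^γ f` for a function `f(x, y, ξ)`. -/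
def deriv₃ {d : ℕ} (α β γ : Fin d → ℕ) (f : Euc d × Euc d × Euc d → ℂ) :
    Euc d × Euc d × Euc d → ℂ :=
  multiDeriv (fun j => (stdVec j, 0, 0)) α
    (multiDeriv (fun j => (0, stdVec j, 0)) β
      (multiDeriv (fun j => (0, 0, stdVec j)) γ f))

/-- The class `GA^{m,ω}_ρ` of global amplitudes `a(x, y, ξ)`. Here
`√(1 + ‖x - y‖²) = ⟨x - y⟩` and `√(1 + ‖x‖² + ‖y‖² + ‖ξ‖²) = ⟨(x, y, ξ)⟩`. -/
def IsAmplitude {d : ℕ} (ω : ℝ → ℝ) (ρ m : ℝ) (a : Euc d × Euc d × Euc d → ℂ) : Prop :=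
  ContDiff ℝ (⊤ : ℕ∞) a ∧
  ∀ n : ℕ, 1 ≤ n → ∃ C : ℝ, 0 < C ∧
    ∀ (x y ξ : Euc d) (α β γ : Fin d → ℕ),
      ‖deriv₃ α β γ a (x, y, ξ)‖ ≤
        C * (√(1 + ‖x - y‖ ^ 2) / √(1 + ‖x‖ ^ 2 + ‖y‖ ^ 2 + ‖ξ‖ ^ 2))
              ^ (ρ * ((len α + len β + len γ : ℕ) : ℝ))
          * Real.exp (n * ρ * youngConj ω (((len α + len β + len γ : ℕ) : ℝ) / n))
          * Real.exp (m * (ω ‖x‖ + ω ‖y‖ + ω ‖ξ‖))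

/-- The strip `Δ_r = {(x, y) : |x - y| < r}` around the diagonal of `ℝ^{2d}`. -/
def strip (d : ℕ) (r : ℝ) : Set (Euc d × Euc d) := {p | ‖p.1 - p.2‖ < r}

/-- The space `𝓓_(ω)(U)` of ultradifferentiable test functions of Beurling type with compact
support in the set `U ⊆ ℝ^{2d}`. -/
def IsTestFunction {d : ℕ} (ω : ℝ → ℝ) (U : Set (Euc d × Euc d)) (Φ : Euc d × Euc d → ℂ) : Prop :=
  ContDiff ℝ (⊤ : ℕ∞) Φ ∧ HasCompactSupport Φ ∧ tsupport Φ ⊆ U ∧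
  ∀ lam : ℝ, 0 < lam → ∃ C : ℝ, ∀ (p : Euc d × Euc d) (α β : Fin d → ℕ),
    ‖deriv₂ α β Φ p‖ ≤
      C * Real.exp (lam * youngConj ω (((len α + len β : ℕ) : ℝ) / lam))

/-- The pairing `∬ e^{i (x - y) · ξ} a(x, y, ξ) Φ(x, y) dx dy` of the function
`(x, y) ↦ e^{i (x - y) · ξ} a(x, y, ξ)`, for fixed `ξ`, with a test function `Φ`. -/
def slicePairing {d : ℕ} (a : Euc d × Euc d × Euc d → ℂ) (Φ : Euc d × Euc d → ℂ) (ξ : Euc d) : ℂ :=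
  ∫ p : Euc d × Euc d,
    Complex.exp (Complex.I * ((inner ℝ (p.1 - p.2) ξ : ℝ) : ℂ)) * a (p.1, p.2, ξ) * Φ p

/-- The formal kernel `K = ∫ e^{i (x - y) · ξ} a(x, y, ξ) dξ`, understood (as the integral need not
converge pointwise) as the ultradistribution
`⟨K, Φ⟩ = ∫ (∬ e^{i (x - y) · ξ} a(x, y, ξ) Φ(x, y) dx dy) dξ`. -/
def formalKernel {d : ℕ} (a : Euc d × Euc d × Euc d → ℂ) (Φ : Euc d × Euc d → ℂ) : ℂ :=
  ∫ ξ : Euc d, slicePairing a Φ ξ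

end

end FormalKernel

/-! The amplitude is cut into dyadic pieces `χ_J a`, where `χ_J` lives where `|(x, y, ξ)|` is of
size `2^J` (a cube for `J = 0`). Each piece has a smooth kernel `K_J`, an integral over a compact
set of `ξ`, and `K = ∑ K_J` away from the diagonal.

The heart is the decay of `K_J` where `|x - y| ≥ r`. Choose a coordinate `l` with `|(x - y)_l|`
comparable to `|x - y|` and integrate by parts `N` times in `ξ_l`. A derivative on the cut-off gains
`2^{-J}`, one on `a` gains `(⟨x - y⟩ / 2^J)^ρ`, and the resulting `⟨x - y⟩^N` is cancelled, up to a
factor `B^N`, by the division by `(x - y)_l^N`. With `g_λ(k) = λ φ*(k / λ) = sup_{R ≥ 1} (k log R -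
λ ω(R))`, convexity of `φ` yields for each `R` an order `N` with `e^{g_λ(N)} R^{-N} ≤ R e^{-λ ω(R)}`
(`exists_optimal_order`). Taking `R = 2^J` and `λ` of size `1 / ρ`, so that the power `ρ` of the
gain suffices, makes `K_J` and its derivatives `O(e^{-μ ω(2^J)})` for every `μ`
(`exists_order_decay`, `exists_shell_bound`, `exists_kernelPiece_bound`). Since `K_J` vanishes
unless `x` and `y` are `O(2^J)`, this is also decay in `x` and `y`, with enough left to sum over `J`
(`exists_weighted_bound`).

All losses are geometric factors `B^k`, factorials or powers of `R`. They are absorbed by changing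
`λ`: conditions (α), (β) and (γ) say precisely that the conjugate can pay for them. The cut-offs
must satisfy the bounds `e^{g_λ(k)}` for all `λ`; they arise from infinitely many averages over
intervals whose summable widths come from (β) (`exists_widths`, `exists_cutoff`).

Convergence of the `ξ` integral follows by the same choice of `N`, with integrations by parts in `x`
against `a Φ`. Finally, the partial sums of `∑ ⟨K_J, Φ⟩` equal the `ξ` integral with a smooth
truncation, so both limits agree when `Φ` is supported off the diagonal. -/

namespace FormalKernel

noncomputable section

/-! ### Weight functions and the scaled Young conjugate -/

/-- The scaled Young conjugate `λ φ*(t / λ)`. -/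
def scaledConj (ω : ℝ → ℝ) (lam t : ℝ) : ℝ := lam * youngConj ω (t / lam)

namespace IsWeight

variable {ω : ℝ → ℝ}

/-- Condition (γ), with the bounded range of `t` moved into the constant. It later exchanges powers
of `R` for `e^{ω(R)}`. -/
theorem exists_log_le (hω : IsWeight ω) {ε : ℝ} (hε : 0 < ε) :
    ∃ C : ℝ, 0 ≤ C ∧ ∀ t, 1 ≤ t → Real.log t ≤ ε * ω t + C := by
  have h := hω.log_isLittleO.def hε
  obtain ⟨T, hT⟩ := eventually_atTop.1 h
  refine ⟨Real.log (max T 1), Real.log_nonneg (le_max_right _ _), fun t ht => ?_⟩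
  have h0 := hω.nonneg t (by linarith)
  rcases le_total T t with h1 | h1
  · have := hT t h1
    rw [Real.norm_eq_abs, Real.norm_eq_abs, abs_of_nonneg h0] at this
    have h2 := Real.log_nonneg (le_max_right T 1)
    linarith [le_abs_self (Real.log t)]
  · have : Real.log t ≤ Real.log (max T 1) :=
      Real.log_le_log (by linarith) (h1.trans (le_max_left _ _))
    nlinarith [mul_nonneg hε.le h0]

theorem bddAbove_conj (hω : IsWeight ω) {t : ℝ} (ht : 0 ≤ t) :
    BddAbove ((fun s => s * t - ω (Real.exp s)) '' Ici 0) := by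
  obtain ⟨C, hC, h⟩ := hω.exists_log_le (ε := 1 / (t + 1)) (by positivity)
  refine ⟨t * C, ?_⟩
  rintro _ ⟨s, hs, rfl⟩
  have h1 := h (Real.exp s) (Real.one_le_exp hs)
  rw [Real.log_exp] at h1
  have h0 := hω.nonneg (Real.exp s) (Real.exp_pos _).le
  have h2 : s * t ≤ (1 / (t + 1) * ω (Real.exp s) + C) * t := mul_le_mul_of_nonneg_right h1 ht
  have h3 : 1 / (t + 1) * ω (Real.exp s) * t ≤ ω (Real.exp s) := by
    rw [div_mul_eq_mul_div, div_mul_eq_mul_div, div_le_iff₀ (by positivity)]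
    nlinarith
  simp only
  nlinarith

/-- Substituting `R = e^s` turns the scaled conjugate into `sup_{R ≥ 1} (k log R - λ ω(R))`. This
lemma and the next are the two halves of that description. -/
theorem le_scaledConj (hω : IsWeight ω) {lam k R : ℝ} (hl : 0 < lam) (hk : 0 ≤ k) (hR : 1 ≤ R) :
    k * Real.log R - lam * ω R ≤ scaledConj ω lam k := by
  have h := le_csSup (hω.bddAbove_conj (t := k / lam) (by positivity))
    (mem_image_of_mem _ (Real.log_nonneg hR : Real.log R ∈ Ici 0))
  simp only [Real.exp_log (show (0 : ℝ) < R by linarith)] at h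
  have h2 := mul_le_mul_of_nonneg_left h hl.le
  unfold scaledConj youngConj
  refine le_trans (le_of_eq ?_) h2
  field_simp

theorem scaledConj_le {lam k c : ℝ} (hl : 0 < lam)
    (h : ∀ R, 1 ≤ R → k * Real.log R - lam * ω R ≤ c) : scaledConj ω lam k ≤ c := by
  unfold scaledConj youngConj
  rw [← le_div_iff₀' hl]
  refine csSup_le ((nonempty_Ici (a := (0 : ℝ))).image _) ?_
  rintro _ ⟨s, hs, rfl⟩
  have := h (Real.exp s) (Real.one_le_exp hs)
  rw [Real.log_exp] at this
  rw [le_div_iff₀' hl]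
  refine le_trans (le_of_eq ?_) this
  field_simp

theorem scaledConj_nonneg (hω : IsWeight ω) {lam k : ℝ} (hl : 0 < lam) (hk : 0 ≤ k) :
    0 ≤ scaledConj ω lam k := by
  have := hω.le_scaledConj hl hk le_rfl
  rw [hω.zero_of_le_one 1 zero_le_one le_rfl] at this
  simpa using this

theorem scaledConj_zero_le (hω : IsWeight ω) {lam : ℝ} (hl : 0 < lam) :
    scaledConj ω lam 0 ≤ 0 :=
  scaledConj_le hl fun R hR => by
    have := hω.nonneg R (by linarith)
    nlinarith

theorem scaledConj_anti (hω : IsWeight ω) {lam lam' k : ℝ} (hl : 0 < lam) (h : lam ≤ lam')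
    (hk : 0 ≤ k) : scaledConj ω lam' k ≤ scaledConj ω lam k :=
  scaledConj_le (hl.trans_le h) fun R hR => by
    have := hω.le_scaledConj hl hk hR
    have h0 := hω.nonneg R (by linarith)
    nlinarith

/-- Of two radii the larger serves both logarithms, and one weight term may be dropped. This merges
the two factors in a Leibniz rule. -/
theorem scaledConj_add_le (hω : IsWeight ω) {lam j k : ℝ} (hl : 0 < lam) (hj : 0 ≤ j)
    (hk : 0 ≤ k) : scaledConj ω lam j + scaledConj ω lam k ≤ scaledConj ω lam (j + k) := by
  rw [← le_sub_iff_add_le]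
  refine scaledConj_le hl fun R hR => ?_
  rw [le_sub_iff_add_le, ← le_sub_iff_add_le']
  refine scaledConj_le hl fun R' hR' => ?_
  rw [le_sub_iff_add_le]
  have h0 := hω.nonneg R (by linarith)
  have h0' := hω.nonneg R' (by linarith)
  rcases le_total R R' with h | h
  · have h1 := hω.le_scaledConj hl (add_nonneg hj hk) hR'
    have h2 := Real.log_le_log (by linarith) h
    nlinarith
  · have h1 := hω.le_scaledConj hl (add_nonneg hj hk) hR
    have h2 := Real.log_le_log (by linarith) h
    nlinarith

/-- At a single radius the weight `2 λ ω(R)` is shared equally. At the price of doubling `λ`, it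
separates the derivatives spent on integration by parts from those being estimated. -/
theorem scaledConj_le_add (hω : IsWeight ω) {lam j k : ℝ} (hl : 0 < lam) (hj : 0 ≤ j)
    (hk : 0 ≤ k) :
    scaledConj ω (2 * lam) (j + k) ≤ scaledConj ω lam j + scaledConj ω lam k :=
  scaledConj_le (by positivity) fun R hR => by
    have h1 := hω.le_scaledConj hl hj hR
    have h2 := hω.le_scaledConj hl hk hR
    nlinarith

/-- Condition (α) iterated until `2 ^ n` exceeds `B`. -/
theorem exists_dilation_le (hω : IsWeight ω) (B : ℝ) :
    ∃ A : ℝ, 1 ≤ A ∧ ∀ t, 0 ≤ t → ω (B * t) ≤ A * (ω t + 1) ∨ B < 0 := by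
  obtain ⟨L, hL, h⟩ := hω.doubling
  have key : ∀ n : ℕ, ∃ A : ℝ, 1 ≤ A ∧ ∀ t, 0 ≤ t → ω (2 ^ n * t) ≤ A * (ω t + 1) := by
    intro n
    induction n with
    | zero => exact ⟨1, le_rfl, fun t _ => by simp⟩
    | succ n ih =>
      obtain ⟨A, hA, ih⟩ := ih
      refine ⟨L * (A + 1), by nlinarith, fun t ht => ?_⟩
      have h1 := h (2 ^ n * t) (by positivity)
      have h2 := ih t ht
      have h0 := hω.nonneg t ht
      rw [pow_succ', mul_assoc]
      calc _ ≤ L * (ω (2 ^ n * t) + 1) := h1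
        _ ≤ L * (A * (ω t + 1) + 1) := by gcongr
        _ ≤ L * ((A + 1) * (ω t + 1)) := by gcongr; nlinarith
        _ = _ := by ring
  obtain ⟨n, hn⟩ := pow_unbounded_of_one_lt B (one_lt_two)
  obtain ⟨A, hA, hA'⟩ := key n
  refine ⟨A, hA, fun t ht => ?_⟩
  rcases lt_or_ge B 0 with hB | hB
  · exact Or.inr hB
  · refine Or.inl ((hω.monotoneOn ?_ ?_ ?_).trans (hA' t ht))
    · exact mul_nonneg hB ht
    · exact mul_nonneg (by positivity) ht
    · gcongr

theorem exists_dilation (hω : IsWeight ω) {B : ℝ} (hB : 0 ≤ B) :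
    ∃ A : ℝ, 1 ≤ A ∧ ∀ t, 0 ≤ t → ω (B * t) ≤ A * (ω t + 1) := by
  obtain ⟨A, hA, h⟩ := hω.exists_dilation_le B
  exact ⟨A, hA, fun t ht => (h t ht).resolve_right hB.not_gt⟩

/-- Geometric factors are absorbed by a change of the parameter. -/
theorem exists_geom_absorb (hω : IsWeight ω) {B : ℝ} (hB : 1 ≤ B) {lam : ℝ} (hl : 0 < lam) :
    ∃ lam₀ C : ℝ, 0 < lam₀ ∧ 0 ≤ C ∧ ∀ lam', lam₀ ≤ lam' → ∀ k, 0 ≤ k →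
      k * Real.log B + scaledConj ω lam' k ≤ scaledConj ω lam k + C := by
  obtain ⟨A, hA, h⟩ := hω.exists_dilation (show 0 ≤ B by linarith)
  have hA0 : 0 < lam * A := by positivity
  -- Testing the conjugate at `B * R` produces the term `k log B` and costs `ω (B R) ≤ A (ω R + 1)`.
  -- This explains both the new parameter and the constant.
  refine ⟨lam * A, lam * A, hA0, hA0.le, fun lam' hl' k hk => ?_⟩
  rw [← le_sub_iff_add_le']
  refine scaledConj_le (hA0.trans_le hl') fun R hR => ?_
  have h1 := hω.le_scaledConj hl hk (one_le_mul_of_one_le_of_one_le hB hR)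
  rw [Real.log_mul (by linarith) (by linarith)] at h1
  have h2 := h R (by linarith)
  have h0 := hω.nonneg R (by linarith)
  nlinarith

/-- By monotonicity the integrand is at least `ω(t) / (2t)²` on an interval of length `t`. -/
theorem le_integral_Ioc (hω : IsWeight ω) {t : ℝ} (ht : 1 ≤ t) :
    ω t / (4 * t) ≤ ∫ s in Ioc t (2 * t), ω s / s ^ 2 := by
  have hsub : Ioc t (2 * t) ⊆ Ioi 1 := fun s hs => ht.trans_lt hs.1
  have h3 : ∫ s in Ioc t (2 * t), ω t / (2 * t) ^ 2 ≤ ∫ s in Ioc t (2 * t), ω s / s ^ 2 := by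
    refine setIntegral_mono_on (by simp) (hω.integrable.mono_set hsub)
      measurableSet_Ioc fun s hs => ?_
    have hs0 : 0 < s := by linarith [hs.1]
    have := hω.monotoneOn (show (0 : ℝ) ≤ t by linarith) hs0.le hs.1.le
    have h0 := hω.nonneg s hs0.le
    gcongr
    exact hs.2
  rw [setIntegral_const, measureReal_def, Real.volume_Ioc, ENNReal.toReal_ofReal (by linarith),
    smul_eq_mul] at h3
  have h4 : (2 * t - t) * (ω t / (2 * t) ^ 2) = ω t / (4 * t) := by field_simp; ring
  rwa [h4] at h3

/-- A non-quasianalytic weight function is `o(t)`. -/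
theorem exists_le_small (hω : IsWeight ω) {ε : ℝ} (hε : 0 < ε) :
    ∃ C : ℝ, 0 ≤ C ∧ ∀ t, 0 ≤ t → ω t ≤ ε * t + C := by
  have hnn : ∀ t ∈ Ioi (1 : ℝ), 0 ≤ ω t / t ^ 2 := fun t ht =>
    div_nonneg (hω.nonneg t (by linarith [mem_Ioi.1 ht])) (by positivity)
  -- A tail below `ε / 4` gives `ω t ≤ ε t` beyond `T`, by `le_integral_Ioc`.
  obtain ⟨T, hT1, hT⟩ : ∃ T : ℝ, 1 ≤ T ∧ ∫ t in Ioi T, ω t / t ^ 2 ≤ ε / 4 := by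
    have h := intervalIntegral_tendsto_integral_Ioi 1 hω.integrable tendsto_id
    obtain ⟨T, hT, hT1⟩ :=
      ((h.eventually (lt_mem_nhds (sub_lt_self _ (show 0 < ε / 4 by positivity)))).and
        (eventually_ge_atTop 1)).exists
    refine ⟨T, hT1, ?_⟩
    have h2 := intervalIntegral.integral_interval_add_Ioi hω.integrable
      (hω.integrable.mono_set (Ioi_subset_Ioi hT1))
    simp only [id] at hT
    linarith
  refine ⟨ω T, hω.nonneg T (by linarith), fun t ht => ?_⟩
  rcases le_or_gt t T with h1 | h1
  · have := hω.monotoneOn ht (show (0 : ℝ) ≤ T by linarith) h1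
    nlinarith
  have hsub : Ioc t (2 * t) ⊆ Ioi T := fun s hs => h1.trans hs.1
  have hint := hω.integrable.mono_set (Ioi_subset_Ioi hT1)
  have h2 : ∫ s in Ioc t (2 * t), ω s / s ^ 2 ≤ ∫ t in Ioi T, ω t / t ^ 2 :=
    setIntegral_mono_set hint
      ((ae_restrict_iff' measurableSet_Ioi).2
        (Eventually.of_forall fun s hs => hnn s (hT1.trans_lt hs))) hsub.eventuallyLE
  have := ((hω.le_integral_Ioc (hT1.trans h1.le)).trans h2).trans hT
  rw [div_le_iff₀ (by linarith)] at this
  have := hω.nonneg T (by linarith)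
  linarith

/-- Factorials are absorbed by the Young conjugate. -/
theorem exists_factorial_le (hω : IsWeight ω) {lam : ℝ} (hl : 0 < lam) :
    ∃ C : ℝ, 0 ≤ C ∧ ∀ k : ℕ, Real.log (k.factorial : ℝ) ≤ scaledConj ω lam k + C := by
  obtain ⟨C, hC, h⟩ := hω.exists_le_small (ε := 1 / (lam * Real.exp 1)) (by positivity)
  refine ⟨lam * C, by positivity, fun k => ?_⟩
  rcases Nat.eq_zero_or_pos k with rfl | hk
  · have := hω.scaledConj_nonneg hl (k := ((0 : ℕ) : ℝ)) (by simp)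
    simp only [Nat.factorial_zero, Nat.cast_one, Real.log_one]
    positivity
  have hk1 : (1 : ℝ) ≤ k := by exact_mod_cast hk
  have he : (1 : ℝ) ≤ Real.exp 1 := Real.one_le_exp zero_le_one
  -- The radius is `e k`: then `k log (e k) = k + k log k`, and the extra `k` pays for the weight,
  -- since `ε` was chosen so that `λ ω(e k) ≤ k + λ C`.
  have h1 := hω.le_scaledConj hl (k := (k : ℝ)) (by positivity)
    (one_le_mul_of_one_le_of_one_le he hk1)
  rw [Real.log_mul (by positivity) (by positivity), Real.log_exp] at h1
  have h2 := mul_le_mul_of_nonneg_left (h (Real.exp 1 * k) (by positivity)) hl.le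
  have h3 : lam * (1 / (lam * Real.exp 1) * (Real.exp 1 * k) + C) = k + lam * C := by
    field_simp
  have h4 : Real.log (k.factorial : ℝ) ≤ k * Real.log k := by
    rw [← Real.log_pow]
    exact Real.log_le_log (by positivity) (by exact_mod_cast Nat.factorial_le_pow k)
  linarith

/-- For every `R ≥ 1` there is an order `N` for which `e^{λ φ*(N / λ)} R^{-N}` is about
`e^{-λ ω(R)}`. -/
theorem exists_optimal_order (hω : IsWeight ω) {lam : ℝ} (hl : 0 < lam) {R : ℝ} (hR : 1 ≤ R) :
    ∃ N : ℕ, scaledConj ω lam N - N * Real.log R ≤ Real.log R - lam * ω R := by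
  set s := Real.log R
  have hs : 0 ≤ s := Real.log_nonneg hR
  have hes : Real.exp s = R := Real.exp_log (by linarith)
  set φ : ℝ → ℝ := fun s => ω (Real.exp s) with hφ
  have hsi : s ∈ interior (univ : Set ℝ) := by simp
  -- The slope of a supporting line of the convex function `φ` at `s = log R`; the right derivative
  -- is one.
  obtain ⟨p, hp⟩ : ∃ p : ℝ, ∀ u, φ s + p * (u - s) ≤ φ u := by
    refine ⟨derivWithin φ (Ioi s) s, fun u => ?_⟩
    rcases lt_trichotomy u s with h | rfl | h
    · have h1 := hω.convex.slope_le_leftDeriv_of_mem_interior (mem_univ u) hsi h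
      have h2 := hω.convex.leftDeriv_le_rightDeriv_of_mem_interior hsi
      have h3 := h1.trans h2
      rw [slope_def_field, div_le_iff₀ (by linarith)] at h3
      simp only [hφ] at h3 ⊢
      linarith
    · simp
    · have h1 := hω.convex.rightDeriv_le_slope_of_mem_interior hsi (mem_univ u) h
      rw [slope_def_field, le_div_iff₀ (by linarith)] at h1
      simp only [hφ] at h1 ⊢
      linarith
  have hp0 : 0 ≤ p := by
    have h1 := hp (s - 1)
    have h2 : φ (s - 1) ≤ φ s := hω.monotoneOn (Real.exp_pos _).le (Real.exp_pos _).le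
      (Real.exp_le_exp.2 (by linarith))
    linarith
  -- At order `λ p` the supremum would be attained at `R` itself. Rounding down keeps `N u ≤ λ p u`
  -- for `u ≥ 0` and costs at most one `log R`.
  refine ⟨⌊lam * p⌋₊, ?_⟩
  have hN := Nat.floor_le (show 0 ≤ lam * p by positivity)
  have hN' := (Nat.lt_floor_add_one (lam * p)).le
  set N : ℝ := (⌊lam * p⌋₊ : ℝ)
  rw [sub_le_iff_le_add]
  refine scaledConj_le hl fun R' hR' => ?_
  have h1 := mul_le_mul_of_nonneg_left (hp (Real.log R')) hl.le
  simp only [hφ, hes, Real.exp_log (show (0 : ℝ) < R' by linarith)] at h1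
  have h2 := Real.log_nonneg hR'
  nlinarith

/-- The function `k ↦ λ φ*(k / λ) - k s` is convex and vanishes at `0`. -/
theorem scaledConj_sub_le (hω : IsWeight ω) {lam : ℝ} (hl : 0 < lam) {j k s c : ℝ} (hj : 0 ≤ j)
    (hjk : j ≤ k) (hc : 0 ≤ c) (h : scaledConj ω lam k - k * s ≤ c) :
    scaledConj ω lam j - j * s ≤ c := by
  rw [sub_le_iff_le_add]
  rcases (hj.trans hjk).eq_or_lt with h0 | hk
  · have : j = k := by linarith
    subst this; linarith
  refine scaledConj_le hl fun R hR => ?_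
  have h1 := hω.le_scaledConj hl hk.le hR
  have h2 : k * Real.log R - lam * ω R ≤ k * s + c := by linarith
  have h0 := hω.nonneg R (by linarith)
  have h3 : (j / k) * (k * Real.log R - lam * ω R) ≤ (j / k) * (k * s + c) :=
    mul_le_mul_of_nonneg_left h2 (by positivity)
  have h4 : (j / k) * k = j := by field_simp
  have h5 : j / k ≤ 1 := (div_le_one hk).2 hjk
  have h6 : 0 ≤ j / k := by positivity
  have h7 : 0 ≤ lam * ω R := by positivity
  calc j * Real.log R - lam * ω R
      = (j / k) * k * Real.log R - lam * ω R := by rw [h4]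
    _ ≤ (j / k) * (k * Real.log R - lam * ω R) := by nlinarith
    _ ≤ (j / k) * (k * s + c) := h3
    _ = j * s + (j / k) * c := by rw [mul_add, ← mul_assoc, h4]
    _ ≤ c + j * s := by nlinarith

end IsWeight

end

noncomputable section

/-! ### Non-quasianalytic cut-off functions -/

/-- A convergent series of positive terms still converges after multiplication by suitable weights
tending to infinity. -/
theorem exists_tendsto_atTop_summable_mul {b : ℕ → ℝ} (hb : ∀ j, 0 < b j) (hs : Summable b) :
    ∃ κ : ℕ → ℝ, (∀ j, 0 < κ j) ∧ Tendsto κ atTop atTop ∧ Summable fun j => κ j * b j := by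
  set r : ℕ → ℝ := fun j => ∑' i, b (i + j) with hr
  have hsj : ∀ j, Summable fun i => b (i + j) := fun j => (summable_nat_add_iff j).2 hs
  have hrpos : ∀ j, 0 < r j := fun j => (hsj j).tsum_pos (fun i => (hb _).le) 0 (hb _)
  have hrs : ∀ j, r j = b j + r (j + 1) := fun j => by
    simp only [hr]
    rw [(hsj j).tsum_eq_zero_add, zero_add]
    congr 1
    exact tsum_congr fun i => by congr 1; omega
  -- With `r` the tails of the series, `b j / √(r j) = (r j - r (j+1)) / √(r j) ≤ 2 (√(r j) - √(r
  -- (j+1)))`, which telescopes.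
  refine ⟨fun j => (√(r j))⁻¹, fun j => inv_pos.2 (Real.sqrt_pos.2 (hrpos j)), ?_, ?_⟩
  · refine Tendsto.inv_tendsto_nhdsGT_zero ?_
    refine tendsto_nhdsWithin_iff.2 ⟨?_, Eventually.of_forall fun j => Real.sqrt_pos.2 (hrpos j)⟩
    have h1 := tendsto_sum_nat_add b
    simpa using h1.sqrt
  · refine summable_of_sum_range_le (c := 2 * √(r 0))
      (fun j => mul_nonneg (inv_nonneg.2 (Real.sqrt_nonneg _)) (hb j).le) fun n => ?_
    have key : ∀ n, ∑ j ∈ Finset.range n, (√(r j))⁻¹ * b j ≤ 2 * √(r 0) - 2 * √(r n) := by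
      intro n
      induction n with
      | zero => simp
      | succ n ih =>
        rw [Finset.sum_range_succ]
        have h1 : (√(r n))⁻¹ * b n ≤ 2 * √(r n) - 2 * √(r (n + 1)) := by
          have hp := Real.sqrt_pos.2 (hrpos n)
          rw [inv_mul_le_iff₀ hp]
          have e1 := Real.sq_sqrt (hrpos n).le
          have e2 := Real.sq_sqrt (hrpos (n + 1)).le
          have := hrs n
          nlinarith [sq_nonneg (√(r n) - √(r (n + 1)))]
        linarith
    have := key n
    have := Real.sqrt_nonneg (r n)
    linarith

namespace IsWeight

variable {ω : ℝ → ℝ}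

/-- Condition (β) in condensed form: each dyadic block of the integral dominates a quarter of the
corresponding term. -/
theorem summable_dyadic (hω : IsWeight ω) : Summable fun j : ℕ => ω (2 ^ j) / 2 ^ j := by
  have hnn : ∀ t ∈ Ioi (1 : ℝ), 0 ≤ ω t / t ^ 2 := fun t ht =>
    div_nonneg (hω.nonneg t (by linarith [mem_Ioi.1 ht])) (by positivity)
  have hone : ∀ j : ℕ, (1 : ℝ) ≤ 2 ^ j := fun j => one_le_pow₀ one_le_two
  refine summable_of_sum_range_le (c := 4 * ∫ t in Ioi (1 : ℝ), ω t / t ^ 2)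
    (fun j => div_nonneg (hω.nonneg _ (by positivity)) (by positivity)) fun n => ?_
  have key : ∀ n : ℕ, ∑ j ∈ Finset.range n, ω (2 ^ j) / 2 ^ j ≤
      4 * ∫ t in Ioc (1 : ℝ) (2 ^ n), ω t / t ^ 2 := by
    intro n
    induction n with
    | zero => simp
    | succ n ih =>
      rw [Finset.sum_range_succ]
      have hun : Ioc (1 : ℝ) (2 ^ (n + 1)) = Ioc 1 (2 ^ n) ∪ Ioc (2 ^ n) (2 * 2 ^ n) := by
        rw [Ioc_union_Ioc_eq_Ioc (hone n) (by linarith [hone n]), pow_succ']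
      rw [hun, setIntegral_union (Ioc_disjoint_Ioc_of_le le_rfl) measurableSet_Ioc
        (hω.integrable.mono_set Ioc_subset_Ioi_self)
        (hω.integrable.mono_set fun t ht => (hone n).trans_lt ht.1)]
      have := hω.le_integral_Ioc (hone n)
      have e : ω (2 ^ n) / 2 ^ n = 4 * (ω (2 ^ n) / (4 * 2 ^ n)) := by field_simp
      linarith
  refine (key n).trans ?_
  gcongr
  · exact (ae_restrict_iff' measurableSet_Ioi).2 (Eventually.of_forall hnn)
  · exact hω.integrable
  · exact Ioc_subset_Ioi_self

/-- There is a summable sequence of widths `a i` such that the products `∏_{i < k} 1 / a i` are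
dominated by `e^{λ φ*(k / λ)}` for every `λ`. -/
theorem exists_widths (hω : IsWeight ω) :
    ∃ a : ℕ → ℝ, (∀ i, 0 < a i) ∧ Summable a ∧ ∀ lam, 0 < lam → ∃ C : ℝ, ∀ k : ℕ,
      -∑ i ∈ Finset.range k, Real.log (a i) ≤ scaledConj ω lam k + C := by
  have hω0 : ∀ j : ℕ, 0 ≤ ω (2 ^ j) := fun j => hω.nonneg _ (by positivity)
  have hgeo : Summable fun j : ℕ => ((1 : ℝ) / 2) ^ j :=
    summable_geometric_of_lt_one (by norm_num) (by norm_num)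
  obtain ⟨κ, hκ0, hκ, hsum⟩ := exists_tendsto_atTop_summable_mul
    (b := fun j : ℕ => ω (2 ^ j) / 2 ^ j + (1 / 2) ^ j)
    (fun j => add_pos_of_nonneg_of_pos (div_nonneg (hω0 j) (by positivity)) (by positivity))
    (hω.summable_dyadic.add hgeo)
  -- The sequence of widths consists of `m j` copies of `2⁻ʲ`. Since `κ` tends to infinity, `m j`
  -- eventually exceeds any multiple of `ω(2^j) + 1`, while `∑ m j 2⁻ʲ` still converges; the summand
  -- `(1 / 2) ^ j` above accounts for the `+ 1`.
  set m : ℕ → ℕ := fun j => ⌈κ j * (ω (2 ^ j) + 1)⌉₊ with hm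
  have hm1 : ∀ j, κ j * (ω (2 ^ j) + 1) ≤ m j := fun j => Nat.le_ceil _
  have hmpos : ∀ j, 0 < m j := fun j => Nat.ceil_pos.2 (mul_pos (hκ0 j) (by linarith [hω0 j]))
  have hmsum : Summable fun j => (m j : ℝ) * (1 / 2) ^ j := by
    refine Summable.of_nonneg_of_le (fun j => by positivity) (fun j => ?_) (hsum.add hgeo)
    have h1 : (m j : ℝ) ≤ κ j * (ω (2 ^ j) + 1) + 1 :=
      (Nat.ceil_lt_add_one (mul_nonneg (hκ0 j).le (by linarith [hω0 j]))).le
    calc (m j : ℝ) * (1 / 2) ^ j ≤ (κ j * (ω (2 ^ j) + 1) + 1) * (1 / 2) ^ j := by gcongr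
      _ = _ := by rw [one_div, inv_pow]; field_simp
  set M : ℕ → ℕ := fun j => ∑ i ∈ Finset.range j, m i with hM
  have hMs : ∀ j, M (j + 1) = M j + m j := fun j => Finset.sum_range_succ _ _
  have hMmono : StrictMono M := strictMono_nat_of_lt_succ fun j => by
    rw [hMs]; exact Nat.lt_add_of_pos_right (hmpos j)
  have hex : ∀ k, ∃ j, k < M (j + 1) := fun k =>
    ⟨k, (Nat.lt_succ_self k).trans_le (hMmono.le_apply (x := k + 1))⟩
  -- The block that contains the index `k`: `M (lev k) ≤ k < M (lev k + 1)`.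
  set lev : ℕ → ℕ := fun k => Nat.find (hex k) with hlev
  have hlt : ∀ k, k < M (lev k + 1) := fun k => Nat.find_spec (hex k)
  have hle : ∀ k, M (lev k) ≤ k := fun k => by
    rcases h : lev k with _ | j
    · simp [hM]
    · exact not_lt.1 (Nat.find_min (hex k) (show j < Nat.find (hex k) by
        change j < lev k; omega))
  have hlmono : Monotone lev := fun k k' h => Nat.find_min' _ (h.trans_lt (hlt k'))
  have hlevM : ∀ j i, i < m j → lev (M j + i) = j := fun j i hi => by
    refine le_antisymm (Nat.find_min' _ (by rw [hMs]; omega)) ?_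
    by_contra hcon
    have h1 := hlt (M j + i)
    have h2 : M (lev (M j + i) + 1) ≤ M j := hMmono.monotone (by omega)
    omega
  refine ⟨fun k => (1 / 2) ^ lev k, fun k => by positivity, ?_, ?_⟩
  · refine summable_of_sum_range_le (c := ∑' j, (m j : ℝ) * (1 / 2) ^ j)
      (fun k => by positivity) fun n => ?_
    have key : ∀ j, ∑ k ∈ Finset.range (M j), ((1 : ℝ) / 2) ^ lev k =
        ∑ i ∈ Finset.range j, (m i : ℝ) * (1 / 2) ^ i := by
      intro j
      induction j with
      | zero => simp [hM]
      | succ j ih =>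
        rw [Finset.sum_range_succ, ← ih, hMs, Finset.sum_range_add]
        congr 1
        rw [Finset.sum_congr rfl fun i hi => by rw [hlevM j i (Finset.mem_range.1 hi)]]
        simp
    calc ∑ k ∈ Finset.range n, ((1 : ℝ) / 2) ^ lev k
        ≤ ∑ k ∈ Finset.range (M n), ((1 : ℝ) / 2) ^ lev k :=
          Finset.sum_le_sum_of_subset_of_nonneg
            (Finset.range_subset_range.2 hMmono.le_apply) fun _ _ _ => by positivity
      _ ≤ _ := by
        rw [key]
        exact hmsum.sum_le_tsum _ fun _ _ => by positivity
  · intro lam hl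
    -- The base is `e` because testing the conjugate at `R = 2 ^ lev k` will lose `λ₀ ω(R) ≤ k + 1`,
    -- hence a factor `e^{k+1}`.
    obtain ⟨lam₀, C, hl₀, hC, hab⟩ :=
      hω.exists_geom_absorb (Real.one_le_exp (zero_le_one (α := ℝ))) hl
    obtain ⟨L, hL, hdbl⟩ := hω.doubling
    obtain ⟨j₀, hj₀⟩ := eventually_atTop.1 (hκ.eventually_ge_atTop (L * lam₀))
    have hlog : ∀ k : ℕ, -∑ i ∈ Finset.range (k + 1), Real.log (((1 : ℝ) / 2) ^ lev i) ≤
        ((k + 1 : ℕ) : ℝ) * Real.log (2 ^ lev k) := by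
      intro k
      rw [← Finset.sum_neg_distrib]
      refine (Finset.sum_le_card_nsmul _ _ (Real.log (2 ^ lev k)) fun i hi => ?_).trans ?_
      · rw [one_div, inv_pow, Real.log_inv, neg_neg]
        refine Real.log_le_log (by positivity) (pow_le_pow_right₀ one_le_two ?_)
        exact hlmono (Nat.lt_succ_iff.1 (Finset.mem_range.1 hi))
      · simp
    refine ⟨C + M (j₀ + 1) * Real.log (2 ^ j₀), fun k => ?_⟩
    have hlogj : 0 ≤ Real.log (2 ^ j₀) := Real.log_nonneg (one_le_pow₀ one_le_two)
    rcases k with _ | k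
    · have := hω.scaledConj_nonneg hl (k := ((0 : ℕ) : ℝ)) (by simp)
      simp only [Finset.range_zero, Finset.sum_empty, neg_zero]
      positivity
    refine (hlog k).trans ?_
    rcases le_or_gt (lev k) j₀ with h | h
    · have h1 : k + 1 ≤ M (j₀ + 1) := (hlt k).trans_le (hMmono.monotone (by omega))
      have h2 : Real.log (2 ^ lev k) ≤ Real.log (2 ^ j₀) :=
        Real.log_le_log (by positivity) (pow_le_pow_right₀ one_le_two h)
      have h3 : (((k + 1 : ℕ) : ℝ)) ≤ M (j₀ + 1) := by exact_mod_cast h1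
      have h4 := hω.scaledConj_nonneg hl (k := ((k + 1 : ℕ) : ℝ)) (by positivity)
      have h5 : ((k + 1 : ℕ) : ℝ) * Real.log (2 ^ lev k) ≤ M (j₀ + 1) * Real.log (2 ^ j₀) :=
        mul_le_mul h3 h2 (Real.log_nonneg (one_le_pow₀ one_le_two)) (by positivity)
      linarith
    -- The whole block `j` precedes the index `k`, so `k + 1 ≥ m j ≥ L λ₀ (ω(2^j) + 1) ≥ λ₀
    -- ω(2^{j+1})`.
    · obtain ⟨j, hj⟩ : ∃ j, lev k = j + 1 := ⟨lev k - 1, by omega⟩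
      have h1 := hω.le_scaledConj hl₀ (k := ((k + 1 : ℕ) : ℝ)) (by positivity)
        (one_le_pow₀ (one_le_two (α := ℝ)) (n := lev k))
      have h2 : (m j : ℝ) ≤ ((k + 1 : ℕ) : ℝ) := by
        have h3 := hle k
        rw [hj, hMs] at h3
        exact_mod_cast (by omega : m j ≤ k + 1)
      have h3 : lam₀ * ω (2 ^ lev k) ≤ ((k + 1 : ℕ) : ℝ) := by
        refine le_trans ?_ ((hm1 j).trans h2)
        rw [hj, pow_succ']
        calc lam₀ * ω (2 * 2 ^ j) ≤ lam₀ * (L * (ω (2 ^ j) + 1)) := by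
              gcongr; exact hdbl _ (by positivity)
          _ = (L * lam₀) * (ω (2 ^ j) + 1) := by ring
          _ ≤ _ := by
            have := hω0 j
            gcongr
            exact hj₀ j (by omega)
      have h4 := hab lam₀ le_rfl ((k + 1 : ℕ) : ℝ) (by positivity)
      rw [Real.log_exp] at h4
      have h5 : 0 ≤ (M (j₀ + 1) : ℝ) * Real.log (2 ^ j₀) := by positivity
      linarith

end IsWeight

/-- The average of `f` over `[t - a, t + a]`. -/
def avg (a : ℝ) (f : ℝ → ℝ) (t : ℝ) : ℝ := (2 * a)⁻¹ * ∫ u in (t - a)..(t + a), f u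

section avg

variable {a : ℝ} {f : ℝ → ℝ}

theorem hasDerivAt_avg (hf : Continuous f) (t : ℝ) :
    HasDerivAt (avg a f) ((2 * a)⁻¹ * (f (t + a) - f (t - a))) t := by
  have h1 : HasDerivAt (fun x => ∫ u in (0 : ℝ)..x, f u) (f (t + a)) (t + a) :=
    intervalIntegral.integral_hasDerivAt_right (hf.intervalIntegrable _ _)
      hf.aestronglyMeasurable.stronglyMeasurableAtFilter hf.continuousAt
  have h2 : HasDerivAt (fun x => ∫ u in (0 : ℝ)..x, f u) (f (t - a)) (t - a) :=
    intervalIntegral.integral_hasDerivAt_right (hf.intervalIntegrable _ _)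
      hf.aestronglyMeasurable.stronglyMeasurableAtFilter hf.continuousAt
  have h3 := ((h1.comp_add_const t a).sub (h2.comp_sub_const t a)).const_mul (2 * a)⁻¹
  refine h3.congr_of_eventuallyEq (Eventually.of_forall fun x => ?_)
  simp only [avg, Pi.sub_apply]
  rw [intervalIntegral.integral_interval_sub_left (hf.intervalIntegrable _ _)
    (hf.intervalIntegrable _ _)]

theorem deriv_avg (hf : ContDiff ℝ 1 f) : deriv (avg a f) = avg a (deriv f) := by
  ext t
  rw [(hasDerivAt_avg hf.continuous t).deriv, avg, intervalIntegral.integral_deriv_eq_sub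
    (fun x _ => (hf.differentiable one_ne_zero).differentiableAt)
    ((hf.continuous_deriv le_rfl).intervalIntegrable _ _)]

theorem contDiff_avg (hf : ContDiff ℝ (⊤ : ℕ∞) f) : ContDiff ℝ (⊤ : ℕ∞) (avg a f) := by
  rw [contDiff_infty_iff_deriv]
  refine ⟨fun t => (hasDerivAt_avg hf.continuous t).differentiableAt, ?_⟩
  have : deriv (avg a f) = fun t => (2 * a)⁻¹ * (f (t + a) - f (t - a)) :=
    funext fun t => (hasDerivAt_avg hf.continuous t).deriv
  rw [this]
  fun_prop

theorem iteratedDeriv_avg (hf : ContDiff ℝ (⊤ : ℕ∞) f) (k : ℕ) :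
    iteratedDeriv k (avg a f) = avg a (iteratedDeriv k f) := by
  induction k with
  | zero => simp
  | succ k ih =>
    rw [iteratedDeriv_succ, ih, iteratedDeriv_succ, deriv_avg]
    rw [iteratedDeriv_eq_iterate]
    exact ContDiff.iterate_deriv' 1 k (contDiff_infty.1 hf (1 + k))

/-- Used in three ways: `c = 0` preserves sup bounds, `M = 0` propagates constancy, and `c = f t`
measures how far one average moves the function. -/
theorem abs_avg_sub_le (ha : 0 < a) (hf : Continuous f) {c M t : ℝ}
    (h : ∀ u, |u - t| ≤ a → |f u - c| ≤ M) : |avg a f t - c| ≤ M := by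
  have h1 : avg a f t - c = (2 * a)⁻¹ * ∫ u in (t - a)..(t + a), (f u - c) := by
    rw [intervalIntegral.integral_sub (hf.intervalIntegrable _ _) (by simp), avg,
      intervalIntegral.integral_const, smul_eq_mul]
    field_simp
    ring
  have h2 : ‖∫ u in (t - a)..(t + a), (f u - c)‖ ≤ M * |(t + a) - (t - a)| := by
    refine intervalIntegral.norm_integral_le_of_norm_le_const fun u hu => h u ?_
    rw [uIoc_of_le (by linarith)] at hu
    exact abs_le.2 ⟨by linarith [hu.1], by linarith [hu.2]⟩
  rw [h1, abs_mul, abs_of_pos (show 0 < (2 * a)⁻¹ by positivity), inv_mul_le_iff₀ (by positivity)]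
  refine h2.trans (le_of_eq ?_)
  rw [show t + a - (t - a) = 2 * a by ring, abs_of_pos (by positivity)]
  ring

end avg

/-- Iterated averaging with the widths `a 0, a 1, …`. -/
def iterAvg (a : ℕ → ℝ) (f : ℝ → ℝ) : ℕ → ℝ → ℝ
  | 0 => f
  | n + 1 => avg (a n) (iterAvg a f n)

section iterAvg

variable {a : ℕ → ℝ} {f : ℝ → ℝ}

theorem contDiff_iterAvg (hf : ContDiff ℝ (⊤ : ℕ∞) f) (n : ℕ) :
    ContDiff ℝ (⊤ : ℕ∞) (iterAvg a f n) := by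
  induction n with
  | zero => exact hf
  | succ n ih => exact contDiff_avg ih

theorem continuous_iteratedDeriv_infty (hf : ContDiff ℝ (⊤ : ℕ∞) f) (k : ℕ) :
    Continuous (iteratedDeriv k f) :=
  hf.continuous_iteratedDeriv k (by exact_mod_cast le_top)

theorem abs_iteratedDeriv_iterAvg_le (ha : ∀ i, 0 < a i) (hf : ContDiff ℝ (⊤ : ℕ∞) f) {k : ℕ}
    {M : ℝ} (h : ∀ t, |iteratedDeriv k f t| ≤ M) (n : ℕ) (t : ℝ) :
    |iteratedDeriv k (iterAvg a f n) t| ≤ M := by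
  induction n generalizing t with
  | zero => exact h t
  | succ n ih =>
    rw [iterAvg, iteratedDeriv_avg (contDiff_iterAvg hf n)]
    have := abs_avg_sub_le (ha n) (continuous_iteratedDeriv_infty (contDiff_iterAvg hf n) k)
      (c := 0) (M := M) (t := t) fun u _ => by simpa using ih u
    simpa using this

/-- Each of the first `k` averages takes one derivative. -/
theorem abs_iteratedDeriv_iterAvg_le_exp (ha : ∀ i, 0 < a i) (hf : ContDiff ℝ (⊤ : ℕ∞) f)
    (h : ∀ t, |f t| ≤ 1) {k n : ℕ} (hkn : k ≤ n) (t : ℝ) :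
    |iteratedDeriv k (iterAvg a f n) t| ≤
      Real.exp (-∑ i ∈ Finset.range k, Real.log (a i)) := by
  induction n generalizing t k with
  | zero =>
    obtain rfl : k = 0 := by omega
    simpa [iterAvg] using h t
  | succ n ih =>
    rcases hkn.lt_or_eq with hlt | rfl
    · rw [iterAvg, iteratedDeriv_avg (contDiff_iterAvg hf n)]
      have := abs_avg_sub_le (ha n) (continuous_iteratedDeriv_infty (contDiff_iterAvg hf n) k)
        (c := 0) (M := Real.exp (-∑ i ∈ Finset.range k, Real.log (a i))) (t := t)
        fun u _ => by simpa using ih (by omega) u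
      simpa using this
    · rw [iteratedDeriv_succ, iterAvg, iteratedDeriv_avg (contDiff_iterAvg hf n),
        (hasDerivAt_avg (continuous_iteratedDeriv_infty (contDiff_iterAvg hf n) n) t).deriv,
        Finset.sum_range_succ, neg_add, Real.exp_add, Real.exp_neg (Real.log (a n)),
        Real.exp_log (ha n), abs_mul, abs_of_pos (inv_pos.2 (mul_pos two_pos (ha n)))]
      have h1 := ih le_rfl (t + a n)
      have h2 := ih le_rfl (t - a n)
      have h3 := abs_sub (iteratedDeriv n (iterAvg a f n) (t + a n))
        (iteratedDeriv n (iterAvg a f n) (t - a n))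
      have h4 : (2 * a n)⁻¹ = 2⁻¹ * (a n)⁻¹ := mul_inv _ _
      have h5 := inv_pos.2 (ha n)
      rw [h4]
      nlinarith

/-- An average sees only the distance `a i`, so the interval of constancy shrinks in total by the
sum of the widths. -/
theorem iterAvg_eq_of_const (ha : ∀ i, 0 < a i) (hf : ContDiff ℝ (⊤ : ℕ∞) f) {c x r : ℝ} {n : ℕ}
    (h : ∀ t, |t - x| ≤ r + ∑ i ∈ Finset.range n, a i → f t = c) {t : ℝ} (ht : |t - x| ≤ r) :
    iterAvg a f n t = c := by
  induction n generalizing t r with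
  | zero => exact h t (by simpa using ht)
  | succ n ih =>
    have := abs_avg_sub_le (ha n) (contDiff_iterAvg (a := a) hf n).continuous (c := c) (M := 0)
      (t := t) fun u hu => by
        rw [ih (r := r + a n) (fun s hs => h s (by
          rw [Finset.sum_range_succ]; linarith)) (by
            have := abs_add_le (u - t) (t - x)
            rw [show u - t + (t - x) = u - x by ring] at this
            linarith)]
        simp
    exact sub_eq_zero.1 (abs_eq_zero.1 (le_antisymm this (abs_nonneg _)))

/-- By the mean value inequality the `n`-th average moves the `k`-th derivative by at most `a n *
sup |f^(k+1)|`, because the earlier averages did not increase sup norms. The telescoping series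
therefore converges with all derivatives. -/
theorem exists_limit_iterAvg (ha : ∀ i, 0 < a i) (hs : Summable a)
    (hf : ContDiff ℝ (⊤ : ℕ∞) f) (hc : HasCompactSupport f) :
    ∃ h : ℝ → ℝ, ContDiff ℝ (⊤ : ℕ∞) h ∧ ∀ k t,
      Tendsto (fun n => iteratedDeriv k (iterAvg a f n) t) atTop (𝓝 (iteratedDeriv k h t)) := by
  have hb : ∀ k, ∃ M, ∀ t, |iteratedDeriv k f t| ≤ M := fun k => by
    have hck : HasCompactSupport (iteratedDeriv k f) := by
      induction k with
      | zero => simpa using hc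
      | succ k ih => rw [iteratedDeriv_succ]; exact ih.deriv
    obtain ⟨M, hM⟩ := (continuous_iteratedDeriv_infty hf k).bounded_above_of_compact_support hck
    exact ⟨M, hM⟩
  choose M hM using hb
  have hcd := fun n => contDiff_iterAvg (a := a) hf n
  set g : ℕ → ℝ → ℝ := fun n t => iterAvg a f (n + 1) t - iterAvg a f n t with hg
  have hgc : ∀ n, ContDiff ℝ (⊤ : ℕ∞) (g n) := fun n => (hcd (n + 1)).sub (hcd n)
  have hgd : ∀ k n t, iteratedDeriv k (g n) t =
      iteratedDeriv k (iterAvg a f (n + 1)) t - iteratedDeriv k (iterAvg a f n) t := by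
    intro k n t
    exact iteratedDeriv_fun_sub ((contDiff_infty.1 (hcd (n + 1)) k).contDiffAt)
      ((contDiff_infty.1 (hcd n) k).contDiffAt)
  have hgb : ∀ k n t, ‖iteratedDeriv k (g n) t‖ ≤ a n * M (k + 1) := by
    intro k n t
    rw [hgd, iterAvg, iteratedDeriv_avg (hcd n), Real.norm_eq_abs]
    refine abs_avg_sub_le (ha n) (continuous_iteratedDeriv_infty (hcd n) k) fun u hu => ?_
    have hdiff : Differentiable ℝ (iteratedDeriv k (iterAvg a f n)) :=
      (hcd n).differentiable_iteratedDeriv k (by exact_mod_cast WithTop.coe_lt_top k)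
    have h1 := Convex.norm_image_sub_le_of_norm_deriv_le (s := univ) (C := M (k + 1))
      (f := iteratedDeriv k (iterAvg a f n)) (x := t) (y := u)
      (fun x _ => hdiff x) (fun x _ => by
        rw [← iteratedDeriv_succ]
        exact abs_iteratedDeriv_iterAvg_le ha hf (hM (k + 1)) n x) convex_univ (mem_univ _)
      (mem_univ _)
    refine h1.trans ?_
    rw [mul_comm]
    have : 0 ≤ M (k + 1) := (abs_nonneg _).trans (hM (k + 1) 0)
    gcongr
    exact hu
  have hgb' : ∀ (k n : ℕ) (t : ℝ), ‖iteratedFDeriv ℝ k (g n) t‖ ≤ a n * M (k + 1) := fun k n t => by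
    rw [norm_iteratedFDeriv_eq_norm_iteratedDeriv]; exact hgb k n t
  have hsum : ∀ k : ℕ, Summable fun n => a n * M (k + 1) := fun k => hs.mul_right _
  have hG : ContDiff ℝ (⊤ : ℕ∞) fun t => ∑' n, g n t :=
    contDiff_tsum hgc (fun k _ => hsum k) fun k n t _ => hgb' k n t
  refine ⟨fun t => f t + ∑' n, g n t, hf.add hG, fun k t => ?_⟩
  have hder : iteratedDeriv k (fun t => ∑' n, g n t) t = ∑' n, iteratedDeriv k (g n) t := by
    simp only [iteratedDeriv]
    rw [iteratedFDeriv_tsum_apply hgc (fun k _ => hsum k) (fun k n t _ => hgb' k n t)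
      (k := k) (by exact_mod_cast le_top)]
    exact (ContinuousMultilinearMap.apply ℝ (fun _ : Fin k => ℝ) ℝ (fun _ => 1)).map_tsum
      (Summable.of_norm_bounded (hsum k) fun n => hgb' k n t)
  rw [iteratedDeriv_fun_add ((contDiff_infty.1 hf k).contDiffAt)
    ((contDiff_infty.1 hG k).contDiffAt), hder]
  have h1 := (Summable.of_norm_bounded (hsum k) fun n => hgb k n t).hasSum.tendsto_sum_nat
  refine (h1.const_add (iteratedDeriv k f t)).congr fun n => ?_
  simp only [hgd]
  rw [Finset.sum_range_sub (fun n => iteratedDeriv k (iterAvg a f n) t)]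
  simp [iterAvg]

end iterAvg

/-- Cut-off functions of class `𝓓_(ω)` on the line. -/
theorem IsWeight.exists_cutoff {ω : ℝ → ℝ} (hω : IsWeight ω) :
    ∃ h : ℝ → ℝ, ContDiff ℝ (⊤ : ℕ∞) h ∧ (∀ t, |t| ≤ 1 → h t = 1) ∧ (∀ t, 4 ≤ |t| → h t = 0) ∧
      ∀ lam, 0 < lam → ∃ C : ℝ, 0 ≤ C ∧ ∀ (k : ℕ) (t : ℝ),
        |iteratedDeriv k h t| ≤ C * Real.exp (scaledConj ω lam k) := by
  obtain ⟨a, ha, hs, hak⟩ := hω.exists_widths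
  -- Division by `S` brings the total width down to at most `1`, the room left between the radii `2,
  -- 3` of the bump and `1, 4` in the claim. The resulting factor `S^k` is absorbed, which needs `S
  -- ≥ 1`.
  set S := max 1 (∑' i, a i) with hS
  have hS1 : 1 ≤ S := le_max_left _ _
  have hS0 : 0 < S := by linarith
  set b : ℕ → ℝ := fun i => a i / S with hb
  have hbpos : ∀ i, 0 < b i := fun i => div_pos (ha i) hS0
  have hbs : Summable b := hs.div_const S
  have hb1 : ∀ n, ∑ i ∈ Finset.range n, b i ≤ 1 := fun n => by
    rw [hb, ← Finset.sum_div, div_le_one hS0]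
    exact (hs.sum_le_tsum _ fun i _ => (ha i).le).trans (le_max_right _ _)
  let f₀ : ContDiffBump (0 : ℝ) := ⟨2, 3, by norm_num, by norm_num⟩
  have hf : ContDiff ℝ (⊤ : ℕ∞) f₀ := f₀.contDiff
  obtain ⟨h, hh, hlim⟩ := exists_limit_iterAvg hbpos hbs hf f₀.hasCompactSupport
  have hlim0 : ∀ t, Tendsto (fun n => iterAvg b f₀ n t) atTop (𝓝 (h t)) := fun t => by
    simpa using hlim 0 t
  refine ⟨h, hh, fun t ht => ?_, fun t ht => ?_, fun lam hl => ?_⟩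
  · refine tendsto_nhds_unique (hlim0 t) (tendsto_const_nhds.congr fun n => ?_)
    refine (iterAvg_eq_of_const hbpos hf (x := 0) (r := 1) (fun u hu => ?_) (by simpa using ht)).symm
    refine f₀.one_of_mem_closedBall ?_
    rw [mem_closedBall_zero_iff, Real.norm_eq_abs]
    have := hb1 n
    rw [sub_zero] at hu
    change |u| ≤ 2
    linarith
  · refine tendsto_nhds_unique (hlim0 t) (tendsto_const_nhds.congr fun n => ?_)
    refine (iterAvg_eq_of_const hbpos hf (x := t) (r := 0) (fun u hu => ?_) (by simp)).symm
    refine f₀.zero_of_le_dist ?_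
    rw [dist_zero_right, Real.norm_eq_abs]
    have := hb1 n
    have h3 := abs_sub_abs_le_abs_sub t u
    rw [abs_sub_comm] at h3
    change 3 ≤ |u|
    linarith
  · obtain ⟨lam₀, C, hl₀, hC, hab⟩ := hω.exists_geom_absorb hS1 hl
    obtain ⟨C', hC'⟩ := hak lam₀ hl₀
    refine ⟨Real.exp (C + C'), (Real.exp_pos _).le, fun k t => ?_⟩
    refine le_of_tendsto (hlim k t).abs ?_
    filter_upwards [eventually_ge_atTop k] with n hn
    refine (abs_iteratedDeriv_iterAvg_le_exp hbpos hf (fun t => ?_) hn t).trans ?_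
    · rw [abs_of_nonneg f₀.nonneg]; exact f₀.le_one
    · rw [← Real.exp_add, Real.exp_le_exp]
      have h1 : ∑ i ∈ Finset.range k, Real.log (b i) =
          ∑ i ∈ Finset.range k, Real.log (a i) - k * Real.log S := by
        rw [Finset.sum_congr rfl fun i _ => Real.log_div (ha i).ne' hS0.ne',
          Finset.sum_sub_distrib]
        simp
      have h2 := hab lam₀ le_rfl k (by positivity)
      have h3 := hC' k
      linarith

end

noncomputable section

/-! ### Iterated directional derivatives -/

section IterDir

variable {V W : Type*} [NormedAddCommGroup V] [NormedSpace ℝ V]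
  [NormedAddCommGroup W] [NormedSpace ℝ W]

/-- Smoothness at a point. -/
abbrev SmoothAt (f : V → ℂ) (z : V) : Prop := ContDiffAt ℝ (⊤ : ℕ∞) f z

/-- The iterated directional derivative along a list of directions. -/
def iterDir : List V → (V → ℂ) → V → ℂ
  | [], f => f
  | v :: w, f => iterDir w (dirDeriv v f)

@[simp] theorem iterDir_nil (f : V → ℂ) : iterDir [] f = f := rfl

@[simp] theorem iterDir_cons (v : V) (w : List V) (f : V → ℂ) :
    iterDir (v :: w) f = iterDir w (dirDeriv v f) := rfl

theorem iterDir_append (w w' : List V) (f : V → ℂ) :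
    iterDir (w ++ w') f = iterDir w' (iterDir w f) := by
  induction w generalizing f with
  | nil => rfl
  | cons v w ih => simp [ih]

theorem SmoothAt.differentiableAt' {f : V → ℂ} {z : V} (hf : SmoothAt f z) :
    DifferentiableAt ℝ f z := hf.differentiableAt (by simp)

theorem SmoothAt.eventually_differentiableAt {f : V → ℂ} {z : V} (hf : SmoothAt f z) :
    ∀ᶠ y in 𝓝 z, DifferentiableAt ℝ f y := by
  have h1 : ContDiffAt ℝ 1 f z := hf.of_le (by exact_mod_cast le_top)
  filter_upwards [h1.eventually (by simp)] with y hy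
  exact hy.differentiableAt one_ne_zero

theorem SmoothAt.dirDeriv {f : V → ℂ} {z : V} (hf : SmoothAt f z) (v : V) :
    SmoothAt (dirDeriv v f) z :=
  (hf.fderiv_right (m := (⊤ : ℕ∞)) (by simp)).clm_apply contDiffAt_const

theorem SmoothAt.iterDir {f : V → ℂ} {z : V} (hf : SmoothAt f z) (w : List V) :
    SmoothAt (iterDir w f) z := by
  induction w generalizing f with
  | nil => exact hf
  | cons v w ih => exact ih (hf.dirDeriv v)

theorem dirDeriv_congr {f g : V → ℂ} {z : V} (h : f =ᶠ[𝓝 z] g) (v : V) :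
    dirDeriv v f =ᶠ[𝓝 z] dirDeriv v g := by
  filter_upwards [h.fderiv (𝕜 := ℝ)] with y hy
  simp [dirDeriv, hy]

theorem iterDir_congr {f g : V → ℂ} {z : V} (h : f =ᶠ[𝓝 z] g) (w : List V) :
    iterDir w f =ᶠ[𝓝 z] iterDir w g := by
  induction w generalizing f g with
  | nil => exact h
  | cons v w ih => exact ih (dirDeriv_congr h v)

theorem dirDeriv_comm {f : V → ℂ} {z : V} (hf : SmoothAt f z) (v v' : V) :
    dirDeriv v (dirDeriv v' f) =ᶠ[𝓝 z] dirDeriv v' (dirDeriv v f) := by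
  have h2 : ContDiffAt ℝ 2 f z := contDiffAt_infty.1 hf 2
  have key : ∀ (u u' y : V), ContDiffAt ℝ 2 f y →
      dirDeriv u (dirDeriv u' f) y = fderiv ℝ (fderiv ℝ f) y u u' := by
    intro u u' y hy
    have hd : DifferentiableAt ℝ (fderiv ℝ f) y :=
      (hy.fderiv_right (m := 1) (by norm_num)).differentiableAt one_ne_zero
    unfold dirDeriv
    rw [fderiv_clm_apply hd (differentiableAt_const _)]
    simp
  filter_upwards [h2.eventually (by simp)] with y hy
  rw [key _ _ y hy, key _ _ y hy]
  exact (hy.isSymmSndFDerivAt (by simp)).eq _ _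

/-- Permutations are generated by adjacent swaps, where the symmetry of second derivatives applies.
It allows words in coordinate directions to be sorted into multi-indices. -/
theorem iterDir_perm {w w' : List V} (h : w.Perm w') {f : V → ℂ} {z : V} (hf : SmoothAt f z) :
    iterDir w f z = iterDir w' f z := by
  induction h generalizing f with
  | nil => rfl
  | cons v _ ih => exact ih (hf.dirDeriv v)
  | swap v v' w => exact (iterDir_congr (dirDeriv_comm hf v v') w).eq_of_nhds
  | trans _ _ ih ih' => exact (ih hf).trans (ih' hf)

theorem dirDeriv_add {f g : V → ℂ} {z : V} (hf : SmoothAt f z) (hg : SmoothAt g z) (v : V) :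
    dirDeriv v (fun y => f y + g y) =ᶠ[𝓝 z] fun y => dirDeriv v f y + dirDeriv v g y := by
  filter_upwards [hf.eventually_differentiableAt, hg.eventually_differentiableAt] with y h1 h2
  simp [dirDeriv, fderiv_fun_add h1 h2]

theorem iterDir_add {f g : V → ℂ} {z : V} (hf : SmoothAt f z) (hg : SmoothAt g z)
    (w : List V) : iterDir w (fun y => f y + g y) z = iterDir w f z + iterDir w g z := by
  induction w generalizing f g with
  | nil => rfl
  | cons v w ih =>
    rw [iterDir_cons, (iterDir_congr (dirDeriv_add hf hg v) w).eq_of_nhds,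
      ih (hf.dirDeriv v) (hg.dirDeriv v)]
    rfl

theorem dirDeriv_const_mul {f : V → ℂ} {z : V} (hf : SmoothAt f z) (c : ℂ) (v : V) :
    dirDeriv v (fun y => c * f y) =ᶠ[𝓝 z] fun y => c * dirDeriv v f y := by
  filter_upwards [hf.eventually_differentiableAt] with y h1
  simp [dirDeriv, fderiv_const_mul h1]

theorem iterDir_const_mul {f : V → ℂ} {z : V} (hf : SmoothAt f z) (c : ℂ)
    (w : List V) : iterDir w (fun y => c * f y) z = c * iterDir w f z := by
  induction w generalizing f with
  | nil => rfl
  | cons v w ih =>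
    rw [iterDir_cons, (iterDir_congr (dirDeriv_const_mul hf c v) w).eq_of_nhds,
      ih (hf.dirDeriv v)]
    rfl

theorem iterDir_sub {f g : V → ℂ} {z : V} (hf : SmoothAt f z) (hg : SmoothAt g z)
    (w : List V) : iterDir w (fun y => f y - g y) z = iterDir w f z - iterDir w g z := by
  have h := iterDir_add hf (contDiffAt_const.mul hg : SmoothAt (fun y => (-1 : ℂ) * g y) z) w
  rw [iterDir_const_mul hg] at h
  simpa [sub_eq_add_neg] using h

theorem iterDir_eq_zero {f : V → ℂ} {z : V} (h : f =ᶠ[𝓝 z] fun _ => 0) (w : List V) :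
    iterDir w f z = 0 := by
  rw [(iterDir_congr h w).eq_of_nhds]
  have : ∀ w : List V, iterDir w (fun _ : V => (0 : ℂ)) = fun _ => 0 := by
    intro w
    induction w with
    | nil => rfl
    | cons v w ih =>
      have h0 : dirDeriv v (fun _ : V => (0 : ℂ)) = fun _ => 0 := by ext; simp [dirDeriv]
      rw [iterDir_cons, h0, ih]
  rw [this]

theorem dirDeriv_mul {f g : V → ℂ} {z : V} (hf : SmoothAt f z) (hg : SmoothAt g z) (v : V) :
    dirDeriv v (fun y => f y * g y) =ᶠ[𝓝 z]
      fun y => dirDeriv v f y * g y + f y * dirDeriv v g y := by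
  filter_upwards [hf.eventually_differentiableAt, hg.eventually_differentiableAt] with y h1 h2
  simp [dirDeriv, fderiv_fun_mul h1 h2]
  ring

theorem dirDeriv_comp_affine (A : W →L[ℝ] V) (c : V) {f : V → ℂ} {p : W}
    (hf : SmoothAt f (A p + c)) (v : W) :
    dirDeriv v (fun q => f (A q + c)) =ᶠ[𝓝 p] fun q => dirDeriv (A v) f (A q + c) := by
  have hc : Tendsto (fun q => A q + c) (𝓝 p) (𝓝 (A p + c)) :=
    (A.continuous.add continuous_const).tendsto p
  filter_upwards [hc.eventually hf.eventually_differentiableAt] with q hq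
  have h1 : HasFDerivAt (fun q => A q + c) A q := A.hasFDerivAt.add_const c
  have := hq.hasFDerivAt.comp q h1
  unfold dirDeriv
  have h2 : fderiv ℝ (fun q => f (A q + c)) q = (fderiv ℝ f (A q + c)).comp A := this.fderiv
  rw [h2]
  rfl

theorem iterDir_comp_affine (A : W →L[ℝ] V) (c : V) {f : V → ℂ} {p : W}
    (hf : SmoothAt f (A p + c)) (w : List W) :
    iterDir w (fun q => f (A q + c)) p = iterDir (w.map A) f (A p + c) := by
  induction w generalizing f with
  | nil => rfl
  | cons v w ih =>
    rw [iterDir_cons, (iterDir_congr (dirDeriv_comp_affine A c hf v) w).eq_of_nhds,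
      ih (hf.dirDeriv _)]
    rfl

theorem iterDir_real {f : ℝ → ℂ} {t : ℝ} (hf : SmoothAt f t) (w : List ℝ) :
    iterDir w f t = (w.prod : ℂ) * iteratedDeriv w.length f t := by
  induction w generalizing f with
  | nil => simp
  | cons v w ih =>
    have h1 : dirDeriv v f = fun s => (v : ℂ) * deriv f s := by
      ext s
      simp [dirDeriv]
    have h2 : SmoothAt (deriv f) t := by
      have := hf.dirDeriv (1 : ℝ)
      refine this.congr_of_eventuallyEq (Eventually.of_forall fun s => ?_)
      simp [dirDeriv]
    rw [iterDir_cons, h1, iterDir_const_mul h2, ih h2, List.length_cons, iteratedDeriv_succ']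
    simp [mul_assoc]

theorem iterDir_comp_linear (A : V →L[ℝ] ℝ) {f : ℝ → ℂ} {p : V} (hf : SmoothAt f (A p))
    (w : List V) :
    iterDir w (fun q => f (A q)) p =
      ((w.map A).prod : ℂ) * iteratedDeriv w.length f (A p) := by
  have h := iterDir_comp_affine A 0 (f := f) (p := p) (by simpa using hf) w
  simp only [add_zero] at h
  rw [h, iterDir_real hf]
  simp

/-- Bounds for the iterated derivatives at `z` along directions in `B`, in terms of the order. -/
def DirBound (B : Set V) (f : V → ℂ) (z : V) (A : ℕ → ℝ) : Prop :=
  ∀ w : List V, (∀ v ∈ w, v ∈ B) → ‖iterDir w f z‖ ≤ A w.length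

theorem DirBound.mono {B : Set V} {f : V → ℂ} {z : V} {A A' : ℕ → ℝ} (h : DirBound B f z A)
    (hA : ∀ n, A n ≤ A' n) : DirBound B f z A' := fun w hw => (h w hw).trans (hA _)

theorem DirBound.dirDeriv {B : Set V} {f : V → ℂ} {z : V} {A : ℕ → ℝ} (h : DirBound B f z A)
    {v : V} (hv : v ∈ B) : DirBound B (dirDeriv v f) z fun n => A (n + 1) := fun w hw =>
  h (v :: w) fun u hu => by
    rcases List.mem_cons.1 hu with rfl | hu
    · exact hv
    · exact hw u hu

/-- The Leibniz rule. -/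
theorem DirBound.mul {B : Set V} {f g : V → ℂ} {z : V} {A A' : ℕ → ℝ} (h : DirBound B f z A)
    (h' : DirBound B g z A') (hf : SmoothAt f z) (hg : SmoothAt g z) :
    DirBound B (fun y => f y * g y) z fun n =>
      ∑ i ∈ Finset.range (n + 1), (n.choose i : ℝ) * (A i * A' (n - i)) := by
  intro w hw
  induction w generalizing f g A A' with
  | nil =>
    have h1 := h [] (by simp)
    have h2 := h' [] (by simp)
    simp only [iterDir_nil, List.length_nil] at h1 h2 ⊢
    rw [norm_mul]
    simpa using mul_le_mul h1 h2 (norm_nonneg _) ((norm_nonneg _).trans h1)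
  | cons v w ih =>
    have hv : v ∈ B := hw v (by simp)
    have hw' : ∀ u ∈ w, u ∈ B := fun u hu => hw u (by simp [hu])
    rw [iterDir_cons, (iterDir_congr (dirDeriv_mul hf hg v) w).eq_of_nhds,
      iterDir_add ((hf.dirDeriv v).mul hg) (hf.mul (hg.dirDeriv v))]
    refine (norm_add_le _ _).trans ?_
    have h1 := ih (h.dirDeriv hv) h' (hf.dirDeriv v) hg hw'
    have h2 := ih h (h'.dirDeriv hv) hf (hg.dirDeriv v) hw'
    refine (add_le_add h1 h2).trans (le_of_eq ?_)
    simp only [List.length_cons]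
    rw [Finset.sum_choose_succ_mul (fun i j => A i * A' j), add_comm]
    congr 1
    refine Finset.sum_congr rfl fun i hi => ?_
    rw [Nat.succ_sub (Nat.lt_succ_iff.1 (Finset.mem_range.1 hi))]

/-- The word of `∂_{e 0}^{α 0} ⋯ ∂_{e (d-1)}^{α (d-1)}`. -/
def multiWord {d : ℕ} (e : Fin d → V) (α : Fin d → ℕ) : List V :=
  (List.finRange d).reverse.flatMap fun j => List.replicate (α j) (e j)

theorem multiDeriv_eq_iterDir {d : ℕ} (e : Fin d → V) (α : Fin d → ℕ) (f : V → ℂ) :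
    multiDeriv e α f = iterDir (multiWord e α) f := by
  unfold multiDeriv multiWord
  have hrep : ∀ (n : ℕ) (v : V) (g : V → ℂ),
      (FormalKernel.dirDeriv v)^[n] g = iterDir (List.replicate n v) g := by
    intro n v
    induction n with
    | zero => intro g; rfl
    | succ n ih => intro g; rw [Function.iterate_succ_apply, ih, List.replicate_succ, iterDir_cons]
  induction List.finRange d with
  | nil => rfl
  | cons j l ih =>
    rw [List.foldr_cons, ih, hrep, ← iterDir_append, List.reverse_cons, List.flatMap_append]
    simp

theorem coe_multiWord {X : Type*} {d : ℕ} (e : Fin d → X) (α : Fin d → ℕ) :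
    (multiWord e α : Multiset X) = ∑ j, Multiset.replicate (α j) (e j) := by
  rw [Fin.sum_univ_def, ← List.sum_reverse, ← List.map_reverse, multiWord]
  induction (List.finRange d).reverse with
  | nil => rfl
  | cons j l ih =>
    rw [List.flatMap_cons, List.map_cons, List.sum_cons, ← ih, ← Multiset.coe_add,
      Multiset.coe_replicate]

theorem length_multiWord {V : Type*} {d : ℕ} (e : Fin d → V) (α : Fin d → ℕ) :
    (multiWord e α).length = len α := by
  have := congrArg Multiset.card (coe_multiWord e α)
  rw [Multiset.coe_card, Multiset.card_sum] at this
  simpa [len] using this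

theorem mem_multiWord {V : Type*} {d : ℕ} {e : Fin d → V} {α : Fin d → ℕ} {v : V} (h : v ∈ multiWord e α) :
    v ∈ range e := by
  simp only [multiWord, List.mem_flatMap] at h
  obtain ⟨j, -, hj⟩ := h
  exact ⟨j, (List.eq_of_mem_replicate hj).symm⟩

theorem coe_multiWord_add_single {X : Type*} {d : ℕ} (e : Fin d → X) (α : Fin d → ℕ) (i : Fin d) :
    (multiWord e (α + Pi.single i 1) : Multiset X) = e i ::ₘ (multiWord e α : Multiset X) := by
  rw [coe_multiWord, coe_multiWord, ← Multiset.singleton_add]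
  simp only [Pi.add_apply, Multiset.replicate_add, Finset.sum_add_distrib]
  rw [add_comm, Finset.sum_eq_single i]
  · simp
  · intro j _ hj; simp [hj]
  · simp

end IterDir

/-! ### The coordinate directions -/

variable {d : ℕ}

/-- The coordinate directions of `ℝ^{2d}`. -/
def basis₂ (d : ℕ) : Set (Euc d × Euc d) :=
  range (fun j : Fin d => ((stdVec j, 0) : Euc d × Euc d)) ∪
    range (fun j : Fin d => ((0, stdVec j) : Euc d × Euc d))

/-- The coordinate directions of `ℝ^{3d}`. -/
def basis₃ (d : ℕ) : Set (Euc d × Euc d × Euc d) :=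
  range (fun j : Fin d => ((stdVec j, 0, 0) : Euc d × Euc d × Euc d)) ∪
    (range (fun j : Fin d => ((0, stdVec j, 0) : Euc d × Euc d × Euc d)) ∪
      range (fun j : Fin d => ((0, 0, stdVec j) : Euc d × Euc d × Euc d)))

theorem len_add_single (α : Fin d → ℕ) (i : Fin d) : len (α + Pi.single i 1) = len α + 1 := by
  simp [len, Finset.sum_add_distrib]

theorem deriv₂_eq_iterDir (α β : Fin d → ℕ) (f : Euc d × Euc d → ℂ) :
    deriv₂ α β f = iterDir (multiWord (fun j => (0, stdVec j)) β ++
      multiWord (fun j => (stdVec j, 0)) α) f := by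
  rw [deriv₂, multiDeriv_eq_iterDir, multiDeriv_eq_iterDir, iterDir_append]

theorem deriv₃_eq_iterDir (α β γ : Fin d → ℕ) (f : Euc d × Euc d × Euc d → ℂ) :
    deriv₃ α β γ f = iterDir (multiWord (fun j => (0, 0, stdVec j)) γ ++
      (multiWord (fun j => (0, stdVec j, 0)) β ++
        multiWord (fun j => (stdVec j, 0, 0)) α)) f := by
  rw [deriv₃, multiDeriv_eq_iterDir, multiDeriv_eq_iterDir, multiDeriv_eq_iterDir,
    iterDir_append, iterDir_append]

/-- Estimates are carried out for words because their Leibniz rule is binomial in the length alone.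
Sorting a word by coordinates makes the hypotheses on multi-indices available. -/
theorem exists_perm_multiWord₂ (w : List (Euc d × Euc d)) (hw : ∀ v ∈ w, v ∈ basis₂ d) :
    ∃ α β : Fin d → ℕ, w.Perm (multiWord (fun j => (0, stdVec j)) β ++
      multiWord (fun j => (stdVec j, 0)) α) ∧ w.length = len α + len β := by
  induction w with
  | nil => exact ⟨0, 0, by simp [multiWord], by simp [len]⟩
  | cons v w ih =>
    obtain ⟨α, β, hp, hl⟩ := ih fun u hu => hw u (by simp [hu])
    rw [← Multiset.coe_eq_coe, ← Multiset.coe_add] at hp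
    rcases hw v (by simp) with ⟨j, rfl⟩ | ⟨j, rfl⟩
    · refine ⟨α + Pi.single j 1, β, ?_, ?_⟩
      · rw [← Multiset.coe_eq_coe, ← Multiset.coe_add, coe_multiWord_add_single,
          ← Multiset.cons_coe, hp]
        simp only [← Multiset.singleton_add]; abel
      · rw [List.length_cons, hl, len_add_single]; ring
    · refine ⟨α, β + Pi.single j 1, ?_, ?_⟩
      · rw [← Multiset.coe_eq_coe, ← Multiset.coe_add, coe_multiWord_add_single,
          ← Multiset.cons_coe, hp]
        simp only [← Multiset.singleton_add]; abel
      · rw [List.length_cons, hl, len_add_single]; ring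

theorem exists_perm_multiWord₃ (w : List (Euc d × Euc d × Euc d)) (hw : ∀ v ∈ w, v ∈ basis₃ d) :
    ∃ α β γ : Fin d → ℕ, w.Perm (multiWord (fun j => (0, 0, stdVec j)) γ ++
      (multiWord (fun j => (0, stdVec j, 0)) β ++
        multiWord (fun j => (stdVec j, 0, 0)) α)) ∧ w.length = len α + len β + len γ := by
  induction w with
  | nil => exact ⟨0, 0, 0, by simp [multiWord], by simp [len]⟩
  | cons v w ih =>
    obtain ⟨α, β, γ, hp, hl⟩ := ih fun u hu => hw u (by simp [hu])
    rw [← Multiset.coe_eq_coe, ← Multiset.coe_add, ← Multiset.coe_add] at hp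
    rcases hw v (by simp) with ⟨j, rfl⟩ | ⟨j, rfl⟩ | ⟨j, rfl⟩
    · refine ⟨α + Pi.single j 1, β, γ, ?_, ?_⟩
      · rw [← Multiset.coe_eq_coe, ← Multiset.coe_add, ← Multiset.coe_add,
          coe_multiWord_add_single, ← Multiset.cons_coe, hp]
        simp only [← Multiset.singleton_add]; abel
      · rw [List.length_cons, hl, len_add_single]; ring
    · refine ⟨α, β + Pi.single j 1, γ, ?_, ?_⟩
      · rw [← Multiset.coe_eq_coe, ← Multiset.coe_add, ← Multiset.coe_add,
          coe_multiWord_add_single, ← Multiset.cons_coe, hp]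
        simp only [← Multiset.singleton_add]; abel
      · rw [List.length_cons, hl, len_add_single]; ring
    · refine ⟨α, β, γ + Pi.single j 1, ?_, ?_⟩
      · rw [← Multiset.coe_eq_coe, ← Multiset.coe_add, ← Multiset.coe_add,
          coe_multiWord_add_single, ← Multiset.cons_coe, hp]
        simp only [← Multiset.singleton_add]; abel
      · rw [List.length_cons, hl, len_add_single]; ring

theorem dirBound_of_deriv₂ {f : Euc d × Euc d → ℂ} {z : Euc d × Euc d} (hf : SmoothAt f z)
    {A : ℕ → ℝ} (h : ∀ α β, ‖deriv₂ α β f z‖ ≤ A (len α + len β)) :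
    DirBound (basis₂ d) f z A := fun w hw => by
  obtain ⟨α, β, hp, hl⟩ := exists_perm_multiWord₂ w hw
  rw [iterDir_perm hp hf, hl, ← deriv₂_eq_iterDir]
  exact h α β

theorem dirBound_of_deriv₃ {f : Euc d × Euc d × Euc d → ℂ} {z : Euc d × Euc d × Euc d}
    (hf : SmoothAt f z) {A : ℕ → ℝ}
    (h : ∀ α β γ, ‖deriv₃ α β γ f z‖ ≤ A (len α + len β + len γ)) :
    DirBound (basis₃ d) f z A := fun w hw => by
  obtain ⟨α, β, γ, hp, hl⟩ := exists_perm_multiWord₃ w hw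
  rw [iterDir_perm hp hf, hl, ← deriv₃_eq_iterDir]
  exact h α β γ

theorem DirBound.deriv₂_le {f : Euc d × Euc d → ℂ} {z : Euc d × Euc d} {A : ℕ → ℝ}
    (h : DirBound (basis₂ d) f z A) (α β : Fin d → ℕ) :
    ‖deriv₂ α β f z‖ ≤ A (len α + len β) := by
  rw [deriv₂_eq_iterDir]
  refine (h _ fun v hv => ?_).trans (le_of_eq ?_)
  · rcases List.mem_append.1 hv with hv | hv
    · exact Or.inr (mem_multiWord hv)
    · exact Or.inl (mem_multiWord hv)
  · rw [List.length_append, length_multiWord, length_multiWord, add_comm]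

end

noncomputable section

/-! ### Series, parametric integrals and integration by parts -/

section Series

variable {E : Type*} [NormedAddCommGroup E] [NormedSpace ℝ E]

/-- In finite dimension a map into linear maps is `C^n` once its value at each vector is, so the
induction can run over directions. -/
theorem contDiffOn_of_iterDir [FiniteDimensional ℝ E] {U : Set E} (hU : IsOpen U) {f : E → ℂ}
    (h : ∀ w : List E, ∀ p ∈ U, DifferentiableAt ℝ (iterDir w f) p) :
    ContDiffOn ℝ (⊤ : ℕ∞) f U := by
  rw [contDiffOn_infty]
  intro n
  induction n generalizing f with
  | zero =>
    exact contDiffOn_zero.2 fun p hp => (h [] p hp).continuousAt.continuousWithinAt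
  | succ n ih =>
    rw [Nat.cast_succ, contDiffOn_succ_iff_fderiv_apply hU.uniqueDiffOn]
    refine ⟨fun p hp => (h [] p hp).differentiableWithinAt, fun hn => by simp at hn, fun y => ?_⟩
    refine (ih (f := dirDeriv y f) fun w p hp => h (y :: w) p hp).congr fun p hp => ?_
    rw [fderivWithin_of_isOpen hU hp]
    rfl

variable {f : ℕ → E → ℂ} {U : Set E}

/-- Bounds along a basis control the operator norm of the derivatives, and a ball around `p` is the
connected domain on which to differentiate termwise. -/
theorem hasFDerivAt_tsum_of_iterDir [FiniteDimensional ℝ E] (hU : IsOpen U)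
    (hf : ∀ j, ∀ p ∈ U, SmoothAt (f j) p)
    (hs : ∀ w : List E, ∃ u : ℕ → ℝ, Summable u ∧ ∀ j, ∀ p ∈ U, ‖iterDir w (f j) p‖ ≤ u j)
    {p : E} (hp : p ∈ U) :
    Summable (fun j => fderiv ℝ (f j) p) ∧
      HasFDerivAt (fun q => ∑' j, f j q) (∑' j, fderiv ℝ (f j) p) p := by
  obtain ⟨u₀, hu₀, hb₀⟩ := hs []
  let b := Module.finBasis ℝ E
  have hs' := fun i => hs [b i]
  choose u hu hb using hs'
  have hnn : ∀ i j, 0 ≤ u i j := fun i j => (norm_nonneg _).trans (hb i j p hp)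
  set C : ℝ := Fintype.card (Fin (Module.finrank ℝ E)) • ‖b.equivFunL.toContinuousLinearMap‖
  have hsum : Summable fun j => C * ∑ i, u i j := (summable_sum fun i _ => hu i).mul_left _
  have hle : ∀ j, ∀ q ∈ U, ‖fderiv ℝ (f j) q‖ ≤ C * ∑ i, u i j := fun j q hq =>
    b.opNorm_le (Finset.sum_nonneg fun i _ => hnn i j) fun i =>
      (hb i j q hq).trans (Finset.single_le_sum (f := fun i => u i j)
        (fun i _ => hnn i j) (Finset.mem_univ i))
  obtain ⟨ε, hε, hball⟩ := Metric.isOpen_iff.1 hU p hp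
  refine ⟨Summable.of_norm_bounded hsum fun j => hle j p hp, ?_⟩
  exact hasFDerivAt_tsum_of_isPreconnected hsum Metric.isOpen_ball
    (convex_ball p ε).isPreconnected
    (fun j q hq => ((hf j q (hball hq)).differentiableAt').hasFDerivAt)
    (fun j q hq => hle j q (hball hq)) (Metric.mem_ball_self hε)
    (Summable.of_norm_bounded hu₀ fun j => hb₀ j p hp) (Metric.mem_ball_self hε)

theorem iterDir_tsum [FiniteDimensional ℝ E] (hU : IsOpen U)
    (hf : ∀ j, ∀ p ∈ U, SmoothAt (f j) p)
    (hs : ∀ w : List E, ∃ u : ℕ → ℝ, Summable u ∧ ∀ j, ∀ p ∈ U, ‖iterDir w (f j) p‖ ≤ u j)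
    (w : List E) {p : E} (hp : p ∈ U) :
    iterDir w (fun q => ∑' j, f j q) p = ∑' j, iterDir w (f j) p ∧
      DifferentiableAt ℝ (iterDir w fun q => ∑' j, f j q) p := by
  induction w generalizing f with
  | nil => exact ⟨rfl, (hasFDerivAt_tsum_of_iterDir hU hf hs hp).2.differentiableAt⟩
  | cons v w ih =>
    have hcongr : dirDeriv v (fun q => ∑' j, f j q) =ᶠ[𝓝 p] fun q => ∑' j, dirDeriv v (f j) q := by
      filter_upwards [hU.mem_nhds hp] with q hq
      obtain ⟨h1, h2⟩ := hasFDerivAt_tsum_of_iterDir hU hf hs hq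
      simp only [dirDeriv]
      rw [h2.fderiv]
      exact (ContinuousLinearMap.apply ℝ ℂ v).map_tsum h1
    have h3 := iterDir_congr hcongr w
    have h4 := ih (f := fun j => dirDeriv v (f j)) (fun j q hq => (hf j q hq).dirDeriv v)
      fun w => hs (v :: w)
    exact ⟨h3.eq_of_nhds.trans h4.1, h4.2.congr_of_eventuallyEq h3⟩

/-- It suffices to bound the derivatives along directions from a spanning set. -/
theorem summable_bound_of_span {B : Set E} (hB : Submodule.span ℝ B = ⊤)
    (hf : ∀ j, ∀ p ∈ U, SmoothAt (f j) p)
    (hs : ∀ w : List E, (∀ v ∈ w, v ∈ B) →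
      ∃ u : ℕ → ℝ, Summable u ∧ ∀ j, ∀ p ∈ U, ‖iterDir w (f j) p‖ ≤ u j) (w : List E) :
    ∃ u : ℕ → ℝ, Summable u ∧ ∀ j, ∀ p ∈ U, ‖iterDir w (f j) p‖ ≤ u j := by
  induction w generalizing f with
  | nil => exact hs [] (by simp)
  | cons v w ih =>
    have hv : v ∈ Submodule.span ℝ B := by rw [hB]; trivial
    induction hv using Submodule.span_induction with
    | mem v hv =>
      exact ih (f := fun j => dirDeriv v (f j)) (fun j p hp => (hf j p hp).dirDeriv v)
        fun w' hw' => hs (v :: w') fun x hx => by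
          rcases List.mem_cons.1 hx with rfl | hx
          · exact hv
          · exact hw' x hx
    | zero =>
      refine ⟨fun _ => 0, summable_zero, fun j p hp => ?_⟩
      rw [iterDir_cons, iterDir_eq_zero (Eventually.of_forall fun q => by simp [dirDeriv])]
      simp
    | add x y _ _ hx hy =>
      obtain ⟨u, hu, hub⟩ := hx
      obtain ⟨u', hu', hub'⟩ := hy
      refine ⟨fun j => u j + u' j, hu.add hu', fun j p hp => ?_⟩
      have : dirDeriv (x + y) (f j) = fun q => dirDeriv x (f j) q + dirDeriv y (f j) q := by
        ext q; simp [dirDeriv]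
      rw [iterDir_cons, this, iterDir_add ((hf j p hp).dirDeriv x) ((hf j p hp).dirDeriv y)]
      exact (norm_add_le _ _).trans (add_le_add (hub j p hp) (hub' j p hp))
    | smul c x _ hx =>
      obtain ⟨u, hu, hub⟩ := hx
      refine ⟨fun j => |c| * u j, hu.mul_left _, fun j p hp => ?_⟩
      have : dirDeriv (c • x) (f j) = fun q => (c : ℂ) * dirDeriv x (f j) q := by
        ext q; simp [dirDeriv]
      rw [iterDir_cons, this, iterDir_const_mul ((hf j p hp).dirDeriv x), norm_mul,
        Complex.norm_real, Real.norm_eq_abs]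
      exact mul_le_mul_of_nonneg_left (hub j p hp) (abs_nonneg _)

end Series

section Parametric

variable {V E F : Type*} [NormedAddCommGroup V] [NormedSpace ℝ V]
  [NormedAddCommGroup E] [NormedSpace ℝ E] [FiniteDimensional ℝ E]
  [NormedAddCommGroup F] [NormedSpace ℝ F]
  [MeasurableSpace F] [BorelSpace F] {μ : Measure F} [IsFiniteMeasureOnCompacts μ]
  (A : E →L[ℝ] V) (B : F →L[ℝ] V) {G : V → ℂ} {U : Set E} {k : Set F}

/-- The derivative is bounded on a compact neighbourhood of `p` times `k` and vanishes off `k`,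
which gives the domination. Smoothness of `G` is required only over `U`, since `G` will contain
negative powers of `(x - y)_l`. -/
theorem hasFDerivAt_parametric (hU : IsOpen U) (hk : IsCompact k)
    (hG : ∀ p ∈ U, ∀ ξ, SmoothAt G (A p + B ξ)) (h0 : ∀ p ∈ U, ∀ ξ, ξ ∉ k → G (A p + B ξ) = 0)
    {p : E} (hp : p ∈ U) :
    Integrable (fun ξ => fderiv ℝ (fun q => G (A q + B ξ)) p) μ ∧
    HasFDerivAt (fun q => ∫ ξ, G (A q + B ξ) ∂μ)
      (∫ ξ, fderiv ℝ (fun q => G (A q + B ξ)) p ∂μ) p := by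
  have hfd : ∀ q ∈ U, ∀ ξ, fderiv ℝ (fun q => G (A q + B ξ)) q =
      (fderiv ℝ G (A q + B ξ)).comp A := fun q hq ξ => by
    have h1 : HasFDerivAt (fun q => A q + B ξ) A q := A.hasFDerivAt.add_const _
    exact (((hG q hq ξ).differentiableAt').hasFDerivAt.comp q h1).fderiv
  have hcont : ∀ q ∈ U, ∀ ξ, ContinuousAt
      (fun x : E × F => (fderiv ℝ G (A x.1 + B x.2)).comp A) (q, ξ) := fun q hq ξ => by
    have h1 : ContinuousAt (fderiv ℝ G) (A q + B ξ) :=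
      ((hG q hq ξ).fderiv_right (m := (⊤ : ℕ∞)) (by simp)).continuousAt
    have h2 : ContinuousAt (fun x : E × F => A x.1 + B x.2) (q, ξ) := by fun_prop
    have h3 : ContinuousAt (fun x : E × F => fderiv ℝ G (A x.1 + B x.2)) (q, ξ) :=
      ContinuousAt.comp (f := fun x : E × F => A x.1 + B x.2) (x := (q, ξ)) h1 h2
    exact h3.clm_comp continuousAt_const
  have hGc : ∀ q ∈ U, Continuous fun ξ => G (A q + B ξ) := fun q hq =>
    continuous_iff_continuousAt.2 fun ξ =>
      ContinuousAt.comp (f := fun ξ : F => A q + B ξ) (hG q hq ξ).continuousAt (by fun_prop)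
  have hz : ∀ q ∈ U, ∀ ξ, ξ ∉ k → fderiv ℝ (fun q => G (A q + B ξ)) q = 0 := fun q hq ξ hξ => by
    have : (fun q => G (A q + B ξ)) =ᶠ[𝓝 q] fun _ => 0 := by
      filter_upwards [hU.mem_nhds hq] with x hx using h0 x hx ξ hξ
    rw [this.fderiv_eq]; simp
  have : ProperSpace E := FiniteDimensional.proper ℝ E
  obtain ⟨s, hs, hsU, hsc⟩ := local_compact_nhds (hU.mem_nhds hp)
  obtain ⟨M, hM⟩ := (hsc.prod hk).exists_bound_of_continuousOn
    (f := fun x : E × F => (fderiv ℝ G (A x.1 + B x.2)).comp A)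
    fun x hx => (hcont x.1 (hsU hx.1) x.2).continuousWithinAt
  have hbi : Integrable (k.indicator fun _ => M) μ :=
    (integrable_indicator_iff hk.measurableSet).2 (by
      rw [integrableOn_const_iff]
      exact Or.inr hk.measure_lt_top)
  have hbd : ∀ q ∈ s, ∀ ξ, ‖fderiv ℝ (fun q => G (A q + B ξ)) q‖ ≤ k.indicator (fun _ => M) ξ := by
    intro q hq ξ
    by_cases hξ : ξ ∈ k
    · rw [indicator_of_mem hξ, hfd q (hsU hq)]
      exact hM (q, ξ) ⟨hq, hξ⟩
    · rw [indicator_of_notMem hξ, hz q (hsU hq) ξ hξ, norm_zero]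
  have hmeas : AEStronglyMeasurable (fun ξ => fderiv ℝ (fun q => G (A q + B ξ)) p) μ := by
    simp only [hfd p hp]
    refine Continuous.aestronglyMeasurable (continuous_iff_continuousAt.2 fun ξ => ?_)
    exact ContinuousAt.comp (f := fun ξ : F => (p, ξ)) (hcont p hp ξ) (by fun_prop)
  refine ⟨hbi.mono' hmeas (Eventually.of_forall fun ξ => hbd p (mem_of_mem_nhds hs) ξ), ?_⟩
  refine hasFDerivAt_integral_of_dominated_of_fderiv_le (bound := k.indicator fun _ => M) hs ?_ ?_
    hmeas (Eventually.of_forall fun ξ q hq => hbd q hq ξ) hbi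
    (Eventually.of_forall fun ξ q hq => ?_)
  · filter_upwards [hU.mem_nhds hp] with q hq using (hGc q hq).aestronglyMeasurable
  · exact (hGc p hp).integrable_of_hasCompactSupport
      (HasCompactSupport.intro hk fun ξ hξ => h0 p hp ξ hξ)
  · have h1 : HasFDerivAt (fun q => A q + B ξ) A q := A.hasFDerivAt.add_const _
    exact (((hG q (hsU hq) ξ).differentiableAt').hasFDerivAt.comp q h1).differentiableAt.hasFDerivAt

/-- The class of integrands is stable: a derivative in `v` replaces `G` by its derivative along `A
v`, which still vanishes for `ξ ∉ k`. -/
theorem iterDir_parametric (hU : IsOpen U) (hk : IsCompact k)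
    (hG : ∀ p ∈ U, ∀ ξ, SmoothAt G (A p + B ξ)) (h0 : ∀ p ∈ U, ∀ ξ, ξ ∉ k → G (A p + B ξ) = 0)
    (w : List E) {p : E} (hp : p ∈ U) :
    iterDir w (fun q => ∫ ξ, G (A q + B ξ) ∂μ) p = ∫ ξ, iterDir (w.map A) G (A p + B ξ) ∂μ ∧
      DifferentiableAt ℝ (iterDir w fun q => ∫ ξ, G (A q + B ξ) ∂μ) p := by
  induction w generalizing G with
  | nil => exact ⟨rfl, (hasFDerivAt_parametric A B hU hk hG h0 hp).2.differentiableAt⟩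
  | cons v w ih =>
    have hd : ∀ q ∈ U, ∀ ξ, dirDeriv v (fun q => G (A q + B ξ)) q = dirDeriv (A v) G (A q + B ξ) :=
      fun q hq ξ => (dirDeriv_comp_affine A (B ξ) (hG q hq ξ) v).eq_of_nhds
    have hcongr : dirDeriv v (fun q => ∫ ξ, G (A q + B ξ) ∂μ) =ᶠ[𝓝 p]
        fun q => ∫ ξ, dirDeriv (A v) G (A q + B ξ) ∂μ := by
      filter_upwards [hU.mem_nhds hp] with q hq
      obtain ⟨h1, h2⟩ := hasFDerivAt_parametric (μ := μ) A B hU hk hG h0 hq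
      simp only [← hd q hq]
      unfold dirDeriv
      rw [h2.fderiv, ContinuousLinearMap.integral_apply h1]
    have h3 := iterDir_congr hcongr w
    have h4 := ih (G := dirDeriv (A v) G) (fun q hq ξ => (hG q hq ξ).dirDeriv _) fun q hq ξ hξ => by
      rw [← hd q hq]
      have : (fun q => G (A q + B ξ)) =ᶠ[𝓝 q] fun _ => 0 := by
        filter_upwards [hU.mem_nhds hq] with x hx using h0 x hx ξ hξ
      exact iterDir_eq_zero this [v]
    exact ⟨h3.eq_of_nhds.trans h4.1, h4.2.congr_of_eventuallyEq h3⟩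

theorem contDiffOn_parametric (hU : IsOpen U) (hk : IsCompact k)
    (hG : ∀ p ∈ U, ∀ ξ, SmoothAt G (A p + B ξ))
    (h0 : ∀ p ∈ U, ∀ ξ, ξ ∉ k → G (A p + B ξ) = 0) :
    ContDiffOn ℝ (⊤ : ℕ∞) (fun q => ∫ ξ, G (A q + B ξ) ∂μ) U :=
  contDiffOn_of_iterDir hU fun w _ hp => (iterDir_parametric A B hU hk hG h0 w hp).2

end Parametric

section Parts

theorem hasCompactSupport_dirDeriv {V : Type*} [NormedAddCommGroup V] [NormedSpace ℝ V] {b : V → ℂ}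
    (hc : HasCompactSupport b) (v : V) :
    HasCompactSupport (dirDeriv v b) := by
  refine (hc.fderiv (𝕜 := ℝ)).mono fun x hx => ?_
  rw [Function.mem_support] at hx ⊢
  intro h
  exact hx (by simp [dirDeriv, h])

variable {F : Type*} [NormedAddCommGroup F] [NormedSpace ℝ F] [FiniteDimensional ℝ F]
  [MeasurableSpace F] [BorelSpace F] {μ : Measure F} [μ.IsAddHaarMeasure]

/-- Repeated integration by parts against a function `e` with `∂_v e = c e`. -/
theorem integral_mul_eq_iterDir {e b : F → ℂ} {v : F} {c : ℂ} (he : ContDiff ℝ (⊤ : ℕ∞) e)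
    (hev : ∀ x, dirDeriv v e x = c * e x) (hb : ContDiff ℝ (⊤ : ℕ∞) b) (hc : HasCompactSupport b)
    (N : ℕ) :
    (-c) ^ N * ∫ x, e x * b x ∂μ = ∫ x, e x * iterDir (List.replicate N v) b x ∂μ := by
  induction N generalizing b with
  | zero => simp
  | succ N ih =>
    have hb' : ContDiff ℝ (⊤ : ℕ∞) (dirDeriv v b) :=
      contDiff_iff_contDiffAt.2 fun x => SmoothAt.dirDeriv hb.contDiffAt v
    have hcd := hasCompactSupport_dirDeriv hc v
    rw [List.replicate_succ, iterDir_cons, ← ih hb' hcd, pow_succ, mul_assoc]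
    congr 1
    have h1 := integral_mul_fderiv_eq_neg_fderiv_mul_of_integrable (μ := μ) (f := e) (g := b)
      (v := v) ?_ ?_ ?_ (fun x _ => (he.differentiable (by simp)) x)
      fun x _ => (hb.differentiable (by simp)) x
    · have h2 : ∀ x, fderiv ℝ e x v = c * e x := hev
      simp only [h2, mul_assoc] at h1
      rw [integral_const_mul] at h1
      rw [neg_mul, ← h1]
      rfl
    · have h2 : ∀ x, fderiv ℝ e x v = c * e x := hev
      simp only [h2, mul_assoc]
      exact ((he.continuous.mul hb.continuous).integrable_of_hasCompactSupport
        hc.mul_left).const_mul c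
    · exact (he.continuous.mul hb'.continuous).integrable_of_hasCompactSupport hcd.mul_left
    · exact (he.continuous.mul hb.continuous).integrable_of_hasCompactSupport hc.mul_left

end Parts

end

noncomputable section

/-! ### Dyadic decomposition of amplitudes -/

namespace IsWeight

variable {ω : ℝ → ℝ}

/-- Choice of the number of integrations by parts at scale `R`. -/
theorem exists_order_decay (hω : IsWeight ω) {ρ B μ : ℝ} (hρ₀ : 0 < ρ) (hρ₁ : ρ ≤ 1) (hB : 1 ≤ B)
    (hμ : 0 < μ) :
    ∃ lam₀ C : ℝ, 0 < lam₀ ∧ ∀ R, 1 ≤ R → ∃ N : ℕ, ∀ lam, lam₀ ≤ lam → ∀ i j : ℕ, i + j = N →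
      N * Real.log B + (scaledConj ω lam i - i * Real.log R) +
        ρ * (scaledConj ω lam j - j * Real.log R) ≤ C - μ * ω R := by
  -- Division by `ρ` because amplitude derivatives gain only the power `ρ`; the `1` pays for the
  -- `log R` lost in rounding the order.
  set μ₀ := (μ + 1) / ρ with hμ₀
  have hμ₀pos : 0 < μ₀ := by positivity
  have hlB := Real.log_nonneg hB
  -- The base is `B^{1/ρ}`, because `B^N` has to be absorbed inside an expression that is multiplied
  -- by `ρ`.
  obtain ⟨lam₀, C₂, hl₀, -, hab⟩ := hω.exists_geom_absorb
    (Real.one_le_exp (div_nonneg hlB hρ₀.le)) hμ₀pos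
  obtain ⟨C₁, hC₁, hlog⟩ := hω.exists_log_le hμ₀pos
  obtain ⟨C₀, hC₀, hlog'⟩ := hω.exists_log_le one_pos
  refine ⟨max lam₀ μ₀, C₁ + ρ * C₂ + ρ * C₀, lt_max_of_lt_left hl₀, fun R hR => ?_⟩
  obtain ⟨N, hN⟩ := hω.exists_optimal_order hμ₀pos hR
  refine ⟨N, fun lam hl i j hij => ?_⟩
  have hl1 : lam₀ ≤ lam := (le_max_left _ _).trans hl
  have hl2 : μ₀ ≤ lam := (le_max_right _ _).trans hl
  have hlpos : 0 < lam := hl₀.trans_le hl1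
  have hijR : (i : ℝ) + j = N := by exact_mod_cast hij
  have h1 : scaledConj ω lam i - i * Real.log R ≤ C₁ := by
    have h2 := hω.scaledConj_anti hμ₀pos hl2 (k := (i : ℝ)) (by positivity)
    have h3 := hω.scaledConj_sub_le hμ₀pos (j := (i : ℝ)) (k := N) (s := Real.log R) (c := C₁)
      (by positivity) (by exact_mod_cast (by omega : i ≤ N)) hC₁ (by linarith [hlog R hR])
    linarith
  have h2 := hω.scaledConj_add_le hlpos (j := (i : ℝ)) (k := j) (by positivity) (by positivity)
  rw [hijR] at h2
  have h3 := hab lam hl1 N (by positivity)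
  rw [Real.log_exp] at h3
  have h4 : ρ * (N * (Real.log B / ρ) + scaledConj ω lam N - N * Real.log R) ≤
      ρ * (Real.log R - μ₀ * ω R + C₂) := mul_le_mul_of_nonneg_left (by linarith) hρ₀.le
  have h5 : ρ * (N * (Real.log B / ρ) + scaledConj ω lam N - N * Real.log R) =
      N * Real.log B + ρ * (scaledConj ω lam N - N * Real.log R) := by field_simp; ring
  have h6 : ρ * (Real.log R - μ₀ * ω R + C₂) = ρ * Real.log R - (μ + 1) * ω R + ρ * C₂ := by
    rw [hμ₀]; field_simp
  have h7 : ρ * Real.log R ≤ ω R + ρ * C₀ := by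
    have := hlog' R hR
    have h0 := hω.nonneg R (by linarith)
    nlinarith
  -- The cut-off bracket is split into shares `1 - ρ` and `ρ`. The first is bounded by a constant;
  -- the second joins the amplitude bracket, and superadditivity gives `ρ` times the bracket of
  -- order `N`.
  have h8 : (1 - ρ) * (scaledConj ω lam i - i * Real.log R) ≤ (1 - ρ) * C₁ :=
    mul_le_mul_of_nonneg_left h1 (by linarith)
  have h9 : (1 - ρ) * C₁ ≤ C₁ := by nlinarith
  have h10 : ρ * (scaledConj ω lam i + scaledConj ω lam j) ≤ ρ * scaledConj ω lam N :=
    mul_le_mul_of_nonneg_left h2 hρ₀.le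
  have h11 : ρ * (N * Real.log R) = ρ * (i * Real.log R) + ρ * (j * Real.log R) := by
    rw [← hijR]; ring
  nlinarith

end IsWeight

theorem DirBound.mul_of_le {V : Type*} [NormedAddCommGroup V] [NormedSpace ℝ V] {B : Set V}
    {f g : V → ℂ} {z : V} {A A' M : ℕ → ℝ} (h : DirBound B f z A)
    (h' : DirBound B g z A') (hf : SmoothAt f z) (hg : SmoothAt g z)
    (hM : ∀ i j, A i * A' j ≤ M (i + j)) :
    DirBound B (fun y => f y * g y) z fun n => 2 ^ n * M n := by
  refine (h.mul h' hf hg).mono fun n => ?_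
  calc ∑ i ∈ Finset.range (n + 1), (n.choose i : ℝ) * (A i * A' (n - i))
      ≤ ∑ i ∈ Finset.range (n + 1), (n.choose i : ℝ) * M n := by
        refine Finset.sum_le_sum fun i hi => mul_le_mul_of_nonneg_left ?_ (by positivity)
        refine (hM i (n - i)).trans (le_of_eq ?_)
        rw [Nat.add_sub_cancel' (Nat.lt_succ_iff.1 (Finset.mem_range.1 hi))]
    _ = 2 ^ n * M n := by
        rw [← Finset.sum_mul]
        congr 1
        exact_mod_cast Nat.sum_range_choose n

/-- Complex-valued cut-off functions of class `𝓓_(ω)` on the line. -/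
structure IsCutoff (ω : ℝ → ℝ) (h : ℝ → ℂ) : Prop where
  contDiff : ContDiff ℝ (⊤ : ℕ∞) h
  eq_one : ∀ t, |t| ≤ 1 → h t = 1
  eq_zero : ∀ t, 4 ≤ |t| → h t = 0
  bound : ∀ lam, 0 < lam → ∃ C : ℝ, 0 ≤ C ∧ ∀ (k : ℕ) (t : ℝ),
    ‖iteratedDeriv k h t‖ ≤ C * Real.exp (scaledConj ω lam k)

theorem IsWeight.exists_isCutoff {ω : ℝ → ℝ} (hω : IsWeight ω) : ∃ h : ℝ → ℂ, IsCutoff ω h := by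
  obtain ⟨h, hh, h1, h4, hb⟩ := hω.exists_cutoff
  have hit : ∀ k t, iteratedDeriv k (fun t => (h t : ℂ)) t = (iteratedDeriv k h t : ℝ) := by
    intro k
    induction k with
    | zero => simp
    | succ k ih =>
      intro t
      rw [iteratedDeriv_succ, iteratedDeriv_succ, funext ih]
      exact (((hh.differentiable_iteratedDeriv k
        (by exact_mod_cast WithTop.coe_lt_top k)) t).hasDerivAt.ofReal_comp).deriv
  refine ⟨fun t => (h t : ℂ), Complex.ofRealCLM.contDiff.comp hh, fun t ht => by simp [h1 t ht],
    fun t ht => by simp [h4 t ht], fun lam hl => ?_⟩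
  obtain ⟨C, hC, hCb⟩ := hb lam hl
  exact ⟨C, hC, fun k t => by rw [hit, Complex.norm_real]; exact hCb k t⟩

variable {d : ℕ}

/-- The coordinate functionals of `ℝ^{3d}`. -/
def coordForm : Fin d ⊕ Fin d ⊕ Fin d → Euc d × Euc d × Euc d →L[ℝ] ℝ
  | .inl j => (EuclideanSpace.proj j).comp (ContinuousLinearMap.fst ℝ _ _)
  | .inr (.inl j) => (EuclideanSpace.proj j).comp
      ((ContinuousLinearMap.fst ℝ _ _).comp (ContinuousLinearMap.snd ℝ _ _))
  | .inr (.inr j) => (EuclideanSpace.proj j).comp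
      ((ContinuousLinearMap.snd ℝ _ _).comp (ContinuousLinearMap.snd ℝ _ _))

@[simp] theorem coordForm_inl (j : Fin d) (z : Euc d × Euc d × Euc d) :
    coordForm (.inl j) z = z.1 j := rfl

@[simp] theorem coordForm_inr_inl (j : Fin d) (z : Euc d × Euc d × Euc d) :
    coordForm (.inr (.inl j)) z = z.2.1 j := rfl

@[simp] theorem coordForm_inr_inr (j : Fin d) (z : Euc d × Euc d × Euc d) :
    coordForm (.inr (.inr j)) z = z.2.2 j := rfl

theorem abs_stdVec_le (j k : Fin d) : |(stdVec j : Euc d) k| ≤ 1 := by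
  simp only [stdVec, PiLp.single_apply]
  split_ifs <;> simp

theorem abs_coordForm_le {v : Euc d × Euc d × Euc d} (hv : v ∈ basis₃ d)
    (i : Fin d ⊕ Fin d ⊕ Fin d) : |coordForm i v| ≤ 1 := by
  rcases hv with ⟨j, rfl⟩ | ⟨j, rfl⟩ | ⟨j, rfl⟩ <;> rcases i with i | i | i <;>
    simp [abs_stdVec_le]

theorem abs_list_prod_le {l : List ℝ} {c : ℝ} (h : ∀ x ∈ l, |x| ≤ c) : |l.prod| ≤ c ^ l.length := by
  induction l with
  | nil => simp
  | cons a l ih =>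
    rw [List.prod_cons, abs_mul, List.length_cons, pow_succ']
    have h1 := h a (by simp)
    exact mul_le_mul h1 (ih fun x hx => h x (by simp [hx])) (abs_nonneg _)
      ((abs_nonneg _).trans h1)

/-- The bounds for a function of a linear form. -/
theorem dirBound_comp_linear {V : Type*} [NormedAddCommGroup V] [NormedSpace ℝ V] {S : Set V}
    (L : V →L[ℝ] ℝ) {f : ℝ → ℂ} {z : V} (hf : SmoothAt f (L z)) {c : ℝ}
    (hc : ∀ v ∈ S, |L v| ≤ c) {A : ℕ → ℝ} (hA : ∀ n, ‖iteratedDeriv n f (L z)‖ ≤ A n) :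
    DirBound S (fun y => f (L y)) z fun n => c ^ n * A n := by
  intro w hw
  rw [iterDir_comp_linear L hf, norm_mul, Complex.norm_real, Real.norm_eq_abs]
  have h1 : |(w.map L).prod| ≤ c ^ w.length := by
    have := abs_list_prod_le (l := w.map L) (c := c) fun x hx => by
      obtain ⟨v, hv, rfl⟩ := List.mem_map.1 hx
      exact hc v (hw v hv)
    simpa using this
  exact mul_le_mul h1 (hA _) (norm_nonneg _) ((abs_nonneg _).trans h1)

/-- The tensor product cut-off at scale `2 ^ J`. -/
def tensorCut (h : ℝ → ℂ) (J : ℕ) (z : Euc d × Euc d × Euc d) : ℂ :=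
  ∏ i, h ((((2 : ℝ) ^ J)⁻¹ • coordForm i) z)

/-- The differences of consecutive cut-offs, a partition of unity. -/
def shellCut (h : ℝ → ℂ) : ℕ → Euc d × Euc d × Euc d → ℂ
  | 0 => tensorCut h 0
  | J + 1 => fun z => tensorCut h (J + 1) z - tensorCut h J z

theorem sum_shellCut (h : ℝ → ℂ) (J : ℕ) (z : Euc d × Euc d × Euc d) :
    ∑ j ∈ Finset.range (J + 1), shellCut h j z = tensorCut h J z := by
  induction J with
  | zero => simp [shellCut]
  | succ J ih => rw [Finset.sum_range_succ, ih, shellCut]; ring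

variable {ω : ℝ → ℝ} {h : ℝ → ℂ}

theorem IsCutoff.contDiff_tensorCut (hh : IsCutoff ω h) (J : ℕ) :
    ContDiff ℝ (⊤ : ℕ∞) (tensorCut (d := d) h J) := by
  refine contDiff_prod fun i _ => ?_
  exact hh.contDiff.comp (((2 : ℝ) ^ J)⁻¹ • coordForm i).contDiff

theorem IsCutoff.contDiff_shellCut (hh : IsCutoff ω h) (J : ℕ) :
    ContDiff ℝ (⊤ : ℕ∞) (shellCut (d := d) h J) := by
  cases J with
  | zero => exact hh.contDiff_tensorCut 0
  | succ J => exact (hh.contDiff_tensorCut _).sub (hh.contDiff_tensorCut _)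

/-- Each factor depends on one linear form, so its chain rule is exact; this is the reason for a
tensor product instead of a radial cut-off. Every further factor costs `2^n` in the Leibniz rule,
absorbed by changing `lam` at each induction step. -/
theorem IsCutoff.dirBound_prod (hω : IsWeight ω) (hh : IsCutoff ω h)
    (s : Finset (Fin d ⊕ Fin d ⊕ Fin d)) {lam : ℝ} (hl : 0 < lam) :
    ∃ C : ℝ, 0 ≤ C ∧ ∀ (J : ℕ) (z : Euc d × Euc d × Euc d),
      DirBound (basis₃ d) (fun z => ∏ i ∈ s, h ((((2 : ℝ) ^ J)⁻¹ • coordForm i) z)) z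
        fun n => C * Real.exp (scaledConj ω lam n) * ((2 ^ J)⁻¹) ^ n := by
  classical
  induction s using Finset.induction_on generalizing lam with
  | empty =>
    refine ⟨1, zero_le_one, fun J z w _ => ?_⟩
    rcases w with _ | ⟨v, w⟩
    · simpa using hω.scaledConj_nonneg hl le_rfl
    · rw [iterDir_cons, iterDir_eq_zero (Eventually.of_forall fun q => by simp [dirDeriv])]
      rw [norm_zero]; positivity
  | insert i s hi ih =>
    obtain ⟨lam', C₀, hl', hC₀, hab⟩ := hω.exists_geom_absorb (one_le_two (α := ℝ)) hl
    obtain ⟨C₁, hC₁, h1⟩ := ih hl'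
    obtain ⟨C₂, hC₂, h2⟩ := hh.bound lam' hl'
    refine ⟨Real.exp C₀ * (C₂ * C₁), by positivity, fun J z => ?_⟩
    have h3 := dirBound_comp_linear (S := basis₃ d) (((2 : ℝ) ^ J)⁻¹ • coordForm i) (f := h)
      (z := z) hh.contDiff.contDiffAt (c := (2 ^ J)⁻¹) (fun v hv => by
        rw [_root_.smul_apply, smul_eq_mul, abs_mul, abs_of_pos (by positivity)]
        exact mul_le_of_le_one_right (by positivity) (abs_coordForm_le hv i))
      (fun n => h2 n _)
    have hsm : SmoothAt (fun z => ∏ i ∈ s, h ((((2 : ℝ) ^ J)⁻¹ • coordForm i) z)) z :=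
      (contDiff_prod fun i _ =>
        hh.contDiff.comp (((2 : ℝ) ^ J)⁻¹ • coordForm i).contDiff).contDiffAt
    have h4 := h3.mul_of_le (h1 J z)
      (hh.contDiff.comp (((2 : ℝ) ^ J)⁻¹ • coordForm i).contDiff).contDiffAt hsm
      (M := fun n => C₂ * C₁ * Real.exp (scaledConj ω lam' n) * ((2 ^ J)⁻¹) ^ n) fun a b => by
        have h5 := hω.scaledConj_add_le hl' (j := (a : ℝ)) (k := b) (by positivity)
          (by positivity)
        rw [← Real.exp_le_exp, Real.exp_add] at h5
        rw [Nat.cast_add, pow_add]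
        calc _ = C₂ * C₁ * (Real.exp (scaledConj ω lam' a) * Real.exp (scaledConj ω lam' b)) *
              (((2 ^ J)⁻¹) ^ a * ((2 ^ J)⁻¹) ^ b) := by ring
          _ ≤ _ := by gcongr
    simp only [Finset.prod_insert hi]
    refine h4.mono fun n => ?_
    have h6 := hab lam' le_rfl n (by positivity)
    rw [← Real.exp_le_exp, Real.exp_add, Real.exp_add, ← Real.log_pow,
      Real.exp_log (by positivity)] at h6
    calc _ = C₂ * C₁ * (2 ^ n * Real.exp (scaledConj ω lam' n)) * ((2 ^ J)⁻¹) ^ n := by ring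
      _ ≤ C₂ * C₁ * (Real.exp (scaledConj ω lam n) * Real.exp C₀) * ((2 ^ J)⁻¹) ^ n := by gcongr
      _ = _ := by ring

theorem IsCutoff.dirBound_shellCut (hω : IsWeight ω) (hh : IsCutoff ω h) {lam : ℝ} (hl : 0 < lam) :
    ∃ C : ℝ, 0 ≤ C ∧ ∀ (J : ℕ) (z : Euc d × Euc d × Euc d),
      DirBound (basis₃ d) (shellCut h J) z
        fun n => C * Real.exp (scaledConj ω lam n) * ((2 ^ J)⁻¹) ^ n := by
  obtain ⟨lam', C₀, hl', hC₀, hab⟩ := hω.exists_geom_absorb (one_le_two (α := ℝ)) hl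
  obtain ⟨C, hC, hb⟩ := hh.dirBound_prod (d := d) hω Finset.univ hl'
  have h6 : ∀ n : ℕ, 2 ^ n * Real.exp (scaledConj ω lam' n) ≤
      Real.exp (scaledConj ω lam n) * Real.exp C₀ := fun n => by
    have h6 := hab lam' le_rfl n (by positivity)
    rwa [← Real.exp_le_exp, Real.exp_add, Real.exp_add, ← Real.log_pow,
      Real.exp_log (by positivity)] at h6
  have h7 : ∀ n : ℕ, Real.exp (scaledConj ω lam' n) ≤
      Real.exp (scaledConj ω lam n) * Real.exp C₀ := fun n =>
    (le_mul_of_one_le_left (Real.exp_pos _).le (one_le_pow₀ one_le_two)).trans (h6 n)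
  refine ⟨2 * (C * Real.exp C₀), by positivity, fun J z w hw => ?_⟩
  have h6' := h6 w.length
  have h7' := h7 w.length
  rcases J with _ | J
  · refine (hb 0 z w hw).trans ?_
    simp only [pow_zero, inv_one, one_pow, mul_one]
    have := mul_le_mul_of_nonneg_left h7' hC
    have : 0 ≤ C * (Real.exp (scaledConj ω lam w.length) * Real.exp C₀) := by positivity
    linarith
  · rw [shellCut, iterDir_sub (hh.contDiff_tensorCut _).contDiffAt
      (hh.contDiff_tensorCut _).contDiffAt]
    refine (norm_sub_le _ _).trans ((add_le_add (hb (J + 1) z w hw) (hb J z w hw)).trans ?_)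
    have e : ((2 : ℝ) ^ J)⁻¹ ^ w.length = 2 ^ w.length * ((2 ^ (J + 1))⁻¹) ^ w.length := by
      rw [← mul_pow]; congr 1; rw [pow_succ]; field_simp
    simp only [e]
    have hq : 0 ≤ C * ((2 : ℝ) ^ (J + 1))⁻¹ ^ w.length := by positivity
    have h8 := mul_le_mul_of_nonneg_left h6' hq
    have h9 := mul_le_mul_of_nonneg_left h7' hq
    linarith

/-- Both cut-offs in the difference vanish there. A whole neighbourhood is needed so that the
derivatives vanish too. -/
theorem shellCut_eventually_zero_of_lt (hh : IsCutoff ω h) {J : ℕ} {z : Euc d × Euc d × Euc d}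
    {i : Fin d ⊕ Fin d ⊕ Fin d} (hi : 4 * 2 ^ J < |coordForm i z|) :
    shellCut h J =ᶠ[𝓝 z] fun _ => 0 := by
  have hopen : ∀ᶠ y in 𝓝 z, 4 * 2 ^ J < |coordForm i y| :=
    (coordForm i).continuous.abs.continuousAt.eventually (lt_mem_nhds hi)
  have key : ∀ K : ℕ, K ≤ J → ∀ y, 4 * 2 ^ J < |coordForm i y| → tensorCut h K y = 0 := by
    intro K hK y hy
    refine Finset.prod_eq_zero (Finset.mem_univ i) (hh.eq_zero _ ?_)
    rw [_root_.smul_apply, smul_eq_mul, abs_mul, abs_of_pos (by positivity),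
      le_inv_mul_iff₀ (by positivity), mul_comm]
    have : (2 : ℝ) ^ K ≤ 2 ^ J := pow_le_pow_right₀ one_le_two hK
    linarith
  filter_upwards [hopen] with y hy
  rcases J with _ | J
  · exact key 0 le_rfl y hy
  · simp [shellCut, key (J + 1) le_rfl y hy, key J (Nat.le_succ J) y hy]

theorem shellCut_succ_eventually_zero (hh : IsCutoff ω h) {J : ℕ} {z : Euc d × Euc d × Euc d}
    (hz : ∀ i, |coordForm i z| < 2 ^ J) :
    shellCut h (J + 1) =ᶠ[𝓝 z] fun _ => 0 := by
  have hopen : ∀ᶠ y in 𝓝 z, ∀ i, |coordForm i y| < 2 ^ J :=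
    eventually_all.2 fun i =>
      (coordForm i).continuous.abs.continuousAt.eventually (gt_mem_nhds (hz i))
  have key : ∀ K : ℕ, J ≤ K → ∀ y : Euc d × Euc d × Euc d, (∀ i, |coordForm i y| < 2 ^ J) →
      tensorCut h K y = 1 := by
    intro K hK y hy
    refine Finset.prod_eq_one fun i _ => hh.eq_one _ ?_
    rw [_root_.smul_apply, smul_eq_mul, abs_mul, abs_of_pos (by positivity),
      inv_mul_le_iff₀ (by positivity), mul_one]
    exact (hy i).le.trans (pow_le_pow_right₀ one_le_two hK)
  filter_upwards [hopen] with y hy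
  simp [shellCut, key (J + 1) (Nat.le_succ J) y hy, key J le_rfl y hy]

end

/-! ### Amplitudes on a dyadic shell -/

noncomputable section

variable {d : ℕ} {ω : ℝ → ℝ} {h : ℝ → ℂ} {ρ m : ℝ} {a : Euc d × Euc d × Euc d → ℂ}

/-- The bracket `⟨(x, y, ξ)⟩`. -/
def bracket (z : Euc d × Euc d × Euc d) : ℝ := √(1 + ‖z.1‖ ^ 2 + ‖z.2.1‖ ^ 2 + ‖z.2.2‖ ^ 2)

/-- The bracket `⟨x - y⟩`. -/
def gapBracket (z : Euc d × Euc d × Euc d) : ℝ := √(1 + ‖z.1 - z.2.1‖ ^ 2)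

theorem one_le_bracket (z : Euc d × Euc d × Euc d) : 1 ≤ bracket z :=
  Real.one_le_sqrt.2 (by nlinarith [sq_nonneg ‖z.1‖, sq_nonneg ‖z.2.1‖, sq_nonneg ‖z.2.2‖])

theorem one_le_gapBracket (z : Euc d × Euc d × Euc d) : 1 ≤ gapBracket z :=
  Real.one_le_sqrt.2 (by nlinarith [sq_nonneg ‖z.1 - z.2.1‖])

theorem abs_coord_le_norm (x : Euc d) (j : Fin d) : |x j| ≤ ‖x‖ := PiLp.norm_apply_le x j

theorem norm_le_of_coord_le {x : Euc d} {c : ℝ} (hc : 0 ≤ c) (hx : ∀ j, |x j| ≤ c) :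
    ‖x‖ ≤ d * c := by
  refine abs_le_of_sq_le_sq' ?_ (by positivity) |>.2
  rw [EuclideanSpace.norm_sq_eq]
  calc ∑ i, ‖x i‖ ^ 2 ≤ ∑ _i : Fin d, c ^ 2 := by
        refine Finset.sum_le_sum fun i _ => pow_le_pow_left₀ (norm_nonneg _) (hx i) 2
    _ = d * c ^ 2 := by simp
    _ ≤ (d * c) ^ 2 := by
        rw [mul_pow]
        refine mul_le_mul_of_nonneg_right ?_ (by positivity)
        exact_mod_cast Nat.le_self_pow two_ne_zero d

theorem abs_coordForm_le_bracket (i : Fin d ⊕ Fin d ⊕ Fin d) (z : Euc d × Euc d × Euc d) :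
    |coordForm i z| ≤ bracket z := by
  have key : ∀ (x : Euc d) (j : Fin d),
      ‖x‖ ^ 2 ≤ 1 + ‖z.1‖ ^ 2 + ‖z.2.1‖ ^ 2 + ‖z.2.2‖ ^ 2 → |x j| ≤ bracket z :=
    fun x j hx => (abs_coord_le_norm x j).trans (Real.le_sqrt_of_sq_le hx)
  have h1 := sq_nonneg ‖z.1‖
  have h2 := sq_nonneg ‖z.2.1‖
  have h3 := sq_nonneg ‖z.2.2‖
  rcases i with i | i | i
  · exact key z.1 i (by linarith)
  · exact key z.2.1 i (by linarith)
  · exact key z.2.2 i (by linarith)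

/-- The dyadic shell that supports the `J`-th cut-off. -/
structure InShell (J : ℕ) (z : Euc d × Euc d × Euc d) : Prop where
  norm_fst : ‖z.1‖ ≤ (4 * d + 1) * 2 ^ J
  norm_snd : ‖z.2.1‖ ≤ (4 * d + 1) * 2 ^ J
  norm_trd : ‖z.2.2‖ ≤ (4 * d + 1) * 2 ^ J
  le_bracket : 2 ^ J ≤ 2 * bracket z

theorem IsCutoff.shellCut_eventually_zero (hh : IsCutoff ω h) {J : ℕ} {z : Euc d × Euc d × Euc d}
    (hz : ¬ InShell J z) : shellCut h J =ᶠ[𝓝 z] fun _ => 0 := by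
  by_cases h1 : ∃ i, 4 * 2 ^ J < |coordForm i z|
  · obtain ⟨i, hi⟩ := h1
    exact shellCut_eventually_zero_of_lt hh hi
  push Not at h1
  rcases J with _ | J
  · have hD : (d : ℝ) * (4 * 2 ^ 0) ≤ (4 * d + 1) * 2 ^ 0 := by linarith
    refine absurd ⟨?_, ?_, ?_, ?_⟩ hz
    · exact (norm_le_of_coord_le (by positivity) fun j => h1 (.inl j)).trans hD
    · exact (norm_le_of_coord_le (by positivity) fun j => h1 (.inr (.inl j))).trans hD
    · exact (norm_le_of_coord_le (by positivity) fun j => h1 (.inr (.inr j))).trans hD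
    · have := one_le_bracket z
      linarith
  · refine shellCut_succ_eventually_zero hh fun i => ?_
    by_contra hi
    push Not at hi
    have h2 : (0 : ℝ) < 2 ^ (J + 1) := by positivity
    have hD : (d : ℝ) * (4 * 2 ^ (J + 1)) ≤ (4 * d + 1) * 2 ^ (J + 1) := by nlinarith
    refine hz ⟨?_, ?_, ?_, ?_⟩
    · exact (norm_le_of_coord_le (by positivity) fun j => h1 (.inl j)).trans hD
    · exact (norm_le_of_coord_le (by positivity) fun j => h1 (.inr (.inl j))).trans hD
    · exact (norm_le_of_coord_le (by positivity) fun j => h1 (.inr (.inr j))).trans hD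
    · have := hi.trans (abs_coordForm_le_bracket i z)
      rw [pow_succ']
      linarith

theorem gapBracket_le (z : Euc d × Euc d × Euc d) : gapBracket z ≤ 2 * bracket z := by
  refine Real.sqrt_le_iff.2 ⟨by linarith [one_le_bracket z], ?_⟩
  rw [mul_pow, bracket, Real.sq_sqrt (by positivity)]
  have := norm_sub_le z.1 z.2.1
  have h0 := norm_nonneg (z.1 - z.2.1)
  nlinarith [sq_nonneg (‖z.1‖ - ‖z.2.1‖), sq_nonneg ‖z.2.2‖, sq_nonneg ‖z.1‖, sq_nonneg ‖z.2.1‖]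

theorem InShell.gapBracket_le {J : ℕ} {z : Euc d × Euc d × Euc d} (hz : InShell J z) :
    gapBracket z ≤ 3 * (4 * d + 1) * 2 ^ J := by
  have hR : (1 : ℝ) ≤ (4 * d + 1) * 2 ^ J := by
    have : (1 : ℝ) ≤ 2 ^ J := one_le_pow₀ one_le_two
    have h2 : (0 : ℝ) ≤ d := by positivity
    nlinarith
  have h1 := norm_sub_le z.1 z.2.1
  have h2 := hz.norm_fst
  have h3 := hz.norm_snd
  have h0 := norm_nonneg (z.1 - z.2.1)
  refine Real.sqrt_le_iff.2 ⟨by positivity, ?_⟩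
  rw [mul_assoc]
  set T : ℝ := (4 * d + 1) * 2 ^ J
  have h4 : ‖z.1 - z.2.1‖ ^ 2 ≤ (2 * T) ^ 2 := pow_le_pow_left₀ h0 (by linarith) 2
  nlinarith

/-- The class is indexed by integers; `n = ⌈lam⌉` serves a real parameter since the scaled conjugate
decreases in it. -/
theorem IsAmplitude.dirBound (hω : IsWeight ω) (hρ₀ : 0 < ρ) (ha : IsAmplitude ω ρ m a) {lam : ℝ}
    (hl : 0 < lam) : ∃ C : ℝ, 0 ≤ C ∧ ∀ z, DirBound (basis₃ d) a z fun n =>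
      C * (gapBracket z / bracket z) ^ (ρ * n) * Real.exp (ρ * scaledConj ω lam n) *
        Real.exp (m * (ω ‖z.1‖ + ω ‖z.2.1‖ + ω ‖z.2.2‖)) := by
  have hN : 1 ≤ ⌈lam⌉₊ := Nat.one_le_ceil_iff.2 hl
  obtain ⟨C, hC, hb⟩ := ha.2 ⌈lam⌉₊ hN
  refine ⟨C, hC.le, fun z => dirBound_of_deriv₃ ha.1.contDiffAt fun α β γ => ?_⟩
  refine (hb z.1 z.2.1 z.2.2 α β γ).trans ?_
  have h1 := hω.scaledConj_anti hl (Nat.le_ceil lam)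
    (k := ((len α + len β + len γ : ℕ) : ℝ)) (by positivity)
  have h2 : (⌈lam⌉₊ : ℝ) * ρ * youngConj ω (((len α + len β + len γ : ℕ) : ℝ) / ⌈lam⌉₊) ≤
      ρ * scaledConj ω lam ((len α + len β + len γ : ℕ) : ℝ) := by
    refine le_trans (le_of_eq ?_) (mul_le_mul_of_nonneg_left h1 hρ₀.le)
    unfold scaledConj
    ring
  have hpos : 0 ≤ C * (gapBracket z / bracket z) ^ (ρ * ((len α + len β + len γ : ℕ) : ℝ)) := by
    have := one_le_bracket z
    have := one_le_gapBracket z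
    positivity
  exact mul_le_mul_of_nonneg_right (mul_le_mul_of_nonneg_left (Real.exp_le_exp.2 h2) hpos)
    (Real.exp_pos _).le

/-- The exponents in a single term of the Leibniz rule. The `i + k = p + N` derivatives are
distributed as `i = i₁ + i₂` and `k = k₁ + k₂`. -/
theorem IsWeight.exponent_le (hω : IsWeight ω) {μ μ₁ lQ lR lD lB l2 CA CB m₁ W : ℝ}
    {i k i₁ i₂ k₁ k₂ p N : ℕ} (hρ₀ : 0 ≤ ρ) (hρ₁ : ρ ≤ 1) (hμ₁ : 0 < μ₁) (e1 : i = i₁ + i₂)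
    (e2 : k = k₁ + k₂) (e3 : i₁ + k₁ = p) (e4 : i₂ + k₂ = N) (hl2 : 0 ≤ l2) (hlQ : 0 ≤ lQ)
    (hlD : 0 ≤ lD) (hlR : 0 ≤ lR) (hQR : lQ ≤ lD + lR)
    (f4 : p * (2 * l2 + lD) + scaledConj ω μ₁ p ≤ scaledConj ω μ p + CB)
    (f5 : N * (2 * l2 + lB) + (scaledConj ω μ₁ i₂ - i₂ * lR) +
      ρ * (scaledConj ω μ₁ k₂ - k₂ * lR) ≤ CA - (μ + m₁) * W) :
    scaledConj ω (2 * μ₁) i + -(i * lR) + (l2 + lQ - lR) * (ρ * k) +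
      ρ * scaledConj ω (2 * μ₁) k + m₁ * (W + 1) ≤
    scaledConj ω μ p + N * lQ + (CB + CA + m₁) - μ * W - (N * lB + (p + N) * l2) := by
  have f1 := hω.scaledConj_le_add hμ₁ (j := (i₁ : ℝ)) (k := i₂) (by positivity) (by positivity)
  have f2 := hω.scaledConj_le_add hμ₁ (j := (k₁ : ℝ)) (k := k₂) (by positivity) (by positivity)
  have f3 := hω.scaledConj_add_le hμ₁ (j := (i₁ : ℝ)) (k := k₁) (by positivity) (by positivity)
  have f3' := hω.scaledConj_nonneg hμ₁ (k := (k₁ : ℝ)) (by positivity)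
  have c1 : (i : ℝ) = i₁ + i₂ := by exact_mod_cast e1
  have c2 : (k : ℝ) = k₁ + k₂ := by exact_mod_cast e2
  have c3 : (i₁ : ℝ) + k₁ = p := by exact_mod_cast e3
  have c4 : (i₂ : ℝ) + k₂ = N := by exact_mod_cast e4
  rw [c3] at f3
  rw [← c1] at f1
  rw [← c2] at f2
  have n1 : (0 : ℝ) ≤ i₁ := by positivity
  have n2 : (0 : ℝ) ≤ i₂ := by positivity
  have n3 : (0 : ℝ) ≤ k₁ := by positivity
  have n4 : (0 : ℝ) ≤ k₂ := by positivity
  have q3 : ρ * k₁ ≤ p := (mul_le_of_le_one_left n3 hρ₁).trans (by linarith)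
  have q4 : ρ * k₂ ≤ N := (mul_le_of_le_one_left n4 hρ₁).trans (by linarith)
  -- For the `p` derivatives that are being estimated, `Q / R ≤ 3 D` on the shell, so they cost only
  -- a geometric factor.
  have g1 : ρ * k₁ * (l2 + lQ - lR) ≤ p * (l2 + lD) :=
    (mul_le_mul_of_nonneg_left (show l2 + lQ - lR ≤ l2 + lD by linarith)
      (by positivity)).trans (mul_le_mul_of_nonneg_right q3 (by positivity))
  -- For the `N` integrations by parts `Q^N` is kept, to be cancelled later by powers of `x - y`;
  -- the gain `R^{-ρ k₂}` is used in `f5`.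
  have g2 : ρ * k₂ * (l2 + lQ) ≤ N * (l2 + lQ) := mul_le_mul_of_nonneg_right q4 (by positivity)
  have g3 : ρ * scaledConj ω (2 * μ₁) k ≤ scaledConj ω μ₁ k₁ + ρ * scaledConj ω μ₁ k₂ := by
    have h1 := mul_le_mul_of_nonneg_left f2 hρ₀
    have h2 := mul_le_of_le_one_left f3' hρ₁
    linarith
  have g4 : 0 ≤ (i₁ : ℝ) * lR := by positivity
  have g5 : (i : ℝ) * lR = i₁ * lR + i₂ * lR := by rw [c1]; ring
  have g6 : (l2 + lQ - lR) * (ρ * k) =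
      ρ * k₁ * (l2 + lQ - lR) + ρ * k₂ * (l2 + lQ) - ρ * (k₂ * lR) := by rw [c2]; ring
  have g7 : ρ * (scaledConj ω μ₁ k₂ - k₂ * lR) =
    ρ * scaledConj ω μ₁ k₂ - ρ * (k₂ * lR) := by ring
  rw [g6, g5]
  rw [g7] at f5
  linarith

/-- The derivatives of order `p + N` of the `J`-th piece of an amplitude, with `N` adapted to the
scale `2 ^ J`. -/
theorem IsAmplitude.exists_shell_bound (hω : IsWeight ω) (hh : IsCutoff ω h) (hρ₀ : 0 < ρ)
    (hρ₁ : ρ ≤ 1) (ha : IsAmplitude ω ρ m a) {B μ : ℝ} (hB : 1 ≤ B) (hμ : 0 < μ) :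
    ∃ C : ℝ, 0 ≤ C ∧ ∀ J : ℕ, ∃ N : ℕ, ∀ z, ∀ w : List (Euc d × Euc d × Euc d),
      (∀ v ∈ w, v ∈ basis₃ d) → ∀ p : ℕ, w.length = p + N →
      ‖iterDir w (fun z => shellCut h J z * a z) z‖ * B ^ N ≤
        C * gapBracket z ^ N * Real.exp (scaledConj ω μ p) * Real.exp (-μ * ω (2 ^ J)) := by
  -- The summand `1` keeps `D ≥ 1` even when `d = 0`.
  set D : ℝ := 4 * d + 1 with hD
  have hD1 : 1 ≤ D := by simp [hD]
  obtain ⟨A, hA, hdil⟩ := hω.exists_dilation (B := D) (by linarith)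
  set m₁ : ℝ := 3 * |m| * A with hm₁
  have hm₁0 : 0 ≤ m₁ := by positivity
  -- In `4 * B`, and in `4 * (3 * D)` below, each derivative pays one factor `2` for the Leibniz
  -- rule and one for `Q / ⟨z⟩ ≤ 2 Q / R`. The surplus `m₁` offsets the growth `e^{m (ω(x) + ω(y) +
  -- ω(ξ))}` on the shell.
  obtain ⟨lamA, CA, hlA, hord⟩ := hω.exists_order_decay hρ₀ hρ₁ (B := 4 * B) (μ := μ + m₁)
    (by linarith) (by positivity)
  obtain ⟨lamB, CB, hlB, hCB, hab⟩ := hω.exists_geom_absorb (B := 4 * (3 * D)) (by linarith) hμ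
  set μ₁ := max lamA lamB with hμ₁
  have hμ₁0 : 0 < μ₁ := lt_max_of_lt_left hlA
  obtain ⟨C₁, hC₁, hcut⟩ := hh.dirBound_shellCut (d := d) hω (lam := 2 * μ₁) (by positivity)
  obtain ⟨C₂, hC₂, hamp⟩ := ha.dirBound hω hρ₀ (lam := 2 * μ₁) (by positivity)
  refine ⟨C₁ * C₂ * Real.exp (CB + CA + m₁), by positivity, fun J => ?_⟩
  have hR : (1 : ℝ) ≤ 2 ^ J := one_le_pow₀ one_le_two
  obtain ⟨N, hN⟩ := hord _ hR
  refine ⟨N, fun z w hw p hp => ?_⟩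
  have hQ := one_le_gapBracket z
  by_cases hz : InShell J z
  swap
  · rw [iterDir_eq_zero ((hh.shellCut_eventually_zero hz).mono fun y hy => by simp [hy])]
    rw [norm_zero, zero_mul]
    positivity
  set R : ℝ := 2 ^ J with hRdef
  set Q := gapBracket z with hQdef
  set l2 := Real.log 2
  set lQ := Real.log Q
  set lR := Real.log R
  set lD := Real.log (3 * D)
  set lB := Real.log B
  have hl2 : 0 ≤ l2 := Real.log_nonneg one_le_two
  have hlQ : 0 ≤ lQ := Real.log_nonneg hQ
  have hlR : 0 ≤ lR := Real.log_nonneg hR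
  have hlD : 0 ≤ lD := Real.log_nonneg (by linarith)
  have hl4 : Real.log 4 = 2 * l2 := by
    rw [show (4 : ℝ) = 2 ^ 2 by norm_num, Real.log_pow]; norm_num [l2]
  have hl4B : Real.log (4 * B) = 2 * l2 + lB := by
    rw [Real.log_mul (by norm_num) (by linarith), hl4]
  have hl4D : Real.log (4 * (3 * D)) = 2 * l2 + lD := by
    rw [Real.log_mul (by norm_num) (by linarith), hl4]
  have hQR : lQ ≤ lD + lR := by
    rw [← Real.log_mul (by linarith) (by linarith)]
    exact Real.log_le_log (by linarith) hz.gapBracket_le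
  have hωR : 0 ≤ ω R := hω.nonneg _ (by linarith)
  have hweight : m * (ω ‖z.1‖ + ω ‖z.2.1‖ + ω ‖z.2.2‖) ≤ m₁ * (ω R + 1) := by
    have h1 : ∀ x : Euc d, ‖x‖ ≤ D * R → 0 ≤ ω ‖x‖ ∧ ω ‖x‖ ≤ A * (ω R + 1) := fun x hx =>
      ⟨hω.nonneg _ (norm_nonneg _), (hω.monotoneOn (norm_nonneg x)
        (mul_nonneg (by linarith) (by linarith) : (0 : ℝ) ≤ D * R) hx).trans
          (hdil R (by linarith))⟩
    obtain ⟨a1, b1⟩ := h1 z.1 hz.norm_fst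
    obtain ⟨a2, b2⟩ := h1 z.2.1 hz.norm_snd
    obtain ⟨a3, b3⟩ := h1 z.2.2 hz.norm_trd
    calc m * (ω ‖z.1‖ + ω ‖z.2.1‖ + ω ‖z.2.2‖) ≤ |m| * (ω ‖z.1‖ + ω ‖z.2.1‖ + ω ‖z.2.2‖) :=
          mul_le_mul_of_nonneg_right (le_abs_self m) (by positivity)
      _ ≤ |m| * (3 * (A * (ω R + 1))) := by gcongr; linarith
      _ = _ := by rw [hm₁]; ring
  have hmul := (hcut J z).mul (hamp z) (hh.contDiff_shellCut J).contDiffAt ha.1.contDiffAt w hw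
  refine (mul_le_mul_of_nonneg_right hmul (by positivity)).trans ?_
  have hterm : ∀ i ∈ Finset.range (w.length + 1),
      (C₁ * Real.exp (scaledConj ω (2 * μ₁) i) * (R⁻¹) ^ i) *
        (C₂ * (Q / bracket z) ^ (ρ * ((w.length - i : ℕ) : ℝ)) *
          Real.exp (ρ * scaledConj ω (2 * μ₁) ((w.length - i : ℕ) : ℝ)) *
          Real.exp (m * (ω ‖z.1‖ + ω ‖z.2.1‖ + ω ‖z.2.2‖))) ≤
      C₁ * C₂ * Real.exp (scaledConj ω μ p + N * lQ + (CB + CA + m₁) - μ * ω R -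
        (N * lB + (p + N) * l2)) := by
    intro i hi
    have hi' : i ≤ p + N := by rw [← hp]; exact Nat.lt_succ_iff.1 (Finset.mem_range.1 hi)
    obtain ⟨k, hk⟩ : ∃ k, w.length - i = k := ⟨_, rfl⟩
    have hik : i + k = p + N := by omega
    obtain ⟨i₁, i₂, k₁, k₂, e1, e2, e3, e4⟩ : ∃ i₁ i₂ k₁ k₂ : ℕ,
        i = i₁ + i₂ ∧ k = k₁ + k₂ ∧ i₁ + k₁ = p ∧ i₂ + k₂ = N :=
      ⟨i - min i N, min i N, p - (i - min i N), N - min i N, by omega, by omega, by omega, by omega⟩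
    rw [hk]
    have hrp : (Q / bracket z) ^ (ρ * (k : ℝ)) ≤ Real.exp ((l2 + lQ - lR) * (ρ * k)) := by
      have h1 : Q / bracket z ≤ 2 * Q / R := by
        rw [div_le_div_iff₀ (by linarith [one_le_bracket z]) (by linarith)]
        have := hz.le_bracket
        nlinarith
      refine (Real.rpow_le_rpow (div_nonneg (by linarith) (by linarith [one_le_bracket z])) h1
        (by positivity)).trans (le_of_eq ?_)
      rw [Real.rpow_def_of_pos (by positivity), Real.log_div (by positivity) (by positivity),
        Real.log_mul (by norm_num) (by positivity)]
    have hRi : (R⁻¹) ^ i = Real.exp (-(i * lR)) := by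
      rw [inv_pow, Real.exp_neg, ← Real.log_pow, Real.exp_log (by positivity)]
    rw [hRi]
    calc _ ≤ (C₁ * Real.exp (scaledConj ω (2 * μ₁) i) * Real.exp (-(i * lR))) *
        (C₂ * Real.exp ((l2 + lQ - lR) * (ρ * k)) *
          Real.exp (ρ * scaledConj ω (2 * μ₁) k) * Real.exp (m₁ * (ω R + 1))) := by gcongr
      _ = C₁ * C₂ * Real.exp (scaledConj ω (2 * μ₁) i + -(i * lR) + (l2 + lQ - lR) * (ρ * k) +
          ρ * scaledConj ω (2 * μ₁) k + m₁ * (ω R + 1)) := by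
        simp only [Real.exp_add]; ring
      _ ≤ _ := by
        refine mul_le_mul_of_nonneg_left (Real.exp_le_exp.2 ?_) (by positivity)
        have f4 := hab μ₁ (le_max_right _ _) p (by positivity)
        have f5 := hN μ₁ (le_max_left _ _) i₂ k₂ e4
        rw [hl4D] at f4
        rw [hl4B] at f5
        exact hω.exponent_le hρ₀.le hρ₁ hμ₁0 e1 e2 e3 e4 hl2 hlQ hlD hlR hQR f4 f5
  have hsum : ∑ i ∈ Finset.range (w.length + 1), (w.length.choose i : ℝ) *
      ((C₁ * Real.exp (scaledConj ω (2 * μ₁) i) * (R⁻¹) ^ i) *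
        (C₂ * (Q / bracket z) ^ (ρ * ((w.length - i : ℕ) : ℝ)) *
          Real.exp (ρ * scaledConj ω (2 * μ₁) ((w.length - i : ℕ) : ℝ)) *
          Real.exp (m * (ω ‖z.1‖ + ω ‖z.2.1‖ + ω ‖z.2.2‖)))) ≤
      2 ^ (p + N) * (C₁ * C₂ * Real.exp (scaledConj ω μ p + N * lQ + (CB + CA + m₁) - μ * ω R -
        (N * lB + (p + N) * l2))) := by
    refine (Finset.sum_le_sum fun i hi =>
      mul_le_mul_of_nonneg_left (hterm i hi) (by positivity)).trans (le_of_eq ?_)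
    rw [← Finset.sum_mul, ← hp]
    congr 1
    exact_mod_cast Nat.sum_range_choose _
  refine (mul_le_mul_of_nonneg_right hsum (by positivity)).trans (le_of_eq ?_)
  have e1 : (2 : ℝ) ^ (p + N) = Real.exp ((p + N) * l2) := by
    rw [← Nat.cast_add, ← Real.log_pow, Real.exp_log (by positivity)]
  have e2 : B ^ N = Real.exp (N * lB) := by
    rw [← Real.log_pow, Real.exp_log (by positivity)]
  have e3 : Q ^ N = Real.exp (N * lQ) := by
    rw [← Real.log_pow, Real.exp_log (by positivity)]
  rw [e1, e2, e3]
  have e4 : Real.exp (scaledConj ω μ p + N * lQ + (CB + CA + m₁) - μ * ω R -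
        (N * lB + (p + N) * l2)) = Real.exp (CB + CA + m₁) * Real.exp (N * lQ) *
        Real.exp (scaledConj ω μ p) * Real.exp (-μ * ω R) *
          (Real.exp ((p + N) * l2) * Real.exp (N * lB))⁻¹ := by
    rw [← Real.exp_add ((p + N) * l2), ← Real.exp_neg, ← Real.exp_add, ← Real.exp_add,
      ← Real.exp_add, ← Real.exp_add]
    congr 1
    ring
  rw [e4]
  have := Real.exp_ne_zero ((p + N) * l2)
  have := Real.exp_ne_zero (N * lB)
  field_simp

end

noncomputable section

/-! ### The pieces of the kernel -/

/-! ### Derivatives of `(-i t)^{-N}` and of `e^{i t}` -/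

section Negative

/-- Negative powers of `-i t`. -/
def negPow (N : ℕ) (t : ℝ) : ℂ := ((-(Complex.I * (t : ℂ))) ^ N)⁻¹

theorem neg_I_mul_ne_zero {t : ℝ} (ht : t ≠ 0) : -(Complex.I * (t : ℂ)) ≠ 0 := by
  simp [Complex.I_ne_zero, ht]

theorem smoothAt_negPow (N : ℕ) {t : ℝ} (ht : t ≠ 0) : SmoothAt (negPow N) t := by
  have h1 : ContDiff ℝ (⊤ : ℕ∞) fun t : ℝ => (-(Complex.I * (t : ℂ))) ^ N :=
    ((contDiff_const.mul Complex.ofRealCLM.contDiff).neg).pow N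
  exact h1.contDiffAt.inv (pow_ne_zero _ (neg_I_mul_ne_zero ht))

theorem deriv_negPow (N : ℕ) {t : ℝ} (ht : t ≠ 0) :
    deriv (negPow N) t = (N * Complex.I) * negPow (N + 1) t := by
  have h0 := neg_I_mul_ne_zero ht
  have h1 : HasDerivAt (fun t : ℝ => -(Complex.I * (t : ℂ))) (-(Complex.I * 1)) t :=
    ((Complex.ofRealCLM.hasDerivAt (x := t)).const_mul Complex.I).neg
  have h2 := ((h1.pow N).inv (pow_ne_zero _ h0)).deriv
  unfold negPow
  refine h2.trans ?_
  rcases N with _ | N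
  · simp
  · rw [Nat.add_sub_cancel]
    simp only [Pi.pow_apply]
    field_simp
    ring

/-- Each derivative raises `N` by one and brings out a factor `N`, enlarged here to `N + 1` so that
the product is `(N+1)⋯(N+k)`. -/
theorem norm_iteratedDeriv_negPow_le (N k : ℕ) {t : ℝ} (ht : t ≠ 0) :
    ‖iteratedDeriv k (negPow N) t‖ ≤ (N + 1).ascFactorial k * (|t| ^ (N + k))⁻¹ := by
  induction k generalizing N with
  | zero => simp [negPow]
  | succ k ih =>
    have h1 : deriv (negPow N) =ᶠ[𝓝 t] fun s => (N * Complex.I) * negPow (N + 1) s := by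
      filter_upwards [isOpen_ne.mem_nhds ht] with s hs using deriv_negPow N hs
    rw [iteratedDeriv_succ', h1.iteratedDeriv_eq, iteratedDeriv_const_mul_field, norm_mul]
    have h2 : ‖(N : ℂ) * Complex.I‖ = N := by simp
    rw [h2]
    have h3 := ih (N + 1)
    have h4 : (((N + 1).ascFactorial (k + 1) : ℕ) : ℝ) =
        (N + 1) * ((N + 1 + 1).ascFactorial k : ℕ) := by
      have := Nat.succ_ascFactorial (N + 1) k
      rw [Nat.ascFactorial_succ, ← this]
      push_cast
      ring
    rw [h4, show N + (k + 1) = N + 1 + k by ring]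
    calc _ ≤ (N : ℝ) * ((N + 1 + 1).ascFactorial k * (|t| ^ (N + 1 + k))⁻¹) := by gcongr
      _ ≤ (N + 1 : ℝ) * ((N + 1 + 1).ascFactorial k * (|t| ^ (N + 1 + k))⁻¹) := by
        gcongr; linarith
      _ = _ := by ring

/-- `(N+1)⋯(N+k)` is `k!` times a binomial coefficient. The dependence on `N` becomes geometric and
can be charged to `B^N`. -/
theorem ascFactorial_le (N k : ℕ) :
    (((N + 1).ascFactorial k : ℕ) : ℝ) ≤ k.factorial * 2 ^ (N + k) := by
  rw [Nat.ascFactorial_eq_factorial_mul_choose]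
  exact_mod_cast Nat.mul_le_mul_left _ (Nat.choose_le_two_pow _ _)

/-- The function `t ↦ e^{i t}`. -/
def expI (t : ℝ) : ℂ := Complex.exp (Complex.I * (t : ℂ))

theorem contDiff_expI : ContDiff ℝ (⊤ : ℕ∞) expI :=
  (contDiff_const.mul Complex.ofRealCLM.contDiff).cexp

theorem norm_expI (t : ℝ) : ‖expI t‖ = 1 := by
  rw [expI, mul_comm, Complex.norm_exp_ofReal_mul_I]

theorem hasDerivAt_expI (t : ℝ) : HasDerivAt expI (Complex.I * expI t) t := by
  have h1 : HasDerivAt (fun t : ℝ => Complex.I * (t : ℂ)) (Complex.I * 1) t :=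
    (Complex.ofRealCLM.hasDerivAt (x := t)).const_mul Complex.I
  have := h1.cexp
  rw [mul_one, mul_comm] at this
  exact this

theorem norm_iteratedDeriv_expI (k : ℕ) (t : ℝ) : ‖iteratedDeriv k expI t‖ = 1 := by
  have h1 : iteratedDeriv k expI = fun t => Complex.I ^ k * expI t := by
    induction k with
    | zero => simp
    | succ k ih =>
      ext t
      rw [iteratedDeriv_succ, ih, ((hasDerivAt_expI t).const_mul _).deriv]
      ring
  rw [h1]
  simp [norm_expI]

end Negative

/-- Superadditivity of the conjugate keeps bounds `K c^n e^{g(n)}` stable under products; the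
Leibniz rule only doubles `c`. -/
theorem dirBound_geom_mul {V : Type*} [NormedAddCommGroup V] [NormedSpace ℝ V] {B : Set V}
    {ω : ℝ → ℝ} (hω : IsWeight ω) {f g : V → ℂ} {z : V} {K K' c ν : ℝ} (hν : 0 < ν) (hK : 0 ≤ K)
    (hK' : 0 ≤ K') (hc : 0 ≤ c)
    (hf : DirBound B f z fun n => K * c ^ n * Real.exp (scaledConj ω ν n))
    (hg : DirBound B g z fun n => K' * c ^ n * Real.exp (scaledConj ω ν n))
    (sf : SmoothAt f z) (sg : SmoothAt g z) :
    DirBound B (fun y => f y * g y) z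
      fun n => K * K' * (2 * c) ^ n * Real.exp (scaledConj ω ν n) := by
  have h1 := hf.mul_of_le hg sf sg
    (M := fun n => K * K' * c ^ n * Real.exp (scaledConj ω ν n)) fun i j => by
      have h5 := hω.scaledConj_add_le hν (j := (i : ℝ)) (k := j) (by positivity) (by positivity)
      rw [← Real.exp_le_exp, Real.exp_add] at h5
      rw [Nat.cast_add, pow_add]
      calc _ = K * K' * (c ^ i * c ^ j) *
            (Real.exp (scaledConj ω ν i) * Real.exp (scaledConj ω ν j)) := by ring
        _ ≤ _ := by gcongr
  exact h1.mono fun n => le_of_eq (by rw [mul_pow]; ring)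

variable {d : ℕ} {ω : ℝ → ℝ} {h : ℝ → ℂ} {ρ m : ℝ} {a : Euc d × Euc d × Euc d → ℂ}

/-- The inclusion `(x, y) ↦ (x, y, 0)`. -/
def incl₂ (d : ℕ) : Euc d × Euc d →L[ℝ] Euc d × Euc d × Euc d :=
  (ContinuousLinearMap.fst ℝ _ _).prod ((ContinuousLinearMap.snd ℝ _ _).prod 0)

/-- The inclusion `ξ ↦ (0, 0, ξ)`. -/
def incl₃ (d : ℕ) : Euc d →L[ℝ] Euc d × Euc d × Euc d :=
  (0 : Euc d →L[ℝ] Euc d).prod ((0 : Euc d →L[ℝ] Euc d).prod (ContinuousLinearMap.id ℝ _))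

theorem incl_add (p : Euc d × Euc d) (ξ : Euc d) : incl₂ d p + incl₃ d ξ = (p.1, p.2, ξ) := by
  simp [incl₂, incl₃]

theorem incl₂_mem {v : Euc d × Euc d} (hv : v ∈ basis₂ d) : incl₂ d v ∈ basis₃ d := by
  rcases hv with ⟨j, rfl⟩ | ⟨j, rfl⟩
  · exact Or.inl ⟨j, by simp [incl₂]⟩
  · exact Or.inr (Or.inl ⟨j, by simp [incl₂]⟩)

/-- The oscillating factor `e^{i (x - y) · ξ}`. -/
def phase (z : Euc d × Euc d × Euc d) : ℂ := expI (inner ℝ (z.1 - z.2.1) z.2.2)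

theorem contDiff_phase : ContDiff ℝ (⊤ : ℕ∞) (phase (d := d)) := by
  refine contDiff_expI.comp ?_
  exact (contDiff_fst.sub (contDiff_fst.comp contDiff_snd)).inner ℝ
    (contDiff_snd.comp contDiff_snd)

/-- The `J`-th piece of the kernel. -/
def kernelPiece (h : ℝ → ℂ) (a : Euc d × Euc d × Euc d → ℂ) (J : ℕ) (p : Euc d × Euc d) : ℂ :=
  ∫ ξ : Euc d, phase (p.1, p.2, ξ) * (shellCut h J (p.1, p.2, ξ) * a (p.1, p.2, ξ))

theorem contDiff_shell_mul (hh : IsCutoff ω h) (ha : IsAmplitude ω ρ m a) (J : ℕ) :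
    ContDiff ℝ (⊤ : ℕ∞) fun z => shellCut h J z * a z := (hh.contDiff_shellCut J).mul ha.1

theorem IsCutoff.shellCut_eq_zero (hh : IsCutoff ω h) {J : ℕ} {p : Euc d × Euc d} {ξ : Euc d}
    (hξ : ξ ∉ Metric.closedBall (0 : Euc d) ((4 * d + 1) * 2 ^ J)) :
    shellCut h J =ᶠ[𝓝 (p.1, p.2, ξ)] fun _ => 0 :=
  hh.shellCut_eventually_zero fun hz => hξ (by
    rw [mem_closedBall_zero_iff]; exact hz.norm_trd)

theorem contDiff_kernelPiece (hh : IsCutoff ω h) (ha : IsAmplitude ω ρ m a) (J : ℕ) :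
    ContDiff ℝ (⊤ : ℕ∞) (kernelPiece h a J) := by
  have h1 : ContDiff ℝ (⊤ : ℕ∞) fun z : Euc d × Euc d × Euc d =>
      phase z * (shellCut h J z * a z) := contDiff_phase.mul (contDiff_shell_mul hh ha J)
  have h2 := contDiffOn_parametric (μ := (volume : Measure (Euc d))) (incl₂ d) (incl₃ d)
    isOpen_univ (isCompact_closedBall (0 : Euc d) ((4 * d + 1) * 2 ^ J))
    (fun p _ ξ => h1.contDiffAt) fun p _ ξ hξ => by
      rw [incl_add, (hh.shellCut_eq_zero hξ).eq_of_nhds]; simp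
  rw [contDiffOn_univ] at h2
  simp only [incl_add] at h2
  exact h2

/-- The coordinates of `x - y`. -/
def gapForm (l : Fin d) : Euc d × Euc d →L[ℝ] ℝ :=
  (EuclideanSpace.proj l).comp (ContinuousLinearMap.fst ℝ _ _ - ContinuousLinearMap.snd ℝ _ _)

theorem gapForm_apply (l : Fin d) (p : Euc d × Euc d) : gapForm l p = (p.1 - p.2) l := rfl

theorem abs_gapForm_le (l : Fin d) {v : Euc d × Euc d} (hv : v ∈ basis₂ d) :
    |gapForm l v| ≤ 1 := by
  rw [gapForm_apply]
  rcases hv with ⟨j, rfl⟩ | ⟨j, rfl⟩ <;> simp [abs_stdVec_le]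

/-- The linear form `(x, y) ↦ (x - y) · ξ`. -/
def phaseForm (ξ : Euc d) : Euc d × Euc d →L[ℝ] ℝ :=
  (innerSL ℝ ξ).comp (ContinuousLinearMap.fst ℝ _ _ - ContinuousLinearMap.snd ℝ _ _)

theorem phase_eq (p : Euc d × Euc d) (ξ : Euc d) :
    phase (p.1, p.2, ξ) = expI (phaseForm ξ p) := by
  rw [phase, real_inner_comm]; rfl

theorem norm_stdVec (j : Fin d) : ‖(stdVec j : Euc d)‖ = 1 := by simp [stdVec]

theorem abs_phaseForm_le (ξ : Euc d) {v : Euc d × Euc d} (hv : v ∈ basis₂ d) :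
    |phaseForm ξ v| ≤ ‖ξ‖ := by
  have h1 : ‖v.1 - v.2‖ = 1 := by
    rcases hv with ⟨j, rfl⟩ | ⟨j, rfl⟩ <;> simp [norm_stdVec]
  have := abs_real_inner_le_norm ξ (v.1 - v.2)
  rw [h1, mul_one] at this
  exact this

theorem dirDeriv_phase (p : Euc d × Euc d) (l : Fin d) (ξ : Euc d) :
    dirDeriv (stdVec l) (fun ξ => phase (p.1, p.2, ξ)) ξ =
      (Complex.I * (gapForm l p : ℂ)) * phase (p.1, p.2, ξ) := by
  have h1 := dirDeriv_comp_affine (innerSL ℝ (p.1 - p.2)) 0 (f := expI) (p := ξ)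
    contDiff_expI.contDiffAt (stdVec l)
  simp only [add_zero] at h1
  have h2 := h1.eq_of_nhds
  refine h2.trans ?_
  have h3 : innerSL ℝ (p.1 - p.2) (stdVec l) = gapForm l p := by
    rw [gapForm_apply, innerSL_apply_apply, stdVec, EuclideanSpace.inner_single_right]
    simp
  rw [h3, dirDeriv, fderiv_eq_smul_deriv, (hasDerivAt_expI _).deriv]
  simp only [phase, innerSL_apply_apply, Complex.real_smul]
  ring

/-- The kernel piece after `N` integrations by parts in `ξ_l`. -/
theorem kernelPiece_eq (hh : IsCutoff ω h) (ha : IsAmplitude ω ρ m a) (J N : ℕ) (l : Fin d)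
    {p : Euc d × Euc d} (hp : gapForm l p ≠ 0) :
    kernelPiece h a J p = ∫ ξ : Euc d, phase (p.1, p.2, ξ) * (negPow N (gapForm l p) *
      iterDir (List.replicate N (incl₃ d (stdVec l))) (fun z => shellCut h J z * a z)
        (p.1, p.2, ξ)) := by
  have hb := contDiff_shell_mul hh ha J
  have hline : ContDiff ℝ (⊤ : ℕ∞) fun ξ : Euc d => incl₃ d ξ + incl₂ d p :=
    (incl₃ d).contDiff.add contDiff_const
  have hz : ∀ ξ, incl₃ d ξ + incl₂ d p = (p.1, p.2, ξ) := fun ξ => by rw [add_comm, incl_add]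
  have h1 := integral_mul_eq_iterDir (μ := (volume : Measure (Euc d)))
    (e := fun ξ => phase (p.1, p.2, ξ))
    (b := fun ξ => (fun z => shellCut h J z * a z) (incl₃ d ξ + incl₂ d p))
    (v := stdVec l) (c := Complex.I * (gapForm l p : ℂ))
    (by
      have := contDiff_phase.comp hline
      simpa only [Function.comp_def, hz] using this)
    (fun ξ => dirDeriv_phase p l ξ) (hb.comp hline)
    (HasCompactSupport.intro (isCompact_closedBall (0 : Euc d) ((4 * d + 1) * 2 ^ J))
      fun ξ hξ => by
        simp only [hz]
        rw [(hh.shellCut_eq_zero hξ).eq_of_nhds, zero_mul]) N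
  have h2 : ∀ ξ, iterDir (List.replicate N (stdVec l))
      (fun ξ => (fun z => shellCut h J z * a z) (incl₃ d ξ + incl₂ d p)) ξ =
      iterDir (List.replicate N (incl₃ d (stdVec l))) (fun z => shellCut h J z * a z)
        (p.1, p.2, ξ) := fun ξ => by
    rw [iterDir_comp_affine (incl₃ d) (incl₂ d p) (f := fun z => shellCut h J z * a z)
      hb.contDiffAt, List.map_replicate, hz]
  simp only [h2] at h1
  have h3 : (-(Complex.I * (gapForm l p : ℂ))) ^ N ≠ 0 :=
    pow_ne_zero _ (neg_I_mul_ne_zero hp)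
  have h4 : ∀ ξ : Euc d, phase (p.1, p.2, ξ) * (negPow N (gapForm l p) *
      iterDir (List.replicate N (incl₃ d (stdVec l))) (fun z => shellCut h J z * a z)
        (p.1, p.2, ξ)) = negPow N (gapForm l p) * (phase (p.1, p.2, ξ) *
      iterDir (List.replicate N (incl₃ d (stdVec l))) (fun z => shellCut h J z * a z)
        (p.1, p.2, ξ)) := fun ξ => by ring
  simp only [h4]
  rw [integral_const_mul, ← h1, negPow, inv_mul_cancel_left₀ h3]
  simp only [kernelPiece, hz]

/-- Otherwise `norm_le_of_coord_le` would give `‖x‖ ≤ d / (d + 1) * ‖x‖`. -/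
theorem exists_le_abs_coord {x : Euc d} (hx : 0 < ‖x‖) : ∃ l, ‖x‖ ≤ (d + 1) * |x l| := by
  by_contra hcon
  push Not at hcon
  have h1 := norm_le_of_coord_le (x := x) (c := ‖x‖ / (d + 1)) (by positivity) fun j => by
    rw [le_div_iff₀ (by positivity), mul_comm]; exact (hcon j).le
  have h2 : (d : ℝ) * (‖x‖ / (d + 1)) < ‖x‖ := by
    rw [← mul_div_assoc, div_lt_iff₀ (by positivity)]
    nlinarith
  linarith

end

/-! ### Decay of the kernel pieces away from the diagonal -/

noncomputable section

variable {d : ℕ} {ω : ℝ → ℝ} {h : ℝ → ℂ} {ρ m : ℝ} {a : Euc d × Euc d × Euc d → ℂ}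

theorem IsWeight.exists_factorial_le_exp (hω : IsWeight ω) {lam : ℝ} (hl : 0 < lam) :
    ∃ C : ℝ, 0 ≤ C ∧ ∀ k : ℕ, (k.factorial : ℝ) ≤ C * Real.exp (scaledConj ω lam k) := by
  obtain ⟨C, hC, h⟩ := hω.exists_factorial_le hl
  refine ⟨Real.exp C, (Real.exp_pos _).le, fun k => ?_⟩
  rw [← Real.exp_add, ← Real.log_le_iff_le_exp (by positivity), add_comm]
  exact h k

/-- Young's inequality. Derivatives of the phase produce powers `|ξ|^n` with `|ξ| = O(R)`; this
trades them for a conjugate and a factor `e^{λ ω(R)}`. -/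
theorem IsWeight.pow_le_exp (hω : IsWeight ω) {lam R : ℝ} (hl : 0 < lam) (hR : 1 ≤ R) (n : ℕ) :
    R ^ n ≤ Real.exp (lam * ω R) * Real.exp (scaledConj ω lam n) := by
  rw [← Real.exp_add, ← Real.log_le_iff_le_exp (by positivity), Real.log_pow]
  have := hω.le_scaledConj hl (k := (n : ℝ)) (by positivity) hR
  linarith

theorem IsWeight.exists_geom_absorb_exp (hω : IsWeight ω) {B : ℝ} (hB : 1 ≤ B) {lam : ℝ}
    (hl : 0 < lam) : ∃ lam' C : ℝ, 0 < lam' ∧ 0 ≤ C ∧ ∀ k : ℕ,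
      B ^ k * Real.exp (scaledConj ω lam' k) ≤ C * Real.exp (scaledConj ω lam k) := by
  obtain ⟨lam', C, hl', -, h⟩ := hω.exists_geom_absorb hB hl
  refine ⟨lam', Real.exp C, hl', (Real.exp_pos _).le, fun k => ?_⟩
  have h1 := h lam' le_rfl k (by positivity)
  rwa [← Real.exp_le_exp, Real.exp_add, Real.exp_add, ← Real.log_pow,
    Real.exp_log (by positivity), mul_comm (Real.exp (scaledConj ω lam k))] at h1

theorem gapBracket_le_of_gap {r : ℝ} (hr : 0 < r) {z : Euc d × Euc d × Euc d}
    (hz : r ≤ ‖z.1 - z.2.1‖) : gapBracket z ≤ (1 / r + 1) * ‖z.1 - z.2.1‖ := by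
  have h0 := norm_nonneg (z.1 - z.2.1)
  have h1 : 1 ≤ 1 / r * ‖z.1 - z.2.1‖ := by rw [one_div, le_inv_mul_iff₀ hr]; linarith
  refine Real.sqrt_le_iff.2 ⟨by positivity, ?_⟩
  nlinarith

/-- The bound for the derivatives of the integrand, after `N` integrations by parts. -/
theorem exists_integrand_bound (hω : IsWeight ω) (hh : IsCutoff ω h) (hρ₀ : 0 < ρ)
    (hρ₁ : ρ ≤ 1) (ha : IsAmplitude ω ρ m a) {r μ : ℝ} (hr : 0 < r) (hμ : 0 < μ) :
    ∃ C : ℝ, 0 ≤ C ∧ ∀ J : ℕ, ∃ N : ℕ, ∀ (p : Euc d × Euc d) (l : Fin d), r ≤ ‖p.1 - p.2‖ →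
      ‖p.1 - p.2‖ ≤ (d + 1) * |gapForm l p| → ∀ ξ : Euc d,
      DirBound (basis₂ d) (fun p => phase (p.1, p.2, ξ) * (negPow N (gapForm l p) *
        iterDir (List.replicate N (incl₃ d (stdVec l))) (fun z => shellCut h J z * a z)
          (p.1, p.2, ξ))) p
        fun n => C * Real.exp (-μ * ω (2 ^ J)) * Real.exp (scaledConj ω μ n) := by
  set D : ℝ := 4 * d + 1 with hD
  have hD1 : 1 ≤ D := by simp [hD]
  set r₁ : ℝ := r / (d + 1) with hr₁
  have hr₁0 : 0 < r₁ := by positivity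
  -- A common base for `D^n` from the phase and `(2 / |(x - y)_l|)^n` from the negative power. Two
  -- products double it twice, hence `2 * (2 * c)`.
  set c : ℝ := max D (2 / r₁) with hc
  have hc1 : 1 ≤ c := hD1.trans (le_max_left _ _)
  obtain ⟨ν, Cab, hν, hCab, hab⟩ := hω.exists_geom_absorb_exp (B := 2 * (2 * c)) (by linarith) hμ
  obtain ⟨Cf, hCf, hfac⟩ := hω.exists_factorial_le_exp hν
  -- The `2` comes from `ascFactorial_le`, the rest from `⟨x - y⟩ ≤ (1/r + 1)(d + 1) |(x - y)_l|`;
  -- `B^{-N}` then cancels every factor of order `N`.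
  set B : ℝ := 2 * ((1 / r + 1) * (d + 1)) with hB
  have hB1 : 1 ≤ B := by
    have h1 : 0 < 1 / r := by positivity
    have h2 : (0 : ℝ) ≤ d := by positivity
    nlinarith
  -- The surplus `ν` compensates the factor `e^{ν ω(R)}` of the phase.
  obtain ⟨C₃, hC₃, hshell⟩ := ha.exists_shell_bound hω hh hρ₀ hρ₁ hB1 (μ := μ + ν) (by positivity)
  refine ⟨Cf * C₃ * Cab, by positivity, fun J => ?_⟩
  obtain ⟨N, hN⟩ := hshell J
  refine ⟨N, fun p l hp hl ξ => ?_⟩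
  set R : ℝ := 2 ^ J with hR
  have hR1 : 1 ≤ R := one_le_pow₀ one_le_two
  set b := fun z => shellCut h J z * a z with hb
  have hbs : ContDiff ℝ (⊤ : ℕ∞) b := contDiff_shell_mul hh ha J
  set g := iterDir (List.replicate N (incl₃ d (stdVec l))) b with hg
  have ht : r₁ ≤ |gapForm l p| := by
    rw [hr₁, div_le_iff₀ (by positivity)]; linarith
  have ht0 : gapForm l p ≠ 0 := abs_pos.1 (hr₁0.trans_le ht)
  have hsg : SmoothAt (fun q => g (incl₂ d q + incl₃ d ξ)) p :=
    ContDiffAt.comp p (SmoothAt.iterDir hbs.contDiffAt _)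
      ((incl₂ d).contDiff.add contDiff_const).contDiffAt
  by_cases hz : InShell J (p.1, p.2, ξ)
  swap
  · intro w hw
    have h1 : g =ᶠ[𝓝 (p.1, p.2, ξ)] fun _ => 0 := by
      have h2 : b =ᶠ[𝓝 (p.1, p.2, ξ)] fun _ => 0 :=
        (hh.shellCut_eventually_zero hz).mono fun y hy => by simp [hb, hy]
      refine (h2.eventually_nhds).mono fun y hy => iterDir_eq_zero hy _
    have h3 : Tendsto (fun q : Euc d × Euc d => (q.1, q.2, ξ)) (𝓝 p) (𝓝 (p.1, p.2, ξ)) :=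
      Continuous.tendsto (by fun_prop) p
    rw [iterDir_eq_zero ((h3.eventually h1).mono fun q hq => by simp [hq]), norm_zero]
    positivity
  have h1 : DirBound (basis₂ d) (fun q => expI (phaseForm ξ q)) p
      fun n => Real.exp (ν * ω R) * c ^ n * Real.exp (scaledConj ω ν n) := by
    refine (dirBound_comp_linear (phaseForm ξ) (f := expI) (c := ‖ξ‖) contDiff_expI.contDiffAt
      (fun v hv => abs_phaseForm_le ξ hv) (A := fun _ => 1)
      fun n => (norm_iteratedDeriv_expI n _).le).mono fun n => ?_
    rw [mul_one]
    calc ‖ξ‖ ^ n ≤ (D * R) ^ n := pow_le_pow_left₀ (norm_nonneg _) hz.norm_trd n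
      _ = D ^ n * R ^ n := mul_pow _ _ _
      _ ≤ c ^ n * (Real.exp (ν * ω R) * Real.exp (scaledConj ω ν n)) := by
        gcongr
        · exact le_max_left _ _
        · exact hω.pow_le_exp hν hR1 n
      _ = _ := by ring
  have h2 : DirBound (basis₂ d) (fun q => negPow N (gapForm l q)) p
      fun n => (Cf * 2 ^ N * (|gapForm l p| ^ N)⁻¹) * c ^ n * Real.exp (scaledConj ω ν n) := by
    refine (dirBound_comp_linear (gapForm l) (f := negPow N) (c := 1) (smoothAt_negPow N ht0)
      (fun v hv => abs_gapForm_le l hv) (fun n => norm_iteratedDeriv_negPow_le N n ht0)).mono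
        fun n => ?_
    rw [one_pow, one_mul]
    have h3 : (2 * |gapForm l p|⁻¹) ^ n ≤ c ^ n := by
      refine pow_le_pow_left₀ (by positivity) ?_ n
      refine le_trans ?_ (le_max_right _ _)
      rw [div_eq_mul_inv]
      gcongr
    calc ((N + 1).ascFactorial n : ℝ) * (|gapForm l p| ^ (N + n))⁻¹
        ≤ (n.factorial * 2 ^ (N + n)) * (|gapForm l p| ^ (N + n))⁻¹ := by
          gcongr; exact ascFactorial_le N n
      _ = n.factorial * (2 ^ N * (|gapForm l p| ^ N)⁻¹ * (2 * |gapForm l p|⁻¹) ^ n) := by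
          rw [pow_add, pow_add, mul_inv, mul_pow, inv_pow]; ring
      _ ≤ (Cf * Real.exp (scaledConj ω ν n)) *
          (2 ^ N * (|gapForm l p| ^ N)⁻¹ * c ^ n) := by
          gcongr; exact hfac n
      _ = _ := by ring
  have h3 : DirBound (basis₂ d) (fun q => g (incl₂ d q + incl₃ d ξ)) p
      fun n => (C₃ * gapBracket (p.1, p.2, ξ) ^ N * (B ^ N)⁻¹ * Real.exp (-(μ + ν) * ω R)) *
        c ^ n * Real.exp (scaledConj ω ν n) := by
    intro w hw
    rw [iterDir_comp_affine (incl₂ d) (incl₃ d ξ) (SmoothAt.iterDir hbs.contDiffAt _),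
      ← iterDir_append, incl_add]
    have h4 := hN (p.1, p.2, ξ) (List.replicate N (incl₃ d (stdVec l)) ++ w.map (incl₂ d))
      (fun v hv => by
        rcases List.mem_append.1 hv with hv | hv
        · rw [List.eq_of_mem_replicate hv]
          exact Or.inr (Or.inr ⟨l, by simp [incl₃]⟩)
        · obtain ⟨u, hu, rfl⟩ := List.mem_map.1 hv
          exact incl₂_mem (hw u hu)) w.length (by simp [add_comm])
    rw [← le_div_iff₀ (by positivity), div_eq_mul_inv] at h4
    refine h4.trans ?_
    beta_reduce
    have h5 : Real.exp (scaledConj ω (μ + ν) w.length) ≤ Real.exp (scaledConj ω ν w.length) :=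
      Real.exp_le_exp.2 (hω.scaledConj_anti hν (by linarith) (by positivity))
    have h6 : (1 : ℝ) ≤ c ^ w.length := one_le_pow₀ hc1
    have hQ := one_le_gapBracket (p.1, p.2, ξ)
    calc _ = (C₃ * gapBracket (p.1, p.2, ξ) ^ N * (B ^ N)⁻¹ * Real.exp (-(μ + ν) * ω R)) *
          1 * Real.exp (scaledConj ω (μ + ν) w.length) := by ring
      _ ≤ _ := by gcongr
  have s2 : SmoothAt (fun q => negPow N (gapForm l q)) p :=
    ContDiffAt.comp (g := negPow N) p (smoothAt_negPow N ht0) (gapForm l).contDiff.contDiffAt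
  have s1 : SmoothAt (fun q => expI (phaseForm ξ q)) p :=
    (contDiff_expI.comp (phaseForm ξ).contDiff).contDiffAt
  have hQ := one_le_gapBracket (p.1, p.2, ξ)
  have h23 := dirBound_geom_mul hω hν (by positivity) (by positivity) (by positivity) h2 h3 s2 hsg
  have h1' : DirBound (basis₂ d) (fun q => expI (phaseForm ξ q)) p
      fun n => Real.exp (ν * ω R) * (2 * c) ^ n * Real.exp (scaledConj ω ν n) :=
    h1.mono fun n => by
      gcongr
      linarith
  have h123 := dirBound_geom_mul hω hν (by positivity) (by positivity) (by positivity) h1' h23 s1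
    (s2.mul hsg)
  simp only [incl_add] at h123
  simp only [phase_eq]
  refine h123.mono fun n => ?_
  have e1 : Real.exp (ν * ω R) * Real.exp (-(μ + ν) * ω R) = Real.exp (-μ * ω R) := by
    rw [← Real.exp_add]; congr 1; ring
  have e2 : 2 ^ N * (|gapForm l p| ^ N)⁻¹ * (gapBracket (p.1, p.2, ξ) ^ N * (B ^ N)⁻¹) ≤ 1 := by
    rw [← inv_pow, ← inv_pow, ← mul_pow, ← mul_pow, ← mul_pow]
    refine pow_le_one₀ (by positivity) ?_
    have h6 := gapBracket_le_of_gap hr (z := (p.1, p.2, ξ)) hp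
    have h7 : gapBracket (p.1, p.2, ξ) ≤ (1 / r + 1) * ((d + 1) * |gapForm l p|) :=
      h6.trans (by gcongr)
    have ht1 : 0 < |gapForm l p| := hr₁0.trans_le ht
    have hB0 : 0 < B := by linarith
    rw [show 2 * |gapForm l p|⁻¹ * (gapBracket (p.1, p.2, ξ) * B⁻¹) =
      (2 * gapBracket (p.1, p.2, ξ)) / (|gapForm l p| * B) by field_simp,
      div_le_one (by positivity), hB]
    nlinarith
  have h8 := hab n
  calc _ = (Real.exp (ν * ω R) * Real.exp (-(μ + ν) * ω R)) * (Cf * C₃) *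
        (2 ^ N * (|gapForm l p| ^ N)⁻¹ * (gapBracket (p.1, p.2, ξ) ^ N * (B ^ N)⁻¹)) *
        ((2 * (2 * c)) ^ n * Real.exp (scaledConj ω ν n)) := by ring
    _ ≤ Real.exp (-μ * ω R) * (Cf * C₃) * 1 * (Cab * Real.exp (scaledConj ω μ n)) := by
        rw [e1]; gcongr
    _ = _ := by ring

/-- The pieces of the kernel decay rapidly off the diagonal. -/
theorem exists_kernelPiece_bound (hω : IsWeight ω) (hh : IsCutoff ω h) (hρ₀ : 0 < ρ)
    (hρ₁ : ρ ≤ 1) (ha : IsAmplitude ω ρ m a) {r μ : ℝ} (hr : 0 < r) (hμ : 0 < μ) :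
    ∃ C : ℝ, 0 ≤ C ∧ ∀ (J : ℕ) (p : Euc d × Euc d), r ≤ ‖p.1 - p.2‖ →
      DirBound (basis₂ d) (kernelPiece h a J) p
        fun n => C * Real.exp (-μ * ω (2 ^ J)) * Real.exp (scaledConj ω μ n) := by
  -- The surplus `1` pays for the volume of the `ξ`-ball, which is `O(R^d) = O(e^{ω(R)})`.
  obtain ⟨C, hC, hb⟩ := exists_integrand_bound hω hh hρ₀ hρ₁ ha hr (μ := μ + 1) (by positivity)
  obtain ⟨C', hC', hlog⟩ := hω.exists_log_le (ε := 1 / (d + 1)) (by positivity)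
  set D : ℝ := 4 * d + 1 with hD
  set v₁ := (volume (Metric.closedBall (0 : Euc d) 1)).toReal with hv₁
  have hv₁0 : 0 ≤ v₁ := ENNReal.toReal_nonneg
  have hD0 : 0 < D := by positivity
  refine ⟨C * (D ^ d * v₁ * Real.exp (d * C')), by positivity, fun J p hp w hw => ?_⟩
  obtain ⟨N, hN⟩ := hb J
  set R : ℝ := 2 ^ J with hR
  have hR1 : 1 ≤ R := one_le_pow₀ one_le_two
  obtain ⟨l, hl⟩ := exists_le_abs_coord (hr.trans_le hp)
  rw [← gapForm_apply] at hl
  have ht0 : gapForm l p ≠ 0 := by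
    intro h0
    rw [h0, abs_zero, mul_zero] at hl
    linarith
  set b := fun z => shellCut h J z * a z with hbdef
  have hbs : ContDiff ℝ (⊤ : ℕ∞) b := contDiff_shell_mul hh ha J
  set G : Euc d × Euc d × Euc d → ℂ := fun z => phase z * (negPow N (gapForm l (z.1, z.2.1)) *
    iterDir (List.replicate N (incl₃ d (stdVec l))) b z) with hG
  -- Differentiation needs the integrated formula near `p` with `l` and `N` fixed; it holds on this
  -- open set.
  set U : Set (Euc d × Euc d) := {q | gapForm l q ≠ 0} with hU
  have hUo : IsOpen U := isOpen_ne.preimage (gapForm l).continuous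
  have hGs : ∀ q ∈ U, ∀ ξ, SmoothAt G (incl₂ d q + incl₃ d ξ) := fun q hq ξ => by
    rw [incl_add]
    refine contDiff_phase.contDiffAt.mul (ContDiffAt.mul ?_ (SmoothAt.iterDir hbs.contDiffAt _))
    refine ContDiffAt.comp (q.1, q.2, ξ) (g := negPow N)
      (f := fun z : Euc d × Euc d × Euc d => gapForm l (z.1, z.2.1)) (smoothAt_negPow N hq) ?_
    exact ((gapForm l).contDiff.comp
      (contDiff_fst.prodMk (contDiff_fst.comp contDiff_snd))).contDiffAt
  set k := Metric.closedBall (0 : Euc d) (D * R) with hk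
  have hG0 : ∀ q ∈ U, ∀ ξ, ξ ∉ k → G (incl₂ d q + incl₃ d ξ) = 0 := fun q _ ξ hξ => by
    rw [incl_add, hG]
    have h1 : b =ᶠ[𝓝 (q.1, q.2, ξ)] fun _ => 0 :=
      (hh.shellCut_eq_zero hξ).mono fun y hy => by simp [hbdef, hy]
    simp only [iterDir_eq_zero h1, mul_zero]
  have hcongr : kernelPiece h a J =ᶠ[𝓝 p] fun q => ∫ ξ, G (incl₂ d q + incl₃ d ξ) := by
    filter_upwards [hUo.mem_nhds ht0] with q hq
    rw [kernelPiece_eq hh ha J N l hq]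
    simp only [incl_add, hG, hbdef]
  rw [(iterDir_congr hcongr w).eq_of_nhds,
    (iterDir_parametric (incl₂ d) (incl₃ d) hUo (isCompact_closedBall 0 (D * R)) hGs hG0 w ht0).1]
  have hpt : ∀ ξ, iterDir (w.map (incl₂ d)) G (incl₂ d p + incl₃ d ξ) =
      iterDir w (fun q => G (incl₂ d q + incl₃ d ξ)) p := fun ξ =>
    (iterDir_comp_affine (incl₂ d) (incl₃ d ξ) (hGs p ht0 ξ) w).symm
  simp only [hpt]
  have hzero : ∀ ξ, ξ ∉ k → iterDir w (fun q => G (incl₂ d q + incl₃ d ξ)) p = 0 := fun ξ hξ =>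
    iterDir_eq_zero (by filter_upwards [hUo.mem_nhds ht0] with q hq using hG0 q hq ξ hξ) w
  rw [← setIntegral_eq_integral_of_forall_compl_eq_zero hzero]
  refine (norm_setIntegral_le_of_norm_le_const (measure_closedBall_lt_top) fun ξ _ => ?_).trans
    (b := (C * Real.exp (-(μ + 1) * ω R) * Real.exp (scaledConj ω (μ + 1) w.length)) *
      volume.real k) ?_
  · have h1 := hN p l hp hl ξ w hw
    simpa only [incl_add, hG] using h1
  have hvol : volume.real k = (D * R) ^ d * v₁ := by
    rw [measureReal_def, hk, Measure.addHaar_closedBall' _ _ (by positivity),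
      ENNReal.toReal_mul, ENNReal.toReal_ofReal (by positivity), finrank_euclideanSpace_fin]
  have hRd : R ^ d ≤ Real.exp (d * C') * Real.exp (ω R) := by
    rw [← Real.exp_add, ← Real.log_le_iff_le_exp (by positivity), Real.log_pow]
    have h1 := mul_le_mul_of_nonneg_left (hlog R hR1) (show (0 : ℝ) ≤ d by positivity)
    have h2 : (d : ℝ) * (1 / (d + 1) * ω R) ≤ ω R := by
      rw [← mul_assoc, mul_one_div]
      refine mul_le_of_le_one_left (hω.nonneg _ (by linarith)) ?_
      rw [div_le_one (by positivity)]
      linarith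
    linarith
  have e1 : Real.exp (-μ * ω R) = Real.exp (-(μ + 1) * ω R) * Real.exp (ω R) := by
    rw [← Real.exp_add]; congr 1; ring
  have h5 : Real.exp (scaledConj ω (μ + 1) w.length) ≤ Real.exp (scaledConj ω μ w.length) :=
    Real.exp_le_exp.2 (hω.scaledConj_anti hμ (by linarith) (by positivity))
  rw [hvol, e1, mul_pow]
  calc _ ≤ (C * Real.exp (-(μ + 1) * ω R) * Real.exp (scaledConj ω μ w.length)) *
        (D ^ d * (Real.exp (d * C') * Real.exp (ω R)) * v₁) := by gcongr
    _ = _ := by ring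

end

noncomputable section

/-! ### The kernel off the diagonal -/

variable {d : ℕ} {ω : ℝ → ℝ} {h : ℝ → ℂ} {ρ m : ℝ} {a : Euc d × Euc d × Euc d → ℂ}

theorem kernelPiece_eventually_zero (hh : IsCutoff ω h) {J : ℕ} {p : Euc d × Euc d}
    (hp : ¬ (‖p.1‖ ≤ (4 * d + 1) * 2 ^ J ∧ ‖p.2‖ ≤ (4 * d + 1) * 2 ^ J)) :
    kernelPiece h a J =ᶠ[𝓝 p] fun _ => 0 := by
  have hop : ∀ᶠ q : Euc d × Euc d in 𝓝 p,
      ¬ (‖q.1‖ ≤ (4 * d + 1) * 2 ^ J ∧ ‖q.2‖ ≤ (4 * d + 1) * 2 ^ J) := by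
    rw [not_and_or, not_le, not_le] at hp
    rcases hp with hp | hp
    · filter_upwards [continuous_fst.norm.continuousAt.eventually (lt_mem_nhds hp)] with q hq hq'
      exact absurd hq'.1 (not_le.2 hq)
    · filter_upwards [continuous_snd.norm.continuousAt.eventually (lt_mem_nhds hp)] with q hq hq'
      exact absurd hq'.2 (not_le.2 hq)
  filter_upwards [hop] with q hq
  have hz : ∀ ξ, shellCut h J (q.1, q.2, ξ) = 0 := fun ξ => by
    have h1 : ¬ InShell J (q.1, q.2, ξ) := fun hs => hq ⟨hs.norm_fst, hs.norm_snd⟩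
    exact (hh.shellCut_eventually_zero h1).eq_of_nhds
  simp only [kernelPiece, hz, zero_mul, mul_zero, integral_zero]

/-- The piece vanishes near `p` unless both `x` and `y` are at most `D 2^J` in norm, and there decay
in `ω(2^J)` is decay in `ω(x)` and `ω(y)`. -/
theorem exists_weighted_bound (hω : IsWeight ω) (hh : IsCutoff ω h) (hρ₀ : 0 < ρ)
    (hρ₁ : ρ ≤ 1) (ha : IsAmplitude ω ρ m a) {r lam : ℝ} (hr : 0 < r) (hl : 0 < lam) :
    ∃ C : ℝ, 0 ≤ C ∧ ∀ (J : ℕ) (p : Euc d × Euc d), r ≤ ‖p.1 - p.2‖ →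
      DirBound (basis₂ d) (kernelPiece h a J) p
        fun n => C * Real.exp (scaledConj ω lam n) * Real.exp (-lam * ω ‖p.1‖) *
          Real.exp (-lam * ω ‖p.2‖) * (1 / 2) ^ J := by
  set D : ℝ := 4 * d + 1 with hD
  have hD0 : 0 < D := by positivity
  obtain ⟨A, hA, hdil⟩ := hω.exists_dilation (B := D) hD0.le
  -- The part `2 lam A` buys the two weights, and `1` buys the summable factor `2^{-J}` through `log
  -- R ≤ ω(R) + C'`.
  obtain ⟨μ, hμ⟩ : ∃ μ, μ = lam + 2 * lam * A + 1 := ⟨_, rfl⟩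
  obtain ⟨C, hC, hb⟩ := exists_kernelPiece_bound hω hh hρ₀ hρ₁ ha hr
    (μ := μ) (by rw [hμ]; positivity)
  obtain ⟨C', hC', hlog⟩ := hω.exists_log_le one_pos
  refine ⟨C * Real.exp (2 * lam * A + C'), by positivity, fun J p hp w hw => ?_⟩
  by_cases hJ : ‖p.1‖ ≤ D * 2 ^ J ∧ ‖p.2‖ ≤ D * 2 ^ J
  swap
  · rw [iterDir_eq_zero (kernelPiece_eventually_zero hh hJ), norm_zero]
    positivity
  refine (hb J p hp w hw).trans ?_
  set R : ℝ := 2 ^ J with hR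
  have hR1 : 1 ≤ R := one_le_pow₀ one_le_two
  have hωR := hω.nonneg R (by linarith)
  have h1 : ∀ x : Euc d, ‖x‖ ≤ D * R → ω ‖x‖ ≤ A * (ω R + 1) := fun x hx =>
    (hω.monotoneOn (norm_nonneg x) (by positivity : (0 : ℝ) ≤ D * R) hx).trans
      (hdil R (by linarith))
  have h2 := mul_le_mul_of_nonneg_left (h1 p.1 hJ.1) hl.le
  have h3 := mul_le_mul_of_nonneg_left (h1 p.2 hJ.2) hl.le
  have h4 : ((1 : ℝ) / 2) ^ J = Real.exp (-Real.log R) := by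
    rw [Real.exp_neg, Real.exp_log (by linarith), hR, one_div, inv_pow]
  have h5 := hlog R hR1
  have h6 := hω.scaledConj_anti hl (lam' := μ)
    (by nlinarith) (k := (w.length : ℝ)) (by positivity)
  rw [h4]
  simp only [mul_assoc, ← Real.exp_add]
  refine mul_le_mul_of_nonneg_left (Real.exp_le_exp.2 ?_) hC
  have h7 := mul_nonneg hl.le hωR
  have e : lam * (A * (ω R + 1)) = lam * A * ω R + lam * A := by ring
  have e' : μ * ω R = lam * ω R + 2 * (lam * A * ω R) + ω R := by rw [hμ]; ring
  linarith

/-- The kernel, as a series. -/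
def kernelSum (h : ℝ → ℂ) (a : Euc d × Euc d × Euc d → ℂ) (p : Euc d × Euc d) : ℂ :=
  ∑' J, kernelPiece h a J p

theorem span_basis₂ : Submodule.span ℝ (basis₂ d) = ⊤ := by
  rw [eq_top_iff]
  rintro ⟨x, y⟩ -
  have hx : ∀ x : Euc d, x = ∑ j, x j • (stdVec j : Euc d) := fun x => by
    ext i
    simp [stdVec, Pi.single_apply]
  have e : ((x, y) : Euc d × Euc d) = ∑ j, x j • ((stdVec j, 0) : Euc d × Euc d) +
      ∑ j, y j • ((0, stdVec j) : Euc d × Euc d) := by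
    refine Prod.ext ?_ ?_
    · simp only [Prod.fst_add, Prod.fst_sum, Prod.smul_fst, smul_zero, Finset.sum_const_zero,
        add_zero]
      exact hx x
    · simp only [Prod.snd_add, Prod.snd_sum, Prod.smul_snd, smul_zero, Finset.sum_const_zero,
        zero_add]
      exact hx y
  rw [e]
  exact add_mem (sum_mem fun j _ => Submodule.smul_mem _ _
    (Submodule.subset_span (Or.inl ⟨j, rfl⟩))) (sum_mem fun j _ => Submodule.smul_mem _ _
    (Submodule.subset_span (Or.inr ⟨j, rfl⟩)))

theorem isOpen_gap_gt (r : ℝ) : IsOpen {p : Euc d × Euc d | r < ‖p.1 - p.2‖} :=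
  isOpen_lt continuous_const (by fun_prop)

theorem kernelPiece_summable_bound (hω : IsWeight ω) (hh : IsCutoff ω h) (hρ₀ : 0 < ρ)
    (hρ₁ : ρ ≤ 1) (ha : IsAmplitude ω ρ m a) {r : ℝ} (hr : 0 < r) (w : List (Euc d × Euc d)) :
    ∃ u : ℕ → ℝ, Summable u ∧ ∀ J, ∀ p ∈ {p : Euc d × Euc d | r < ‖p.1 - p.2‖},
      ‖iterDir w (kernelPiece h a J) p‖ ≤ u J := by
  refine summable_bound_of_span span_basis₂
    (fun J p _ => (contDiff_kernelPiece hh ha J).contDiffAt) (fun w hw => ?_) w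
  obtain ⟨C, hC, hb⟩ := exists_weighted_bound hω hh hρ₀ hρ₁ ha hr one_pos
  refine ⟨fun J => C * Real.exp (scaledConj ω 1 w.length) * (1 / 2) ^ J,
    (summable_geometric_of_lt_one (by norm_num) (by norm_num)).mul_left _, fun J p hp => ?_⟩
  refine (hb J p (le_of_lt hp) w hw).trans ?_
  beta_reduce
  have h1 : ∀ x : Euc d, Real.exp (-1 * ω ‖x‖) ≤ 1 := fun x =>
    Real.exp_le_one_iff.2 (by linarith [hω.nonneg _ (norm_nonneg x)])
  calc _ ≤ C * Real.exp (scaledConj ω 1 w.length) * 1 * 1 * (1 / 2) ^ J := by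
        gcongr <;> exact h1 _
    _ = _ := by ring

theorem contDiffOn_kernelSum (hω : IsWeight ω) (hh : IsCutoff ω h) (hρ₀ : 0 < ρ)
    (hρ₁ : ρ ≤ 1) (ha : IsAmplitude ω ρ m a) {r : ℝ} (hr : 0 < r) :
    ContDiffOn ℝ (⊤ : ℕ∞) (kernelSum h a) {p : Euc d × Euc d | r < ‖p.1 - p.2‖} :=
  contDiffOn_of_iterDir (isOpen_gap_gt r) fun w _ hp =>
    (iterDir_tsum (isOpen_gap_gt r) (fun J _ _ => (contDiff_kernelPiece hh ha J).contDiffAt)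
      (kernelPiece_summable_bound hω hh hρ₀ hρ₁ ha hr) w hp).2

theorem exists_kernelSum_bound (hω : IsWeight ω) (hh : IsCutoff ω h) (hρ₀ : 0 < ρ)
    (hρ₁ : ρ ≤ 1) (ha : IsAmplitude ω ρ m a) {r lam : ℝ} (hr : 0 < r) (hl : 0 < lam) :
    ∃ C : ℝ, 0 ≤ C ∧ ∀ p : Euc d × Euc d, r ≤ ‖p.1 - p.2‖ →
      DirBound (basis₂ d) (kernelSum h a) p fun n => C * Real.exp (scaledConj ω lam n) *
        Real.exp (-lam * ω ‖p.1‖) * Real.exp (-lam * ω ‖p.2‖) := by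
  obtain ⟨C, hC, hb⟩ := exists_weighted_bound hω hh hρ₀ hρ₁ ha hr hl
  refine ⟨C * 2, by positivity, fun p hp w hw => ?_⟩
  -- Half the gap makes the boundary points `|x - y| = r` interior, so termwise differentiation
  -- applies there.
  have hp' : p ∈ {p : Euc d × Euc d | r / 2 < ‖p.1 - p.2‖} := by
    change r / 2 < _
    linarith
  have h1 := (iterDir_tsum (isOpen_gap_gt (r / 2))
    (fun J _ _ => (contDiff_kernelPiece hh ha J).contDiffAt)
    (kernelPiece_summable_bound hω hh hρ₀ hρ₁ ha (half_pos hr)) w hp').1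
  have h2 : iterDir w (kernelSum h a) p = ∑' J, iterDir w (kernelPiece h a J) p := h1
  rw [h2]
  have h3 := hasSum_geometric_two.mul_left (C * Real.exp (scaledConj ω lam w.length) *
    Real.exp (-lam * ω ‖p.1‖) * Real.exp (-lam * ω ‖p.2‖))
  refine (tsum_of_norm_bounded h3 fun J => hb J p hp w hw).trans (le_of_eq ?_)
  ring

/-! ### Integrability of the slice pairing -/

variable {Φ : Euc d × Euc d → ℂ} {U : Set (Euc d × Euc d)}

theorem slicePairing_eq (ξ : Euc d) :
    slicePairing a Φ ξ = ∫ p : Euc d × Euc d, phase (p.1, p.2, ξ) * (a (p.1, p.2, ξ) * Φ p) := by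
  unfold slicePairing phase expI
  simp only [mul_assoc]

theorem IsTestFunction.dirBound (hΦ : IsTestFunction ω U Φ) {lam : ℝ} (hl : 0 < lam) :
    ∃ C : ℝ, 0 ≤ C ∧ ∀ p, DirBound (basis₂ d) Φ p
      fun n => C * Real.exp (scaledConj ω lam n) := by
  obtain ⟨C, hC⟩ := hΦ.2.2.2 lam hl
  refine ⟨C, ?_, fun p => dirBound_of_deriv₂ hΦ.1.contDiffAt fun α β => hC p α β⟩
  have h1 := (norm_nonneg _).trans (hC 0 0 0)
  exact nonneg_of_mul_nonneg_left h1 (Real.exp_pos _)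

theorem smooth_slice (ha : IsAmplitude ω ρ m a) (ξ : Euc d) :
    ContDiff ℝ (⊤ : ℕ∞) fun p : Euc d × Euc d => a (p.1, p.2, ξ) :=
  ha.1.comp (contDiff_fst.prodMk (contDiff_snd.prodMk contDiff_const))

/-- Derivatives of `(x, y) ↦ a(x, y, ξ) Φ(x, y)`. -/
theorem exists_slice_bound (hω : IsWeight ω) (hρ₀ : 0 < ρ) (hρ₁ : ρ ≤ 1)
    (ha : IsAmplitude ω ρ m a) (hΦ : IsTestFunction ω U Φ) {lam : ℝ} (hl : 0 < lam) :
    ∃ C : ℝ, 0 ≤ C ∧ ∀ (ξ : Euc d) (p : Euc d × Euc d),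
      DirBound (basis₂ d) (fun p => a (p.1, p.2, ξ) * Φ p) p
        fun n => C * Real.exp (|m| * ω ‖ξ‖) * 4 ^ n * Real.exp (scaledConj ω lam n) := by
  obtain ⟨C₁, hC₁, h1⟩ := ha.dirBound hω hρ₀ hl
  obtain ⟨C₂, hC₂, h2⟩ := hΦ.dirBound hl
  obtain ⟨S, hS⟩ := hΦ.2.1.isCompact.isBounded.exists_norm_le
  have hω0 : ∀ x : Euc d, 0 ≤ ω ‖x‖ := fun x => hω.nonneg _ (norm_nonneg x)
  refine ⟨C₁ * Real.exp (|m| * (2 * ω (max S 0))) * C₂, by positivity, fun ξ p => ?_⟩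
  have sa : SmoothAt (fun p : Euc d × Euc d => a (p.1, p.2, ξ)) p :=
    (smooth_slice ha ξ).contDiffAt
  by_cases hp : p ∈ tsupport Φ
  swap
  · intro w hw
    rw [iterDir_eq_zero ((notMem_tsupport_iff_eventuallyEq.1 hp).mono fun q hq => by simp [hq]),
      norm_zero]
    positivity
  have hpS := hS p hp
  have hm : m * (ω ‖p.1‖ + ω ‖p.2‖ + ω ‖ξ‖) ≤ |m| * (2 * ω (max S 0)) + |m| * ω ‖ξ‖ := by
    have h3 : ∀ x : Euc d, ‖x‖ ≤ ‖p‖ → ω ‖x‖ ≤ ω (max S 0) := fun x hx =>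
      hω.monotoneOn (norm_nonneg x) (le_max_right S 0) (hx.trans (hpS.trans (le_max_left _ _)))
    have h4 := h3 p.1 (norm_fst_le p)
    have h5 := h3 p.2 (norm_snd_le p)
    have h6 := hω0 p.1
    have h7 := hω0 p.2
    have h8 := hω0 ξ
    calc m * (ω ‖p.1‖ + ω ‖p.2‖ + ω ‖ξ‖) ≤ |m| * (ω ‖p.1‖ + ω ‖p.2‖ + ω ‖ξ‖) :=
          mul_le_mul_of_nonneg_right (le_abs_self m) (by positivity)
      _ ≤ |m| * (2 * ω (max S 0) + ω ‖ξ‖) := by gcongr; linarith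
      _ = _ := by ring
  have h3 : DirBound (basis₂ d) (fun q : Euc d × Euc d => a (q.1, q.2, ξ)) p
      fun n => (C₁ * Real.exp (|m| * (2 * ω (max S 0)) + |m| * ω ‖ξ‖)) * 2 ^ n *
        Real.exp (scaledConj ω lam n) := by
    intro w hw
    have h4 := iterDir_comp_affine (incl₂ d) (incl₃ d ξ) (f := a) (p := p) ha.1.contDiffAt w
    simp only [incl_add] at h4
    rw [h4]
    have h5 := h1 (p.1, p.2, ξ) (w.map (incl₂ d)) (fun v hv => by
      obtain ⟨u, hu, rfl⟩ := List.mem_map.1 hv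
      exact incl₂_mem (hw u hu))
    rw [List.length_map] at h5
    refine h5.trans ?_
    beta_reduce
    have hbr := one_le_bracket (p.1, p.2, ξ)
    have hQ := one_le_gapBracket (p.1, p.2, ξ)
    -- No gain from the amplitude is needed here; the decay in `ξ` will come from the phase alone.
    have h6 : (gapBracket (p.1, p.2, ξ) / bracket (p.1, p.2, ξ)) ^ (ρ * (w.length : ℝ)) ≤
        2 ^ w.length := by
      have h7 : gapBracket (p.1, p.2, ξ) / bracket (p.1, p.2, ξ) ≤ 2 := by
        rw [div_le_iff₀ (by linarith)]; exact gapBracket_le _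
      calc _ ≤ (2 : ℝ) ^ (ρ * (w.length : ℝ)) :=
            Real.rpow_le_rpow (by positivity) h7 (by positivity)
        _ ≤ (2 : ℝ) ^ (w.length : ℝ) :=
            Real.rpow_le_rpow_of_exponent_le one_le_two
              (mul_le_of_le_one_left (by positivity) hρ₁)
        _ = _ := Real.rpow_natCast _ _
    have h8 : ρ * scaledConj ω lam w.length ≤ scaledConj ω lam w.length :=
      mul_le_of_le_one_left (hω.scaledConj_nonneg hl (by positivity)) hρ₁
    calc _ ≤ C₁ * 2 ^ w.length * Real.exp (scaledConj ω lam w.length) *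
          Real.exp (|m| * (2 * ω (max S 0)) + |m| * ω ‖ξ‖) := by gcongr
      _ = _ := by ring
  have h4 : DirBound (basis₂ d) Φ p fun n => C₂ * 2 ^ n * Real.exp (scaledConj ω lam n) :=
    (h2 p).mono fun n => by
      have : (1 : ℝ) ≤ 2 ^ n := one_le_pow₀ one_le_two
      have h5 := Real.exp_pos (scaledConj ω lam n)
      refine mul_le_mul_of_nonneg_right ?_ h5.le
      exact le_mul_of_one_le_right hC₂ this
  refine (dirBound_geom_mul hω hl (by positivity) hC₂ (by positivity) h3 h4 sa
    hΦ.1.contDiffAt).mono fun n => le_of_eq ?_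
  rw [Real.exp_add]
  norm_num
  ring

theorem dirDeriv_phase_fst (ξ : Euc d) (l : Fin d) (p : Euc d × Euc d) :
    dirDeriv (stdVec l, 0) (fun p : Euc d × Euc d => phase (p.1, p.2, ξ)) p =
      (Complex.I * (ξ l : ℂ)) * phase (p.1, p.2, ξ) := by
  have h1 := dirDeriv_comp_affine (phaseForm ξ) 0 (f := expI) (p := p)
    contDiff_expI.contDiffAt ((stdVec l, 0) : Euc d × Euc d)
  simp only [add_zero, ← phase_eq] at h1
  refine h1.eq_of_nhds.trans ?_
  have h3 : phaseForm ξ ((stdVec l, 0) : Euc d × Euc d) = ξ l := by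
    change inner ℝ ξ (stdVec l - 0) = ξ l
    rw [sub_zero, stdVec, EuclideanSpace.inner_single_right]
    simp
  rw [h3, dirDeriv, fderiv_eq_smul_deriv, (hasDerivAt_expI _).deriv, phase_eq]
  simp only [Complex.real_smul]
  ring

/-- For `|ξ| > 1`, integrate by parts in `x_l` with `|ξ_l|` comparable to `|ξ|`, the order being
optimal for `R = |ξ|`. -/
theorem exists_slicePairing_bound (hω : IsWeight ω) (hρ₀ : 0 < ρ) (hρ₁ : ρ ≤ 1)
    (ha : IsAmplitude ω ρ m a) (hΦ : IsTestFunction ω U Φ) :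
    ∃ C : ℝ, ∀ ξ : Euc d, ‖slicePairing a Φ ξ‖ ≤ C * (1 + ‖ξ‖) ^ (-(d + 1 : ℝ)) := by
  set B : ℝ := 4 * (d + 1) with hB
  have hB1 : 1 ≤ B := by
    have : (0 : ℝ) ≤ d := by positivity
    rw [hB]; linarith
  -- Used with `ρ = 1` and all `N` derivatives in the second slot. In `B`, `4` comes from
  -- `exists_slice_bound` and `d + 1` from the choice of `l`; `|m|` cancels the growth of `a` in
  -- `ξ`, and `d + 1` leaves an integrable power.
  obtain ⟨lam, C₀, hl, hord⟩ := hω.exists_order_decay one_pos le_rfl hB1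
    (μ := |m| + (d + 1)) (by positivity)
  obtain ⟨C₁, hC₁, hb⟩ := exists_slice_bound hω hρ₀ hρ₁ ha hΦ hl
  obtain ⟨C₂, hC₂, hlog⟩ := hω.exists_log_le one_pos
  have : (volume : Measure (Euc d × Euc d)).IsAddHaarMeasure := by
    rw [Measure.volume_eq_prod]
    infer_instance
  set v := volume.real (tsupport Φ) with hv
  have hv0 : 0 ≤ v := measureReal_nonneg
  have hcs : ∀ ξ, HasCompactSupport fun p : Euc d × Euc d => a (p.1, p.2, ξ) * Φ p :=
    fun ξ => hΦ.2.1.mul_left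
  have hbs : ∀ ξ, ContDiff ℝ (⊤ : ℕ∞) fun p : Euc d × Euc d => a (p.1, p.2, ξ) * Φ p :=
    fun ξ => (smooth_slice ha ξ).mul hΦ.1
  -- the bound for the integral after differentiation
  have key : ∀ (ξ : Euc d) (w : List (Euc d × Euc d)), (∀ u ∈ w, u ∈ basis₂ d) →
      ‖∫ p : Euc d × Euc d, phase (p.1, p.2, ξ) *
        iterDir w (fun p => a (p.1, p.2, ξ) * Φ p) p‖ ≤
      (C₁ * Real.exp (|m| * ω ‖ξ‖) * 4 ^ w.length * Real.exp (scaledConj ω lam w.length)) * v := by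
    intro ξ w hw
    rw [← setIntegral_eq_integral_of_forall_compl_eq_zero (s := tsupport Φ) fun p hp => by
      rw [iterDir_eq_zero ((notMem_tsupport_iff_eventuallyEq.1 hp).mono fun q hq => by simp [hq]),
        mul_zero]]
    refine norm_setIntegral_le_of_norm_le_const hΦ.2.1.isCompact.measure_lt_top fun p _ => ?_
    rw [norm_mul, phase, norm_expI, one_mul]
    exact hb ξ p w hw
  have hpow : ∀ x : ℝ, 0 < x → x ^ (-(d + 1 : ℝ)) = (x ^ (d + 1))⁻¹ := fun x hx => by
    rw [Real.rpow_neg hx.le, ← Nat.cast_succ, Real.rpow_natCast]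
  refine ⟨C₁ * v * 2 ^ (d + 1) + C₁ * v * Real.exp (C₀ + (d + 1) * C₂) * 2 ^ (d + 1),
    fun ξ => ?_⟩
  rw [hpow _ (by positivity), ← div_eq_mul_inv, le_div_iff₀ (by positivity)]
  rcases le_or_gt ‖ξ‖ 1 with hξ | hξ
  · have h1 := key ξ [] (by simp)
    rw [hω.zero_of_le_one _ (norm_nonneg ξ) hξ] at h1
    simp only [iterDir_nil, List.length_nil, pow_zero, mul_zero, Real.exp_zero, mul_one,
      Nat.cast_zero, ← slicePairing_eq] at h1
    have h2 : Real.exp (scaledConj ω lam 0) ≤ 1 :=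
      Real.exp_le_one_iff.2 (hω.scaledConj_zero_le hl)
    have h3 : (1 + ‖ξ‖) ^ (d + 1) ≤ 2 ^ (d + 1) :=
      pow_le_pow_left₀ (by positivity) (by linarith) _
    calc ‖slicePairing a Φ ξ‖ * (1 + ‖ξ‖) ^ (d + 1)
        ≤ (C₁ * 1 * v) * 2 ^ (d + 1) := by
          gcongr; exact h1.trans (by gcongr)
      _ ≤ _ := by
        have : 0 ≤ C₁ * v * Real.exp (C₀ + (d + 1) * C₂) * 2 ^ (d + 1) := by positivity
        linarith
  · obtain ⟨l, hlc⟩ := exists_le_abs_coord (x := ξ) (by linarith)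
    obtain ⟨N, hN⟩ := hord _ hξ.le
    have h1 := integral_mul_eq_iterDir (μ := (volume : Measure (Euc d × Euc d)))
      (e := fun p : Euc d × Euc d => phase (p.1, p.2, ξ))
      (b := fun p => a (p.1, p.2, ξ) * Φ p) (v := (stdVec l, 0)) (c := Complex.I * (ξ l : ℂ))
      (contDiff_phase.comp (contDiff_fst.prodMk (contDiff_snd.prodMk contDiff_const)))
      (dirDeriv_phase_fst ξ l) (hbs ξ) (hcs ξ) N
    have h2 := key ξ (List.replicate N (stdVec l, 0)) fun u hu => by
      rw [List.eq_of_mem_replicate hu]; exact Or.inl ⟨l, rfl⟩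
    rw [← h1, ← slicePairing_eq, List.length_replicate, norm_mul, norm_pow] at h2
    have h3 : ‖-(Complex.I * (ξ l : ℂ))‖ = |ξ l| := by simp
    rw [h3] at h2
    have h4 : ‖ξ‖ ^ N * ‖slicePairing a Φ ξ‖ ≤
        C₁ * v * Real.exp (|m| * ω ‖ξ‖) * (B ^ N * Real.exp (scaledConj ω lam N)) := by
      calc ‖ξ‖ ^ N * ‖slicePairing a Φ ξ‖ ≤ ((d + 1) * |ξ l|) ^ N * ‖slicePairing a Φ ξ‖ := by
            gcongr
        _ = (d + 1) ^ N * (|ξ l| ^ N * ‖slicePairing a Φ ξ‖) := by rw [mul_pow]; ring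
        _ ≤ (d + 1) ^ N * ((C₁ * Real.exp (|m| * ω ‖ξ‖) * 4 ^ N *
            Real.exp (scaledConj ω lam N)) * v) := by gcongr
        _ = _ := by rw [hB, mul_pow]; ring
    have h5 := hN lam le_rfl 0 N (by simp)
    have h6 := hω.scaledConj_nonneg hl (k := ((0 : ℕ) : ℝ)) (by simp)
    have hξ0 : 0 < ‖ξ‖ := by linarith
    have h7 : B ^ N * Real.exp (scaledConj ω lam N) ≤
        Real.exp (C₀ - (|m| + (d + 1)) * ω ‖ξ‖) * ‖ξ‖ ^ N := by
      rw [← Real.exp_log (pow_pos hξ0 N), ← Real.exp_log (pow_pos (show 0 < B by linarith) N),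
        Real.log_pow, Real.log_pow, ← Real.exp_add, ← Real.exp_add, Real.exp_le_exp]
      simp only [Nat.cast_zero, zero_mul, sub_zero, one_mul] at h5 h6
      linarith
    have h8 : ‖slicePairing a Φ ξ‖ ≤ C₁ * v * Real.exp (C₀ - (d + 1) * ω ‖ξ‖) := by
      have h9 : ‖ξ‖ ^ N * ‖slicePairing a Φ ξ‖ ≤
          ‖ξ‖ ^ N * (C₁ * v * Real.exp (C₀ - (d + 1) * ω ‖ξ‖)) := by
        refine h4.trans ?_
        calc _ ≤ C₁ * v * Real.exp (|m| * ω ‖ξ‖) *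
              (Real.exp (C₀ - (|m| + (d + 1)) * ω ‖ξ‖) * ‖ξ‖ ^ N) := by gcongr
          _ = ‖ξ‖ ^ N * (C₁ * v * (Real.exp (|m| * ω ‖ξ‖) *
              Real.exp (C₀ - (|m| + (d + 1)) * ω ‖ξ‖))) := by ring
          _ = _ := by rw [← Real.exp_add]; congr 3; ring
      exact le_of_mul_le_mul_left h9 (pow_pos hξ0 N)
    have h10 : (1 + ‖ξ‖) ^ (d + 1) ≤ 2 ^ (d + 1) * Real.exp ((d + 1) * ω ‖ξ‖ + (d + 1) * C₂) := by
      calc (1 + ‖ξ‖) ^ (d + 1) ≤ (2 * ‖ξ‖) ^ (d + 1) :=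
            pow_le_pow_left₀ (by positivity) (by linarith) _
        _ = 2 ^ (d + 1) * ‖ξ‖ ^ (d + 1) := mul_pow _ _ _
        _ ≤ _ := by
          gcongr
          rw [← Real.log_le_iff_le_exp (by positivity), Real.log_pow]
          have := hlog _ hξ.le
          push_cast
          have h0 : (0 : ℝ) ≤ d + 1 := by positivity
          nlinarith
    calc ‖slicePairing a Φ ξ‖ * (1 + ‖ξ‖) ^ (d + 1)
        ≤ (C₁ * v * Real.exp (C₀ - (d + 1) * ω ‖ξ‖)) *
          (2 ^ (d + 1) * Real.exp ((d + 1) * ω ‖ξ‖ + (d + 1) * C₂)) := by gcongr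
      _ = C₁ * v * (Real.exp (C₀ - (d + 1) * ω ‖ξ‖) *
          Real.exp ((d + 1) * ω ‖ξ‖ + (d + 1) * C₂)) * 2 ^ (d + 1) := by ring
      _ = C₁ * v * Real.exp (C₀ + (d + 1) * C₂) * 2 ^ (d + 1) := by
          rw [← Real.exp_add]; congr 3; ring
      _ ≤ _ := by
        have : 0 ≤ C₁ * v * 2 ^ (d + 1) := by positivity
        linarith

theorem integrable_slicePairing (hω : IsWeight ω) (hρ₀ : 0 < ρ) (hρ₁ : ρ ≤ 1)
    (ha : IsAmplitude ω ρ m a) (hΦ : IsTestFunction ω U Φ) : Integrable (slicePairing a Φ) := by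
  obtain ⟨C, hC⟩ := exists_slicePairing_bound hω hρ₀ hρ₁ ha hΦ
  have hcont : Continuous (slicePairing a Φ) := by
    have h1 : ∀ ξ, slicePairing a Φ ξ = ∫ p in tsupport Φ,
        phase (p.1, p.2, ξ) * (a (p.1, p.2, ξ) * Φ p) := fun ξ => by
      rw [slicePairing_eq, setIntegral_eq_integral_of_forall_compl_eq_zero]
      intro p hp
      rw [image_eq_zero_of_notMem_tsupport hp]; simp
    rw [funext h1]
    have h2 : Continuous fun x : Euc d × (Euc d × Euc d) => (x.2.1, x.2.2, x.1) := by fun_prop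
    refine continuous_parametric_integral_of_continuous
      (f := fun ξ p => phase (p.1, p.2, ξ) * (a (p.1, p.2, ξ) * Φ p)) ?_ hΦ.2.1.isCompact
    exact (contDiff_phase.continuous.comp h2).mul
      ((ha.1.continuous.comp h2).mul (hΦ.1.continuous.comp continuous_snd))
  refine Integrable.mono' ((integrable_one_add_norm (E := Euc d) (r := (d + 1 : ℝ)) ?_).const_mul C)
    hcont.aestronglyMeasurable (Eventually.of_forall hC)
  rw [finrank_euclideanSpace_fin]
  linarith

end

noncomputable section

/-! ### The pairing with test functions supported off the diagonal -/

variable {d : ℕ} {ω : ℝ → ℝ} {h : ℝ → ℂ} {ρ m : ℝ} {a : Euc d × Euc d × Euc d → ℂ}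
  {Φ : Euc d × Euc d → ℂ} {U : Set (Euc d × Euc d)}

theorem IsTestFunction.exists_gap (hΦ : IsTestFunction ω {p : Euc d × Euc d | p.1 ≠ p.2} Φ) :
    ∃ r : ℝ, 0 < r ∧ ∀ p ∈ tsupport Φ, r ≤ ‖p.1 - p.2‖ := by
  rcases (tsupport Φ).eq_empty_or_nonempty with he | hne
  · exact ⟨1, one_pos, fun p hp => by simp [he] at hp⟩
  · obtain ⟨q, hq, hmin⟩ := hΦ.2.1.isCompact.exists_isMinOn hne
      (f := fun p : Euc d × Euc d => ‖p.1 - p.2‖) (by fun_prop)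
    exact ⟨‖q.1 - q.2‖, norm_pos_iff.2 (sub_ne_zero.2 (hΦ.2.2.1 hq)), fun p hp => hmin hp⟩

/-- The integrand of the pairing of a piece of the kernel with a test function. -/
def pairingPiece (h : ℝ → ℂ) (a : Euc d × Euc d × Euc d → ℂ) (Φ : Euc d × Euc d → ℂ) (J : ℕ)
    (z : (Euc d × Euc d) × Euc d) : ℂ :=
  phase (z.1.1, z.1.2, z.2) * (shellCut h J (z.1.1, z.1.2, z.2) * a (z.1.1, z.1.2, z.2)) * Φ z.1

theorem integrable_pairingPiece (hh : IsCutoff ω h) (ha : IsAmplitude ω ρ m a)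
    (hΦ : IsTestFunction ω U Φ) (J : ℕ) :
    Integrable (pairingPiece h a Φ J) ((volume : Measure (Euc d × Euc d)).prod volume) := by
  have h1 : Continuous fun z : (Euc d × Euc d) × Euc d => (z.1.1, z.1.2, z.2) := by fun_prop
  have hc : Continuous (pairingPiece h a Φ J) :=
    ((contDiff_phase.continuous.comp h1).mul ((contDiff_shell_mul hh ha J).continuous.comp h1)).mul
      (hΦ.1.continuous.comp continuous_fst)
  refine hc.integrable_of_hasCompactSupport (HasCompactSupport.intro
    (hΦ.2.1.isCompact.prod (isCompact_closedBall (0 : Euc d) ((4 * d + 1) * 2 ^ J)))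
    fun z hz => ?_)
  rw [mem_prod, not_and_or] at hz
  rcases hz with hz | hz
  · rw [pairingPiece, image_eq_zero_of_notMem_tsupport hz, mul_zero]
  · rw [pairingPiece, (hh.shellCut_eq_zero (p := z.1) hz).eq_of_nhds]
    simp only [zero_mul, mul_zero]

theorem integral_kernelPiece_mul (hh : IsCutoff ω h) (ha : IsAmplitude ω ρ m a)
    (hΦ : IsTestFunction ω U Φ) (J : ℕ) :
    ∫ p, kernelPiece h a J p * Φ p =
      ∫ z, pairingPiece h a Φ J z ∂(volume : Measure (Euc d × Euc d)).prod volume := by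
  rw [integral_prod _ (integrable_pairingPiece hh ha hΦ J)]
  refine integral_congr_ae (Eventually.of_forall fun p => ?_)
  exact (integral_mul_const (Φ p) _).symm

theorem abs_apply_le_norm (x : Euc d) (i : Fin d) : |x i| ≤ ‖x‖ := PiLp.norm_apply_le x i

theorem abs_inv_mul_le_one {R t : ℝ} (hR : 0 < R) (ht : |t| ≤ R) : |R⁻¹ * t| ≤ 1 := by
  rw [abs_mul, abs_of_pos (inv_pos.2 hR), ← div_eq_inv_mul]
  exact div_le_one_of_le₀ ht hR.le

/-- The factors in `x` and `y` equal `1` there, so on the support of a test function the cut-off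
eventually truncates `ξ` only. -/
theorem IsCutoff.tensorCut_eq (hh : IsCutoff ω h) {J : ℕ} {p : Euc d × Euc d} (hp : ‖p‖ ≤ 2 ^ J)
    (ξ : Euc d) : tensorCut h J (p.1, p.2, ξ) = tensorCut h J (0, 0, ξ) := by
  have h0 : h 0 = 1 := hh.eq_one 0 (by simp)
  have h1 : ∀ x : Euc d, ‖x‖ ≤ 2 ^ J → ∀ i, h (((2 : ℝ) ^ J)⁻¹ * x i) = 1 := fun x hx i =>
    hh.eq_one _ (abs_inv_mul_le_one (by positivity) ((abs_apply_le_norm x i).trans hx))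
  refine Finset.prod_congr rfl fun i _ => ?_
  rcases i with i | i | i
  · simp [h0, h1 p.1 ((norm_fst_le p).trans hp) i]
  · simp [h0, h1 p.2 ((norm_snd_le p).trans hp) i]
  · simp

theorem IsCutoff.tensorCut_eq_one (hh : IsCutoff ω h) {J : ℕ} {ξ : Euc d} (hξ : ‖ξ‖ ≤ 2 ^ J) :
    tensorCut h J (0, 0, ξ) = 1 := by
  refine Finset.prod_eq_one fun i _ => hh.eq_one _ ?_
  rcases i with i | i | i
  · simp
  · simp
  · exact abs_inv_mul_le_one (by positivity) ((abs_apply_le_norm ξ i).trans hξ)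

theorem IsCutoff.exists_norm_tensorCut_le (hh : IsCutoff ω h) :
    ∃ C : ℝ, ∀ (J : ℕ) (z : Euc d × Euc d × Euc d), ‖tensorCut h J z‖ ≤ C := by
  obtain ⟨C, _, hb⟩ := hh.bound 1 one_pos
  refine ⟨∏ _i : Fin d ⊕ Fin d ⊕ Fin d, C * Real.exp (scaledConj ω 1 (0 : ℕ)), fun J z => ?_⟩
  rw [tensorCut, norm_prod]
  refine Finset.prod_le_prod (fun _ _ => norm_nonneg _) fun i _ => ?_
  have h1 := hb 0 ((((2 : ℝ) ^ J)⁻¹ • coordForm i) z)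
  rwa [iteratedDeriv_zero] at h1

/-- After Fubini the shells telescope, so a partial sum of pairings is the defining `ξ` integral
with a smooth truncation. -/
theorem sum_integral_kernelPiece (hh : IsCutoff ω h) (ha : IsAmplitude ω ρ m a)
    (hΦ : IsTestFunction ω U Φ) {J : ℕ} (hJ : ∀ p ∈ tsupport Φ, ‖p‖ ≤ 2 ^ J) :
    ∑ j ∈ Finset.range (J + 1), ∫ p, kernelPiece h a j p * Φ p =
      ∫ ξ, tensorCut h J (0, 0, ξ) * slicePairing a Φ ξ := by
  have hint := fun j => integrable_pairingPiece hh ha hΦ j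
  simp only [integral_kernelPiece_mul hh ha hΦ]
  rw [← integral_finsetSum _ fun j _ => hint j,
    integral_prod_symm _ (integrable_finsetSum _ fun j _ => hint j)]
  refine integral_congr_ae (Eventually.of_forall fun ξ => ?_)
  beta_reduce
  rw [slicePairing_eq, ← integral_const_mul]
  refine integral_congr_ae (Eventually.of_forall fun p => ?_)
  beta_reduce
  by_cases hp : p ∈ tsupport Φ
  · simp only [pairingPiece, ← Finset.sum_mul, ← Finset.mul_sum, sum_shellCut]
    rw [hh.tensorCut_eq (hJ p hp)]
    ring
  · simp only [pairingPiece, image_eq_zero_of_notMem_tsupport hp, mul_zero, Finset.sum_const_zero]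

/-- The truncations are uniformly bounded and eventually `1` at each `ξ`, and the slice pairing is
integrable. -/
theorem tendsto_integral_tensorCut (hh : IsCutoff ω h) (hint : Integrable (slicePairing a Φ)) :
    Tendsto (fun J => ∫ ξ, tensorCut h J (0, 0, ξ) * slicePairing a Φ ξ) atTop
      (𝓝 (formalKernel a Φ)) := by
  obtain ⟨C, hC⟩ := hh.exists_norm_tensorCut_le (d := d)
  have hc : ∀ J, Continuous fun ξ : Euc d => tensorCut h J (0, 0, ξ) := fun J =>
    (hh.contDiff_tensorCut J).continuous.comp (by fun_prop)
  refine tendsto_integral_of_dominated_convergence (fun ξ => C * ‖slicePairing a Φ ξ‖)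
    (fun J => (hc J).aestronglyMeasurable.mul hint.aestronglyMeasurable) (hint.norm.const_mul C)
    (fun J => Eventually.of_forall fun ξ => ?_) (Eventually.of_forall fun ξ => ?_)
  · rw [norm_mul]
    exact mul_le_mul_of_nonneg_right (hC J _) (norm_nonneg _)
  · refine tendsto_const_nhds.congr' ?_
    filter_upwards [(tendsto_pow_atTop_atTop_of_one_lt (one_lt_two (α := ℝ))).eventually_ge_atTop
      ‖ξ‖] with J hJ
    rw [hh.tensorCut_eq_one hJ, one_mul]

/-- The support of `Φ` keeps a positive distance from the diagonal, where the pieces are `O(2^{-J})`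
uniformly. -/
theorem hasSum_integral_kernelPiece (hω : IsWeight ω) (hh : IsCutoff ω h) (hρ₀ : 0 < ρ)
    (hρ₁ : ρ ≤ 1) (ha : IsAmplitude ω ρ m a)
    (hΦ : IsTestFunction ω {p : Euc d × Euc d | p.1 ≠ p.2} Φ) :
    HasSum (fun J => ∫ p, kernelPiece h a J p * Φ p) (∫ p, kernelSum h a p * Φ p) := by
  have : (volume : Measure (Euc d × Euc d)).IsAddHaarMeasure := by
    rw [Measure.volume_eq_prod]
    infer_instance
  obtain ⟨r, hr, hgap⟩ := hΦ.exists_gap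
  obtain ⟨C, hC, hb⟩ := exists_weighted_bound hω hh hρ₀ hρ₁ ha hr one_pos
  have hΦi : Integrable Φ := hΦ.1.continuous.integrable_of_hasCompactSupport hΦ.2.1
  have hi : ∀ J, Integrable fun p => kernelPiece h a J p * Φ p := fun J =>
    ((contDiff_kernelPiece hh ha J).continuous.mul
      hΦ.1.continuous).integrable_of_hasCompactSupport hΦ.2.1.mul_left
  have hn : ∀ J p, ‖kernelPiece h a J p * Φ p‖ ≤ C * (1 / 2) ^ J * ‖Φ p‖ := by
    intro J p
    rw [norm_mul]
    by_cases hp : p ∈ tsupport Φ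
    · refine mul_le_mul_of_nonneg_right ?_ (norm_nonneg _)
      refine (hb J p (hgap p hp) [] (by simp)).trans ?_
      beta_reduce
      have h1 : ∀ x : Euc d, Real.exp (-1 * ω ‖x‖) ≤ 1 := fun x =>
        Real.exp_le_one_iff.2 (by linarith [hω.nonneg _ (norm_nonneg x)])
      have h2 : Real.exp (scaledConj ω 1 ((List.length ([] : List (Euc d × Euc d)) : ℕ) : ℝ)) ≤ 1 :=
        Real.exp_le_one_iff.2 (by simpa using hω.scaledConj_zero_le one_pos)
      calc _ ≤ C * 1 * 1 * 1 * (1 / 2) ^ J := by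
            gcongr
            · exact h1 _
            · exact h1 _
        _ = _ := by ring
    · rw [image_eq_zero_of_notMem_tsupport hp, norm_zero, mul_zero, mul_zero]
  have hs : Summable fun J => ∫ p, ‖kernelPiece h a J p * Φ p‖ := by
    refine Summable.of_nonneg_of_le (fun J => integral_nonneg fun p => norm_nonneg _) (fun J => ?_)
      (((summable_geometric_of_lt_one (r := (1 : ℝ) / 2) (by norm_num) (by norm_num)).mul_left
        C).mul_right (∫ p, ‖Φ p‖))
    rw [← integral_const_mul]
    exact integral_mono (hi J).norm (hΦi.norm.const_mul _) (hn J)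
  have h1 := hasSum_integral_of_summable_integral_norm hi hs
  simp only [tsum_mul_right] at h1
  exact h1

theorem formalKernel_eq_integral (hω : IsWeight ω) (hh : IsCutoff ω h) (hρ₀ : 0 < ρ)
    (hρ₁ : ρ ≤ 1) (ha : IsAmplitude ω ρ m a)
    (hΦ : IsTestFunction ω {p : Euc d × Euc d | p.1 ≠ p.2} Φ) :
    formalKernel a Φ = ∫ p, kernelSum h a p * Φ p := by
  obtain ⟨S, hS⟩ := hΦ.2.1.isCompact.isBounded.exists_norm_le
  have h1 := (hasSum_integral_kernelPiece hω hh hρ₀ hρ₁ ha hΦ).tendsto_sum_nat.comp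
    (tendsto_add_atTop_nat 1)
  refine tendsto_nhds_unique (tendsto_integral_tensorCut hh
    (integrable_slicePairing hω hρ₀ hρ₁ ha hΦ)) (h1.congr' ?_)
  filter_upwards [(tendsto_pow_atTop_atTop_of_one_lt (one_lt_two (α := ℝ))).eventually_ge_atTop S]
    with J hJ
  exact sum_integral_kernelPiece hh ha hΦ fun p hp => (hS p hp).trans hJ

end

end FormalKernel

/-! ### Assembly of the theorem -/

theorem theorem5p2 (d : ℕ) (ω : ℝ → ℝ) (hω : FormalKernel.IsWeight ω)
    (ρ m : ℝ) (hρ₀ : 0 < ρ) (hρ₁ : ρ ≤ 1)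
    (a : FormalKernel.Euc d × FormalKernel.Euc d × FormalKernel.Euc d → ℂ)
    (ha : FormalKernel.IsAmplitude ω ρ m a) :
    -- the integral over `ξ` that defines the formal kernel converges on all test functions
    (∀ Φ, FormalKernel.IsTestFunction ω univ Φ → Integrable (FormalKernel.slicePairing a Φ)) ∧
    -- off the diagonal the formal kernel is a function `K` ...
    ∃ K : FormalKernel.Euc d × FormalKernel.Euc d → ℂ,
      (∀ Φ, FormalKernel.IsTestFunction ω {p | p.1 ≠ p.2} Φ →
        FormalKernel.formalKernel a Φ = ∫ p, K p * Φ p) ∧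
      -- ... which is smooth off the closed strip, with decay of all derivatives, for every width
      ∀ r : ℝ, 0 < r →
        ContDiffOn ℝ (⊤ : ℕ∞) K (closure (FormalKernel.strip d r))ᶜ ∧
        ∀ lam : ℝ, 0 < lam → ∃ C : ℝ, 0 < C ∧
          ∀ (x y : FormalKernel.Euc d), (x, y) ∉ FormalKernel.strip d r →
            ∀ α β : Fin d → ℕ,
              ‖FormalKernel.deriv₂ α β K (x, y)‖ ≤
                C * Real.exp (lam * FormalKernel.youngConj ω
                      (((FormalKernel.len α + FormalKernel.len β : ℕ) : ℝ) / lam))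
                  * Real.exp (-lam * ω ‖x‖) * Real.exp (-lam * ω ‖y‖) := by
  obtain ⟨h, hh⟩ := hω.exists_isCutoff
  refine ⟨fun Φ hΦ => FormalKernel.integrable_slicePairing hω hρ₀ hρ₁ ha hΦ,
    FormalKernel.kernelSum h a,
    fun Φ hΦ => FormalKernel.formalKernel_eq_integral hω hh hρ₀ hρ₁ ha hΦ, fun r hr => ⟨?_, ?_⟩⟩
  -- Off the closed strip `|x - y| ≥ r`, hence the strict inequality with `r / 2`. The same series
  -- serves every `r`.
  · refine (FormalKernel.contDiffOn_kernelSum hω hh hρ₀ hρ₁ ha (half_pos hr)).mono fun p hp => ?_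
    have h1 : p ∉ FormalKernel.strip d r := fun hp' => hp (subset_closure hp')
    have h2 : r ≤ ‖p.1 - p.2‖ := not_lt.1 h1
    change r / 2 < ‖p.1 - p.2‖
    linarith
  · intro lam hl
    obtain ⟨C, hC, hb⟩ := FormalKernel.exists_kernelSum_bound hω hh hρ₀ hρ₁ ha hr hl
    refine ⟨C + 1, by positivity, fun x y hxy α β => ?_⟩
    have h1 := (hb (x, y) (not_lt.1 hxy)).deriv₂_le α β
    refine h1.trans ?_
    rw [FormalKernel.scaledConj]
    gcongr
    linarith
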